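/- **Theorem (Local SGD convergence).** Let $K\ge 1$ devices be given; device $i$ holds a shard $S_i=\{(x_{i,j},y_{i,j})\}_{j=1}^n$, $n\ge1$, with $x_{i,j}\in\mathbb R^d$, $\|x_{i,j}\|=1$ and $|y_{i,j}|\le B$. Assume that the inputs of all shards are separated: for some $\varphi>0$ and any two distinct index pairs, $\|x_{i,j}-x_{i',j'}\|\ge\varphi$ and $\|x_{i,j}+x_{i',j'}\|\ge\kappa\varphi$, where $\kappa>0$ is a constant. Consider the two-layer ReLU network $f(W,v,x)=v^\top\sigma(Wx)$ with $m\ge2$ hidden neurons, $W\in\mathbb R^{m\times d}$, $\sigma(z)=\max(z,0)$, the loss $\ell(W;x,y)=\tfrac12(f(W,v,x)-y)^2$, $L_i(W)=\sum_{j=1}^n\ell(W;x_{i,j},y_{i,j})$ and $L(W)=\frac1K\sum_{i=1}^K L_i(W)$. The entries of $W(0)$ are i.i.d. $N(0,2/m)$, and those of $v$ (which is not trained) are i.i.d. $N(0,1/d)$, independent of $W(0)$. Local SGD with step size $\eta>0$ and synchronization period $\tau\ge1$ starts from $W^{(i)}(0)=W(0)$. At each step $t$ each device $i$ draws an index $j$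 uniformly from $\{1,\dots,n\}$, independently over steps and devices and independently of $(W(0),v)$, and moves from $W^{(i)}(t)$ to $W^{(i)}(t)-\eta\, n\nabla_W\ell(W^{(i)}(t);x_{i,j},y_{i,j})$, where $\nabla_W\ell(W;x,y)=(f(W,v,x)-y)\,D\,v\,x^\top$, $D=\mathrm{diag}(\sigma'(\langle W_r,x\rangle))$, $\sigma'(z)=\mathbf 1[z>0]$; if $\tau$ divides $t+1$, all local models are then replaced by their average. Let $W(t)=\frac1K\sum_{i=1}^K W^{(i)}(t)$. There are constants $c,C>0$ depending only on $K$, $B$, $\kappa$ such that the following holds. Suppose $$m\ge\frac{d\,n^{25}(\log m)^3}{\varphi^4},\qquad T\ge\frac{d\,n^{45/2}(\log T)^3\,\tau\,(\log m)^{3/2}}{\varphi^{11/2}},\qquad 0<\eta\le\frac{d\,n^2\log T}{m\varphi T},$$ and let $\omega=C\varphi^{3/2}n^{-9}(\log m)^{-3/2}$. Then with probability at least $1-C/n$ (over $W(0)$, $v$ and the samples), simultaneously for all $0\le t\le T$: 1. $\|W(t)-W(0)\|_F\le\omega$ and $\|W^{(i)}(t)-W(0)\|_F\le\omega$ for every $i$;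 2. $$L(W(t))\le\Big(1-c\,\frac{\eta m\varphi}{dn^2}\Big)^t n\,L(W(0))+\exp\!\Big[C\frac{d^{1/2}n^{10}}{m^{1/2}\varphi^{5/2}}\Big]\cdot C\Big(\frac{m^{7/2}n^{11}\tau^3\eta^3}{d^3\varphi^{3/2}}+\frac{m^{3/2}n^9\tau\eta}{d^{1/2}\varphi^{3/2}}\Big)L(W(0)).$$ -/

import Mathlib

open MeasureTheory ProbabilityTheory
open scoped NNReal

noncomputable section

namespace LocalSGD

/-- First-layer weights of a two-layer network with `m` hidden neurons and input dimension `d`;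
row `r` is the weight vector of neuron `r`. -/
abbrev Weights (m d : ℕ) : Type := Fin m → Fin d → ℝ

/-- The Frobenius norm of a weight matrix. -/
def frobNorm {m d : ℕ} (W : Weights m d) : ℝ := √(∑ r, ∑ k, W r k ^ 2)

/-- The ReLU activation. -/
def relu (z : ℝ) : ℝ := max z 0

/-- The derivative of ReLU, with the convention that it vanishes at `0`. -/
def reluDeriv (z : ℝ) : ℝ := if 0 < z then 1 else 0

/-- The pre-activation `⟨W_r, x⟩` of neuron `r`. -/
def preact {m d : ℕ} (W : Weights m d) (x : EuclideanSpace ℝ (Fin d)) (r : Fin m) : ℝ :=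
  ∑ k, W r k * x k

/-- The network `f(W, v, x) = vᵀ σ(W x)`. -/
def network {m d : ℕ} (v : Fin m → ℝ) (W : Weights m d) (x : EuclideanSpace ℝ (Fin d)) : ℝ :=
  ∑ r, v r * relu (preact W x r)

/-- The squared loss `ℓ(W; x, y) = (f(W, v, x) - y)² / 2` at one data point. -/
def pointLoss {m d : ℕ} (v : Fin m → ℝ) (W : Weights m d) (x : EuclideanSpace ℝ (Fin d))
    (y : ℝ) : ℝ :=
  (network v W x - y) ^ 2 / 2

/-- The (sub)gradient in `W` of the loss at one data point, as computed by back-propagation: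
`(f(W, v, x) - y) • D v xᵀ`, where `D` is the diagonal matrix with entries `σ'(⟨W_r, x⟩)`. -/
def pointGrad {m d : ℕ} (v : Fin m → ℝ) (W : Weights m d) (x : EuclideanSpace ℝ (Fin d))
    (y : ℝ) : Weights m d :=
  fun r k => (network v W x - y) * (reluDeriv (preact W x r) * v r) * x k

/-- The global loss `L(W) = (1/K) ∑ i, L_i(W)`, where the local loss `L_i` of device `i` is the sum
of the losses at the `n` points of its shard. -/
def globalLoss {K n m d : ℕ} (x : Fin K → Fin n → EuclideanSpace ℝ (Fin d))
    (y : Fin K → Fin n → ℝ) (v : Fin m → ℝ) (W : Weights m d) : ℝ :=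
  (K : ℝ)⁻¹ * ∑ i, ∑ j, pointLoss v W (x i j) (y i j)

/-- The average of the models of the `K` devices. -/
def average {K m d : ℕ} (U : Fin K → Weights m d) : Weights m d :=
  (K : ℝ)⁻¹ • ∑ i, U i

/-- The local models `W⁽ⁱ⁾(t)` of Local SGD with step size `η` and synchronization period `τ`,
started at `W₀` on every device. At step `t` device `i` uses its sample number `J t i`, and the
gradient at that sample is scaled by `n`; the models are averaged after every `τ` local steps. -/
def localIterate {K n m d : ℕ} (x : Fin K → Fin n → EuclideanSpace ℝ (Fin d))
    (y : Fin K → Fin n → ℝ) (η : ℝ) (τ : ℕ) (v : Fin m → ℝ) (W₀ : Weights m d)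
    (J : ℕ → Fin K → Fin n) : ℕ → Fin K → Weights m d
  | 0 => fun _ => W₀
  | t + 1 =>
    let W := localIterate x y η τ v W₀ J t
    let U : Fin K → Weights m d := fun i =>
      W i - η • ((n : ℝ) • pointGrad v (W i) (x i (J t i)) (y i (J t i)))
    if τ ∣ t + 1 then fun _ => average U else U

/-- The (virtual) averaged model `W(t) = (1/K) ∑ i, W⁽ⁱ⁾(t)`. -/
def avgIterate {K n m d : ℕ} (x : Fin K → Fin n → EuclideanSpace ℝ (Fin d))
    (y : Fin K → Fin n → ℝ) (η : ℝ) (τ : ℕ) (v : Fin m → ℝ) (W₀ : Weights m d)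
    (J : ℕ → Fin K → Fin n) (t : ℕ) : Weights m d :=
  average (localIterate x y η τ v W₀ J t)

/-- The random initialization of the hidden layer: independent `N(0, 2/m)` entries. -/
def hiddenInit (m d : ℕ) : Measure (Weights m d) :=
  Measure.pi fun _ => Measure.pi fun _ => gaussianReal 0 (2 / (m : ℝ≥0))

/-- The random output layer, which is not trained: independent `N(0, 1/d)` entries. -/
def outputInit (m d : ℕ) : Measure (Fin m → ℝ) :=
  Measure.pi fun _ => gaussianReal 0 (1 / (d : ℝ≥0))

/-- The law of the sampled indices: independent over steps and devices, uniform on the shard. -/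
def samplingLaw (K n : ℕ) [NeZero n] : Measure (ℕ → Fin K → Fin n) :=
  Measure.infinitePi fun _ => Measure.pi fun _ => uniformOn Set.univ

/-- The joint law of `(W(0), v, J)`: hidden layer, output layer and samples are independent. -/
def trainingLaw (K n m d : ℕ) [NeZero n] :
    Measure (Weights m d × (Fin m → ℝ) × (ℕ → Fin K → Fin n)) :=
  (hiddenInit m d).prod ((outputInit m d).prod (samplingLaw K n))

end LocalSGD

end

/-! The whole trajectory is compared with one linear model, the network linearized at W(0). Let Φ =
`featureMap` be the transposed Jacobian of the outputs at initialization and u_t the vector of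
residuals of the averaged model. As long as few neurons change their activation pattern, W(t+1) ≈
W(t) - ηΦ(s_t) and u_{t+1} ≈ u_t - ηΦ*Φ(s_t), where s_t is the sampled part of u_t, with mean u_t/K.
All errors are relative, small multiples of η‖u_t‖ (`linearized_step`). They come from the drift of
the local models since the last synchronization, and from neurons whose pattern flips. Row r of
every gradient carries the factor v_r, so the preactivation of neuron r moves by at most |v_r| · 2n
· ∑ η‖u_s‖. If this sum stays below a radius ρ, only the neurons with |⟨W_r(0), x⟩| ≤ |v_r|ρ matter,
and their total weight ∑ v_r² is at most a small θ.

If ‖Φc‖² ≥ λ‖c‖², one step gives ‖u_{t+1}‖² ≤ ‖u_t‖² exp(-ηλ/K + ηX_t), where X_t (`noise`) is the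
sampling error divided by ‖u_t‖². Because of this normalization and because Φ is frozen, the X_t are
martingale differences bounded by a constant on every trajectory, without any stopping time.
Kolmogorov's maximal inequality gives η∑X_s ≤ 1 for all t ≤ T at once, with high probability. Then
‖u_t‖² ≤ 4‖u_0‖² exp(-ηλt/K), so ∑ η‖u_s‖ is at most 6K‖u_0‖/λ, which is what the radius ρ requires:
the induction closes (`norm_residual_sq_le`). The factor 4 is absorbed by the factor n of the claim,
and the additive error term of the claim is only used through its nonnegativity.

The distance from W(0) is not bounded by summing step lengths. The accumulated linear displacement
is ΦC with Φ*ΦC ≈ u_0 - u_t, so ‖ΦC‖ ≤ ‖Φ*ΦC‖/√λ is of order ‖u_0‖/√λ (`norm_flat_sub_le`).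

What remains concerns the initialization. The expected Gram matrix of the features is positive
definite because, with positive probability, a Gaussian neuron has its boundary close to one input
and away from all others (`ofReal_le_lintegral_norm_sq`). Concentration of the Gram matrix, of ∑
v_r², of the initial outputs and of the flip sets needs only Chebyshev and Markov, since a failure
probability of order 1/n is allowed. Finally, C is chosen so large that n < C makes the claim empty;
for n ≥ C, spare powers of n absorb all constants. -/

noncomputable section

/-! ### Euclidean geometry of weights, features and residuals. -/

namespace LocalSGD

open Finset

variable {K n m d : ℕ}

/-- A weight matrix as a vector of the Euclidean space whose norm is the Frobenius norm. -/
def flat (W : Weights m d) : EuclideanSpace ℝ (Fin m × Fin d) :=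
  WithLp.toLp 2 fun p => W p.1 p.2

theorem flat_add (A B : Weights m d) : flat (A + B) = flat A + flat B := rfl

theorem flat_sub (A B : Weights m d) : flat (A - B) = flat A - flat B := rfl

theorem flat_smul (c : ℝ) (A : Weights m d) : flat (c • A) = c • flat A := rfl

theorem flat_zero : flat (0 : Weights m d) = 0 := rfl

theorem flat_sum {ι : Type*} (s : Finset ι) (A : ι → Weights m d) :
    flat (∑ i ∈ s, A i) = ∑ i ∈ s, flat (A i) := by
  classical
  induction s using Finset.induction_on with
  | empty => simp [flat_zero]
  | insert a s ha ih => rw [sum_insert ha, sum_insert ha, flat_add, ih]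

theorem frobNorm_eq_norm_flat (W : Weights m d) : frobNorm W = ‖flat W‖ := by
  rw [frobNorm, EuclideanSpace.norm_eq, Fintype.sum_prod_type]
  simp [flat]

theorem inner_flat (A B : Weights m d) :
    inner ℝ (flat A) (flat B) = ∑ r, ∑ k, A r k * B r k := by
  simp only [PiLp.inner_apply, Fintype.sum_prod_type, flat]
  simp [mul_comm]

theorem norm_flat_sq (A : Weights m d) : ‖flat A‖ ^ 2 = ∑ r, ∑ k, A r k ^ 2 := by
  rw [← real_inner_self_eq_norm_sq, inner_flat]
  simp [sq]

theorem preact_sub (A B : Weights m d) (x : EuclideanSpace ℝ (Fin d)) (r : Fin m) :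
    preact (A - B) x r = preact A x r - preact B x r := by
  simp [preact, sub_mul, sum_sub_distrib]

theorem preact_smul (c : ℝ) (A : Weights m d) (x : EuclideanSpace ℝ (Fin d)) (r : Fin m) :
    preact (c • A) x r = c * preact A x r := by
  simp [preact, mul_sum, mul_assoc]

theorem preact_sum {ι : Type*} (s : Finset ι) (A : ι → Weights m d)
    (x : EuclideanSpace ℝ (Fin d)) (r : Fin m) :
    preact (∑ i ∈ s, A i) x r = ∑ i ∈ s, preact (A i) x r := by
  simp only [preact, Finset.sum_apply, sum_mul]
  exact sum_comm

theorem sum_sq_eq_norm_sq (x : EuclideanSpace ℝ (Fin d)) : ∑ k, x k ^ 2 = ‖x‖ ^ 2 := by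
  rw [EuclideanSpace.norm_sq_eq]
  simp

theorem sum_mul_eq_inner (x z : EuclideanSpace ℝ (Fin d)) : ∑ k, x k * z k = inner ℝ x z := by
  simp [PiLp.inner_apply, mul_comm]

theorem sum_preact_sq_le (A : Weights m d) {x : EuclideanSpace ℝ (Fin d)} (hx : ‖x‖ = 1) :
    ∑ r, preact A x r ^ 2 ≤ ‖flat A‖ ^ 2 := by
  rw [norm_flat_sq]
  refine sum_le_sum fun r _ => ?_
  have := sum_mul_sq_le_sq_mul_sq univ (A r) (fun k => x k)
  rwa [sum_sq_eq_norm_sq, hx, one_pow, mul_one] at this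

theorem abs_relu_sub_le (a b : ℝ) : |relu a - relu b| ≤ |a - b| := by
  simpa [relu] using abs_max_sub_max_le_abs a b 0

theorem reluDeriv_nonneg (z : ℝ) : 0 ≤ reluDeriv z := by
  unfold reluDeriv; split_ifs <;> norm_num

theorem reluDeriv_le_one (z : ℝ) : reluDeriv z ≤ 1 := by
  unfold reluDeriv; split_ifs <;> norm_num

theorem reluDeriv_sq (z : ℝ) : reluDeriv z ^ 2 = reluDeriv z := by
  unfold reluDeriv; split_ifs <;> norm_num

theorem abs_reluDeriv_sub_le (a b : ℝ) : |reluDeriv a - reluDeriv b| ≤ 1 := by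
  unfold reluDeriv; split_ifs <;> norm_num

theorem reluDeriv_eq_of_abs_lt {a b : ℝ} (h : |b - a| < |a|) : reluDeriv b = reluDeriv a := by
  unfold reluDeriv
  rcases abs_cases a with h1 | h1 <;> rcases abs_cases (b - a) with h2 | h2 <;>
    split_ifs <;> first | rfl | (exfalso; linarith)

theorem relu_eq (a : ℝ) : relu a = reluDeriv a * a := by
  unfold relu reluDeriv
  split_ifs with h
  · rw [max_eq_left h.le, one_mul]
  · rw [max_eq_right (not_lt.mp h), zero_mul]

/-- The difference between a ReLU increment and its linearization with slope in `[0, 1]`. -/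
theorem abs_relu_sub_sub_le (a b : ℝ) {s : ℝ} (hs0 : 0 ≤ s) (hs1 : s ≤ 1) :
    |relu b - relu a - s * (b - a)| ≤ |b - a| := by
  unfold relu
  rcases max_cases a 0 with h1 | h1 <;> rcases max_cases b 0 with h2 | h2 <;>
    rw [h1.1, h2.1] <;> rcases abs_cases (b - a) with h3 | h3 <;> rw [h3.1, abs_le] <;>
    constructor <;> nlinarith

theorem network_sub_network (v : Fin m → ℝ) (W W' : Weights m d) (x : EuclideanSpace ℝ (Fin d)) :
    network v W x - network v W' x = ∑ r, v r * (relu (preact W x r) - relu (preact W' x r)) := by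
  simp [network, mul_sub, sum_sub_distrib]

/-- Cauchy–Schwarz over the neurons, together with the fact that ReLU is 1-Lipschitz. -/
theorem abs_network_sub_le {v : Fin m → ℝ} {V : ℝ} (hV : ∑ r, v r ^ 2 ≤ V) (W W' : Weights m d)
    {x : EuclideanSpace ℝ (Fin d)} (hx : ‖x‖ = 1) :
    |network v W x - network v W' x| ≤ √V * ‖flat (W - W')‖ := by
  have hV0 : 0 ≤ V := (sum_nonneg fun r _ => sq_nonneg _).trans hV
  rw [network_sub_network]
  refine abs_le_of_sq_le_sq ?_ (by positivity)
  refine (sum_mul_sq_le_sq_mul_sq univ _ _).trans ?_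
  rw [mul_pow, Real.sq_sqrt hV0]
  refine mul_le_mul hV ?_ (sum_nonneg fun r _ => sq_nonneg _) hV0
  refine le_trans (sum_le_sum fun r _ => ?_) (sum_preact_sq_le (W - W') hx)
  rw [preact_sub]
  exact sq_le_sq.mpr (abs_relu_sub_le _ _)

/-- The gradient of the network output with respect to the hidden layer. -/
def feature (v : Fin m → ℝ) (W : Weights m d) (x : EuclideanSpace ℝ (Fin d)) : Weights m d :=
  fun r k => reluDeriv (preact W x r) * v r * x k

theorem pointGrad_eq_smul_feature (v : Fin m → ℝ) (W : Weights m d)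
    (x : EuclideanSpace ℝ (Fin d)) (y : ℝ) :
    pointGrad v W x y = (network v W x - y) • feature v W x := by
  ext r k
  simp [pointGrad, feature, mul_assoc]

theorem preact_feature (v : Fin m → ℝ) (W : Weights m d) (x z : EuclideanSpace ℝ (Fin d))
    (r : Fin m) :
    preact (feature v W x) z r = reluDeriv (preact W x r) * v r * inner ℝ x z := by
  rw [← sum_mul_eq_inner, mul_sum]
  simp [preact, feature, mul_assoc]

theorem inner_flat_feature (v : Fin m → ℝ) (W A : Weights m d) (x : EuclideanSpace ℝ (Fin d)) :
    inner ℝ (flat (feature v W x)) (flat A)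
      = ∑ r, reluDeriv (preact W x r) * v r * preact A x r := by
  rw [inner_flat]
  refine sum_congr rfl fun r _ => ?_
  rw [show preact A x r = ∑ k, A r k * x k from rfl, mul_sum]
  exact sum_congr rfl fun k _ => by simp only [feature]; ring

theorem norm_flat_feature_le {v : Fin m → ℝ} {V : ℝ} (hV : ∑ r, v r ^ 2 ≤ V) (W : Weights m d)
    {x : EuclideanSpace ℝ (Fin d)} (hx : ‖x‖ = 1) : ‖flat (feature v W x)‖ ≤ √V := by
  refine Real.le_sqrt_of_sq_le (le_trans ?_ hV)
  rw [norm_flat_sq]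
  refine sum_le_sum fun r _ => ?_
  simp only [feature, mul_pow, ← mul_sum, sum_sq_eq_norm_sq, hx, reluDeriv_sq]
  nlinarith [reluDeriv_le_one (preact W x r), sq_nonneg (v r)]

theorem norm_flat_pointGrad_le {v : Fin m → ℝ} {V : ℝ} (hV : ∑ r, v r ^ 2 ≤ V) (W : Weights m d)
    {x : EuclideanSpace ℝ (Fin d)} (hx : ‖x‖ = 1) (y : ℝ) :
    ‖flat (pointGrad v W x y)‖ ≤ |network v W x - y| * √V := by
  rw [pointGrad_eq_smul_feature, flat_smul, norm_smul, Real.norm_eq_abs]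
  exact mul_le_mul_of_nonneg_left (norm_flat_feature_le hV W hx) (abs_nonneg _)

/-- Row r of the gradient is proportional to v_r. This bound for each single neuron, much finer than
the Frobenius norm, is what controls pattern changes. -/
theorem abs_preact_pointGrad_le (v : Fin m → ℝ) (W : Weights m d)
    {x z : EuclideanSpace ℝ (Fin d)} (hx : ‖x‖ = 1) (hz : ‖z‖ = 1) (y : ℝ) (r : Fin m) :
    |preact (pointGrad v W x y) z r| ≤ |network v W x - y| * |v r| := by
  rw [pointGrad_eq_smul_feature, preact_smul, abs_mul, preact_feature, abs_mul, abs_mul]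
  refine mul_le_mul_of_nonneg_left ?_ (abs_nonneg _)
  have h1 := abs_real_inner_le_norm x z
  rw [hx, hz, one_mul] at h1
  rw [abs_of_nonneg (reluDeriv_nonneg _)]
  have h2 := reluDeriv_le_one (preact W x r)
  have h3 : reluDeriv (preact W x r) * |v r| ≤ |v r| := by
    nlinarith [abs_nonneg (v r)]
  nlinarith [abs_nonneg (v r), abs_nonneg (inner ℝ x z : ℝ)]

theorem average_const (hK : 0 < K) (A : Weights m d) : average (fun _ : Fin K => A) = A := by
  have : (K : ℝ) ≠ 0 := by positivity
  ext r k
  simp [average, this]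

theorem average_sub (hK : 0 < K) (U : Fin K → Weights m d) (A : Weights m d) :
    average U - A = (K : ℝ)⁻¹ • ∑ i, (U i - A) := by
  conv_lhs => rw [← average_const hK A]
  simp [average, ← smul_sub, sum_sub_distrib]

theorem inv_mul_sum_le (hK : 0 < K) {f : Fin K → ℝ} {b : ℝ} (h : ∀ i, f i ≤ b) :
    (K : ℝ)⁻¹ * ∑ i, f i ≤ b := by
  have hK' : (0 : ℝ) < K := by positivity
  rw [inv_mul_le_iff₀ hK']
  calc ∑ i, f i ≤ ∑ _i : Fin K, b := sum_le_sum fun i _ => h i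
    _ = K * b := by simp

theorem norm_flat_average_sub_le (hK : 0 < K) {U : Fin K → Weights m d} {A : Weights m d} {b : ℝ}
    (h : ∀ i, ‖flat (U i - A)‖ ≤ b) : ‖flat (average U - A)‖ ≤ b := by
  rw [average_sub hK, flat_smul, flat_sum, norm_smul, Real.norm_of_nonneg (by positivity)]
  exact (mul_le_mul_of_nonneg_left (norm_sum_le _ _) (by positivity)).trans (inv_mul_sum_le hK h)

theorem abs_preact_average_sub_le (hK : 0 < K) {U : Fin K → Weights m d} {A : Weights m d}
    {b : ℝ} (x : EuclideanSpace ℝ (Fin d)) (r : Fin m)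
    (h : ∀ i, |preact (U i - A) x r| ≤ b) : |preact (average U - A) x r| ≤ b := by
  rw [average_sub hK, preact_smul, preact_sum, abs_mul, abs_of_nonneg (by positivity)]
  exact (mul_le_mul_of_nonneg_left (abs_sum_le_sum_abs _ _) (by positivity)).trans
    (inv_mul_sum_le hK h)

/-- The residuals `f(W, v, x_{i,j}) - y_{i,j}` at all points of all shards. -/
def residual (x : Fin K → Fin n → EuclideanSpace ℝ (Fin d)) (y : Fin K → Fin n → ℝ)
    (v : Fin m → ℝ) (W : Weights m d) : EuclideanSpace ℝ (Fin K × Fin n) :=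
  WithLp.toLp 2 fun p => network v W (x p.1 p.2) - y p.1 p.2

theorem residual_apply (x : Fin K → Fin n → EuclideanSpace ℝ (Fin d)) (y : Fin K → Fin n → ℝ)
    (v : Fin m → ℝ) (W : Weights m d) (p : Fin K × Fin n) :
    residual x y v W p = network v W (x p.1 p.2) - y p.1 p.2 := rfl

theorem globalLoss_eq (x : Fin K → Fin n → EuclideanSpace ℝ (Fin d)) (y : Fin K → Fin n → ℝ)
    (v : Fin m → ℝ) (W : Weights m d) :
    globalLoss x y v W = (K : ℝ)⁻¹ * (‖residual x y v W‖ ^ 2 / 2) := by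
  rw [globalLoss, EuclideanSpace.norm_sq_eq, Fintype.sum_prod_type]
  simp [pointLoss, residual, sum_div]

theorem abs_apply_le_norm {ι : Type*} [Fintype ι] (u : EuclideanSpace ℝ ι) (p : ι) :
    |u p| ≤ ‖u‖ := by
  simpa using PiLp.norm_apply_le u p

theorem norm_le_sqrt_card_mul {ι : Type*} [Fintype ι] (u : EuclideanSpace ℝ ι) {b : ℝ}
    (hb : 0 ≤ b) (h : ∀ p, |u p| ≤ b) : ‖u‖ ≤ √(Fintype.card ι) * b := by
  rw [EuclideanSpace.norm_eq]
  refine (Real.sqrt_le_sqrt (y := Fintype.card ι * b ^ 2) ?_).trans_eq ?_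
  · calc ∑ p, ‖u p‖ ^ 2 ≤ ∑ _p : ι, b ^ 2 :=
        sum_le_sum fun p _ => pow_le_pow_left₀ (norm_nonneg _) (by simpa using h p) 2
      _ = _ := by simp
  · rw [Real.sqrt_mul (by positivity), Real.sqrt_sq hb]

theorem norm_residual_sub_le {x : Fin K → Fin n → EuclideanSpace ℝ (Fin d)}
    (hx : ∀ i j, ‖x i j‖ = 1) (y : Fin K → Fin n → ℝ) {v : Fin m → ℝ} {V : ℝ}
    (hV : ∑ r, v r ^ 2 ≤ V) (W W' : Weights m d) :
    ‖residual x y v W - residual x y v W'‖ ≤ √(K * n) * (√V * ‖flat (W - W')‖) := by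
  have := norm_le_sqrt_card_mul (residual x y v W - residual x y v W')
    (b := √V * ‖flat (W - W')‖) (by positivity) fun p => by
      simpa [residual] using abs_network_sub_le hV W W' (hx p.1 p.2)
  simpa using this

end LocalSGD
end

/-! ### Drift of the local models and movement of single neurons. -/

noncomputable section

namespace LocalSGD

open Finset

variable {K n m d : ℕ}

/-- One local step on every device. -/
def localStep (x : Fin K → Fin n → EuclideanSpace ℝ (Fin d)) (y : Fin K → Fin n → ℝ) (η : ℝ)
    (v : Fin m → ℝ) (U : Fin K → Weights m d) (J : Fin K → Fin n) : Fin K → Weights m d :=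
  fun i => U i - η • ((n : ℝ) • pointGrad v (U i) (x i (J i)) (y i (J i)))

theorem localIterate_succ (x : Fin K → Fin n → EuclideanSpace ℝ (Fin d)) (y : Fin K → Fin n → ℝ)
    (η : ℝ) (τ : ℕ) (v : Fin m → ℝ) (W₀ : Weights m d) (J : ℕ → Fin K → Fin n) (t : ℕ) :
    localIterate x y η τ v W₀ J (t + 1) =
      if τ ∣ t + 1 then fun _ => average (localStep x y η v (localIterate x y η τ v W₀ J t) (J t))
      else localStep x y η v (localIterate x y η τ v W₀ J t) (J t) := rfl

/-- Averaging is idempotent, so synchronization is invisible to the averaged model. -/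
theorem avgIterate_succ (hK : 0 < K) (x : Fin K → Fin n → EuclideanSpace ℝ (Fin d))
    (y : Fin K → Fin n → ℝ) (η : ℝ) (τ : ℕ) (v : Fin m → ℝ) (W₀ : Weights m d)
    (J : ℕ → Fin K → Fin n) (t : ℕ) :
    avgIterate x y η τ v W₀ J (t + 1)
      = average (localStep x y η v (localIterate x y η τ v W₀ J t) (J t)) := by
  rw [avgIterate, localIterate_succ]
  split_ifs
  · exact average_const hK _
  · rfl

theorem avgIterate_succ_eq_sub (hK : 0 < K) (x : Fin K → Fin n → EuclideanSpace ℝ (Fin d))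
    (y : Fin K → Fin n → ℝ) (η : ℝ) (τ : ℕ) (v : Fin m → ℝ) (W₀ : Weights m d)
    (J : ℕ → Fin K → Fin n) (t : ℕ) :
    avgIterate x y η τ v W₀ J (t + 1) = avgIterate x y η τ v W₀ J t
      - η • ((K : ℝ)⁻¹ • ∑ i, (n : ℝ) • pointGrad v (localIterate x y η τ v W₀ J t i)
          (x i (J t i)) (y i (J t i))) := by
  rw [avgIterate_succ hK]
  simp only [average, localStep, avgIterate, sum_sub_distrib, smul_sub, ← smul_sum]
  rw [smul_comm (K : ℝ)⁻¹ η]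

theorem avgIterate_zero (hK : 0 < K) (x : Fin K → Fin n → EuclideanSpace ℝ (Fin d))
    (y : Fin K → Fin n → ℝ) (η : ℝ) (τ : ℕ) (v : Fin m → ℝ) (W₀ : Weights m d)
    (J : ℕ → Fin K → Fin n) : avgIterate x y η τ v W₀ J 0 = W₀ :=
  average_const hK W₀

section Trajectory

variable {x : Fin K → Fin n → EuclideanSpace ℝ (Fin d)} {y : Fin K → Fin n → ℝ} {η : ℝ} {τ : ℕ}
  {v : Fin m → ℝ} {W₀ : Weights m d} {J : ℕ → Fin K → Fin n} {V δ : ℝ}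

theorem norm_flat_localStep_sub_le (hx : ∀ i j, ‖x i j‖ = 1) (hη : 0 ≤ η)
    (hV : ∑ r, v r ^ 2 ≤ V) (U : Fin K → Weights m d) (J : Fin K → Fin n) (A : Weights m d)
    (i : Fin K) :
    ‖flat (localStep x y η v U J i - A)‖
      ≤ ‖flat (U i - A)‖ + η * n * √V * ‖residual x y v (U i)‖ := by
  have h1 : localStep x y η v U J i - A
      = (U i - A) - η • ((n : ℝ) • pointGrad v (U i) (x i (J i)) (y i (J i))) := by
    simp only [localStep]; abel
  rw [h1, flat_sub]
  refine (norm_sub_le _ _).trans (add_le_add le_rfl ?_)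
  rw [flat_smul, flat_smul, norm_smul, norm_smul, Real.norm_of_nonneg hη,
    Real.norm_of_nonneg (Nat.cast_nonneg n)]
  have h2 := norm_flat_pointGrad_le hV (U i) (hx i (J i)) (y i (J i))
  have h3 := abs_apply_le_norm (residual x y v (U i)) (i, J i)
  rw [residual_apply] at h3
  calc η * (n * ‖flat (pointGrad v (U i) (x i (J i)) (y i (J i)))‖)
      ≤ η * (n * (‖residual x y v (U i)‖ * √V)) := by
        gcongr
        exact h2.trans (mul_le_mul_of_nonneg_right h3 (Real.sqrt_nonneg _))
    _ = _ := by ring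

/-- Since the last synchronization, the local models have moved by a multiple of the residual. -/
theorem exists_norm_localIterate_sub_le (hx : ∀ i j, ‖x i j‖ = 1) (hη : 0 ≤ η) (hτ : 0 < τ)
    (hV : ∑ r, v r ^ 2 ≤ V) (hδ : 8 * √(K * n) * n * τ * η * V ≤ δ) (hδ1 : δ ≤ 1) (t : ℕ) :
    ∃ A : Weights m d, ∀ i, ‖flat (localIterate x y η τ v W₀ J t i - A)‖
      ≤ (t % τ : ℕ) * (2 * η * n * √V * ‖residual x y v A‖) := by
  have hV0 : 0 ≤ V := (sum_nonneg fun r _ => sq_nonneg _).trans hV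
  induction t with
  | zero => exact ⟨W₀, fun i => by simp [localIterate, flat_zero]⟩
  | succ t ih =>
    rw [localIterate_succ]
    by_cases hd : τ ∣ t + 1
    · rw [if_pos hd]
      -- At a synchronization the common average becomes the new reference point, and the counter
      -- `(t + 1) % τ` is 0.
      exact ⟨_, fun i => by
        rw [sub_self, flat_zero, norm_zero, Nat.mod_eq_zero_of_dvd hd]; simp⟩
    · rw [if_neg hd]
      obtain ⟨A, hA⟩ := ih
      refine ⟨A, fun i => ?_⟩
      have hk : (t + 1) % τ = t % τ + 1 := by
        have h1 := Nat.div_add_mod t τ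
        have h2 : t % τ + 1 ≠ τ := fun h => hd ⟨t / τ + 1, by rw [mul_add, mul_one]; omega⟩
        have h3 := Nat.mod_lt t hτ
        rw [show t + 1 = t % τ + 1 + τ * (t / τ) by omega, Nat.add_mul_mod_self_left,
          Nat.mod_eq_of_lt (by omega)]
      rw [hk]
      refine (norm_flat_localStep_sub_le hx hη hV _ _ A i).trans ?_
      set L := localIterate x y η τ v W₀ J t with hL
      set b := ‖residual x y v A‖ with hb
      have hkτ : ((t % τ : ℕ) : ℝ) ≤ τ := by exact_mod_cast (Nat.mod_lt t hτ).le
      have hb0 : 0 ≤ b := norm_nonneg _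
      -- By the induction hypothesis the models are so close to A that no residual vector has more
      -- than doubled; this justifies the factor 2 for the next step.
      have h1 : ‖residual x y v (L i)‖ ≤ 2 * b := by
        have h2 := norm_residual_sub_le hx y hV (L i) A
        have h3 : √(K * n) * (√V * ‖flat (L i - A)‖) ≤ b := by
          calc √(K * n) * (√V * ‖flat (L i - A)‖)
              ≤ √(K * n) * (√V * (τ * (2 * η * n * √V * b))) := by
                gcongr
                exact (hA i).trans (by gcongr)
            _ = (8 * √(K * n) * n * τ * η * (√V * √V)) * (b / 4) := by ring
            _ ≤ 1 * (b / 4) := by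
                rw [Real.mul_self_sqrt hV0]
                gcongr
                exact hδ.trans hδ1
            _ ≤ b := by linarith
        have h4 := norm_le_norm_add_norm_sub' (residual x y v (L i)) (residual x y v A)
        linarith
      have h5 : η * n * √V * ‖residual x y v (L i)‖ ≤ η * n * √V * (2 * b) := by gcongr
      have h6 := hA i
      push_cast
      linarith

/-- Both the local model and the average are close to the last synchronized model; the triangle
inequality removes that model, so that the drift is relative to the current averaged residual. -/
theorem norm_residual_localIterate_sub_le (hK : 0 < K) (hx : ∀ i j, ‖x i j‖ = 1) (hη : 0 ≤ η)
    (hτ : 0 < τ) (hV : ∑ r, v r ^ 2 ≤ V) (hδ : 8 * √(K * n) * n * τ * η * V ≤ δ) (hδ1 : δ ≤ 1)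
    (t : ℕ) (i : Fin K) :
    ‖residual x y v (localIterate x y η τ v W₀ J t i)
        - residual x y v (avgIterate x y η τ v W₀ J t)‖
      ≤ δ * ‖residual x y v (avgIterate x y η τ v W₀ J t)‖ ∧
    ‖flat (localIterate x y η τ v W₀ J t i - avgIterate x y η τ v W₀ J t)‖
      ≤ 6 * τ * η * n * √V * ‖residual x y v (avgIterate x y η τ v W₀ J t)‖ := by
  have hV0 : 0 ≤ V := (sum_nonneg fun r _ => sq_nonneg _).trans hV
  obtain ⟨A, hA⟩ := exists_norm_localIterate_sub_le (y := y) (W₀ := W₀) (J := J) hx hη hτ hV hδ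
    hδ1 t
  have hkτ : ((t % τ : ℕ) : ℝ) ≤ τ := by exact_mod_cast (Nat.mod_lt t hτ).le
  set L := localIterate x y η τ v W₀ J t with hL
  have hav : avgIterate x y η τ v W₀ J t = average L := rfl
  rw [hav]
  set b := ‖residual x y v A‖ with hb
  have hb0 : 0 ≤ b := norm_nonneg _
  have hA' : ∀ i, ‖flat (L i - A)‖ ≤ τ * (2 * η * n * √V * b) := fun i =>
    (hA i).trans (by gcongr)
  have hB := norm_flat_average_sub_le hK hA'
  have key : ∀ W : Weights m d, ‖flat (W - A)‖ ≤ τ * (2 * η * n * √V * b) →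
      ‖residual x y v W - residual x y v A‖ ≤ δ * (b / 4) := fun W hW => by
    refine (norm_residual_sub_le hx y hV W A).trans ?_
    calc √(K * n) * (√V * ‖flat (W - A)‖)
        ≤ √(K * n) * (√V * (τ * (2 * η * n * √V * b))) := by gcongr
      _ = (8 * √(K * n) * n * τ * η * (√V * √V)) * (b / 4) := by ring
      _ ≤ δ * (b / 4) := by
          rw [Real.mul_self_sqrt hV0]
          gcongr
  have h1 := key _ (hA' i)
  have h2 := key _ hB
  have h3 := norm_le_norm_add_norm_sub (residual x y v (average L)) (residual x y v A)
  have hδ0 : 0 ≤ δ := le_trans (by positivity) hδ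
  -- The residuals at A and at the average differ by at most b/4, because δ ≤ 1.
  have h4 : b ≤ 4 / 3 * ‖residual x y v (average L)‖ := by nlinarith
  constructor
  · have h5 := norm_sub_le_norm_sub_add_norm_sub (residual x y v (L i)) (residual x y v A)
      (residual x y v (average L))
    rw [norm_sub_rev (residual x y v A)] at h5
    nlinarith [norm_nonneg (residual x y v (average L))]
  · have h5 : ‖flat (L i - average L)‖ ≤ ‖flat (L i - A)‖ + ‖flat (average L - A)‖ := by
      rw [show L i - average L = (L i - A) - (average L - A) by abel, flat_sub]
      exact norm_sub_le _ _
    have h6 := hA' i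
    calc ‖flat (L i - average L)‖ ≤ 4 * τ * η * n * √V * b := by linarith
      _ ≤ 4 * τ * η * n * √V * (4 / 3 * ‖residual x y v (average L)‖) := by gcongr
      _ ≤ _ := by
          have : 0 ≤ τ * η * n * √V * ‖residual x y v (average L)‖ := by positivity
          linarith

theorem norm_residual_localIterate_le (hK : 0 < K) (hx : ∀ i j, ‖x i j‖ = 1) (hη : 0 ≤ η)
    (hτ : 0 < τ) (hV : ∑ r, v r ^ 2 ≤ V) (hδ : 8 * √(K * n) * n * τ * η * V ≤ δ) (hδ1 : δ ≤ 1)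
    (t : ℕ) (i : Fin K) :
    ‖residual x y v (localIterate x y η τ v W₀ J t i)‖
      ≤ 2 * ‖residual x y v (avgIterate x y η τ v W₀ J t)‖ := by
  have h1 := (norm_residual_localIterate_sub_le (y := y) (W₀ := W₀) (J := J) hK hx hη hτ hV hδ
    hδ1 t i).1
  have h2 := norm_le_norm_add_norm_sub' (residual x y v (localIterate x y η τ v W₀ J t i))
    (residual x y v (avgIterate x y η τ v W₀ J t))
  nlinarith [norm_nonneg (residual x y v (avgIterate x y η τ v W₀ J t))]

/-- The pre-activation of neuron `r` has moved by at most `|v r|` times the sum of the residuals. -/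
theorem abs_preact_localIterate_sub_le (hK : 0 < K) (hx : ∀ i j, ‖x i j‖ = 1) (hη : 0 ≤ η)
    (hτ : 0 < τ) (hV : ∑ r, v r ^ 2 ≤ V) (hδ : 8 * √(K * n) * n * τ * η * V ≤ δ) (hδ1 : δ ≤ 1)
    {z : EuclideanSpace ℝ (Fin d)} (hz : ‖z‖ = 1) (r : Fin m) (t : ℕ) (i : Fin K) :
    |preact (localIterate x y η τ v W₀ J t i - W₀) z r|
      ≤ |v r| * (2 * n * ∑ s ∈ range t, η * ‖residual x y v (avgIterate x y η τ v W₀ J s)‖) := by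
  induction t generalizing i with
  | zero => simp [localIterate, preact]
  | succ t ih =>
    set L := localIterate x y η τ v W₀ J t with hL
    set S := ∑ s ∈ range t, η * ‖residual x y v (avgIterate x y η τ v W₀ J s)‖ with hS
    set b := ‖residual x y v (avgIterate x y η τ v W₀ J t)‖ with hb
    have key : ∀ i, |preact (localStep x y η v L (J t) i - W₀) z r|
        ≤ |v r| * (2 * n * (S + η * b)) := by
      intro i
      have h1 : localStep x y η v L (J t) i - W₀
          = (L i - W₀) - η • ((n : ℝ) • pointGrad v (L i) (x i (J t i)) (y i (J t i))) := by
        simp only [localStep]; abel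
      rw [h1, preact_sub, preact_smul, preact_smul]
      refine (abs_sub _ _).trans ?_
      rw [abs_mul, abs_mul, abs_of_nonneg hη, Nat.abs_cast]
      have h2 := abs_preact_pointGrad_le v (L i) (hx i (J t i)) hz (y i (J t i)) r
      have h3 := abs_apply_le_norm (residual x y v (L i)) (i, J t i)
      rw [residual_apply] at h3
      have h4 := norm_residual_localIterate_le (y := y) (W₀ := W₀) (J := J) hK hx hη hτ hV hδ
        hδ1 t i
      have h5 : η * (n * |preact (pointGrad v (L i) (x i (J t i)) (y i (J t i))) z r|)
          ≤ η * (n * (2 * b * |v r|)) := by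
        gcongr
        exact h2.trans (mul_le_mul_of_nonneg_right (h3.trans h4) (abs_nonneg _))
      have h6 := ih i
      nlinarith
    rw [sum_range_succ, localIterate_succ]
    split_ifs
    · exact abs_preact_average_sub_le hK z r key
    · exact key i

theorem abs_preact_avgIterate_sub_le (hK : 0 < K) (hx : ∀ i j, ‖x i j‖ = 1) (hη : 0 ≤ η)
    (hτ : 0 < τ) (hV : ∑ r, v r ^ 2 ≤ V) (hδ : 8 * √(K * n) * n * τ * η * V ≤ δ) (hδ1 : δ ≤ 1)
    {z : EuclideanSpace ℝ (Fin d)} (hz : ‖z‖ = 1) (r : Fin m) (t : ℕ) :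
    |preact (avgIterate x y η τ v W₀ J t - W₀) z r|
      ≤ |v r| * (2 * n * ∑ s ∈ range t, η * ‖residual x y v (avgIterate x y η τ v W₀ J s)‖) :=
  abs_preact_average_sub_le hK z r fun i =>
    abs_preact_localIterate_sub_le hK hx hη hτ hV hδ hδ1 hz r t i

end Trajectory

end LocalSGD
end

/-! ### Linearization at the initial weights. -/

noncomputable section

namespace LocalSGD

open Finset

variable {K n m d : ℕ}

/-- The derivative of the outputs at all points with respect to the hidden layer, transposed. -/
def featureMap (x : Fin K → Fin n → EuclideanSpace ℝ (Fin d)) (v : Fin m → ℝ) (W₀ : Weights m d) :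
    EuclideanSpace ℝ (Fin K × Fin n) →L[ℝ] EuclideanSpace ℝ (Fin m × Fin d) :=
  ∑ p, (EuclideanSpace.proj p).smulRight (flat (feature v W₀ (x p.1 p.2)))

theorem featureMap_apply (x : Fin K → Fin n → EuclideanSpace ℝ (Fin d)) (v : Fin m → ℝ)
    (W₀ : Weights m d) (c : EuclideanSpace ℝ (Fin K × Fin n)) :
    featureMap x v W₀ c = ∑ p, c p • flat (feature v W₀ (x p.1 p.2)) := by
  simp [featureMap]

theorem adjoint_featureMap_apply (x : Fin K → Fin n → EuclideanSpace ℝ (Fin d)) (v : Fin m → ℝ)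
    (W₀ : Weights m d) (z : EuclideanSpace ℝ (Fin m × Fin d)) (p : Fin K × Fin n) :
    (featureMap x v W₀).adjoint z p = inner ℝ (flat (feature v W₀ (x p.1 p.2))) z := by
  have h := ContinuousLinearMap.adjoint_inner_left (featureMap x v W₀)
    (EuclideanSpace.single p (1 : ℝ)) z
  rw [featureMap_apply] at h
  simp only [EuclideanSpace.inner_single_right] at h
  rw [Finset.sum_eq_single p] at h
  · simpa [real_inner_comm] using h
  · intro q _ hq
    simp [hq]
  · simp

theorem norm_featureMap_le {x : Fin K → Fin n → EuclideanSpace ℝ (Fin d)}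
    (hx : ∀ i j, ‖x i j‖ = 1) {v : Fin m → ℝ} {V : ℝ} (hV : ∑ r, v r ^ 2 ≤ V)
    (W₀ : Weights m d) (c : EuclideanSpace ℝ (Fin K × Fin n)) :
    ‖featureMap x v W₀ c‖ ≤ (K * n) * √V * ‖c‖ := by
  rw [featureMap_apply]
  refine (norm_sum_le _ _).trans ?_
  calc ∑ p, ‖c p • flat (feature v W₀ (x p.1 p.2))‖
      ≤ ∑ _p : Fin K × Fin n, ‖c‖ * √V := by
        refine sum_le_sum fun p _ => ?_
        rw [norm_smul]
        exact mul_le_mul (PiLp.norm_apply_le c p) (norm_flat_feature_le hV W₀ (hx _ _))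
          (norm_nonneg _) (norm_nonneg _)
    _ = _ := by simp; ring

theorem norm_adjoint_featureMap_featureMap_le {x : Fin K → Fin n → EuclideanSpace ℝ (Fin d)}
    (hx : ∀ i j, ‖x i j‖ = 1) {v : Fin m → ℝ} {V : ℝ} (hV : ∑ r, v r ^ 2 ≤ V)
    (W₀ : Weights m d) (c : EuclideanSpace ℝ (Fin K × Fin n)) :
    ‖(featureMap x v W₀).adjoint (featureMap x v W₀ c)‖ ≤ (K * n) ^ 2 * V * ‖c‖ := by
  have hV0 : 0 ≤ V := (sum_nonneg fun r _ => sq_nonneg _).trans hV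
  have h1 : ‖featureMap x v W₀‖ ≤ (K * n) * √V :=
    ContinuousLinearMap.opNorm_le_bound _ (by positivity) (norm_featureMap_le hx hV W₀)
  have h2 : ‖(featureMap x v W₀).adjoint‖ = ‖featureMap x v W₀‖ :=
    LinearIsometryEquiv.norm_map _ _
  refine (ContinuousLinearMap.le_opNorm _ _).trans ?_
  rw [h2]
  calc ‖featureMap x v W₀‖ * ‖featureMap x v W₀ c‖
      ≤ ((K * n) * √V) * ((K * n) * √V * ‖c‖) :=
        mul_le_mul h1 (norm_featureMap_le hx hV W₀ c) (norm_nonneg _) (by positivity)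
    _ = (K * n) ^ 2 * (√V * √V) * ‖c‖ := by ring
    _ = _ := by rw [Real.mul_self_sqrt hV0]

/-- The part of the residual vector `u` seen by the samples `J`, scaled so that it is `u / K` on
average. -/
def sampled (J : Fin K → Fin n) (u : EuclideanSpace ℝ (Fin K × Fin n)) :
    EuclideanSpace ℝ (Fin K × Fin n) :=
  WithLp.toLp 2 fun p => (K : ℝ)⁻¹ * if J p.1 = p.2 then n * u p else 0

theorem norm_sampled_le (hK : 0 < K) (J : Fin K → Fin n) (u : EuclideanSpace ℝ (Fin K × Fin n)) :
    ‖sampled J u‖ ≤ n * ‖u‖ := by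
  have hK1 : (K : ℝ)⁻¹ ≤ 1 := inv_le_one_of_one_le₀ (by exact_mod_cast hK)
  have hK0 : 0 ≤ (K : ℝ)⁻¹ := by positivity
  have h : ‖sampled J u‖ ≤ ‖(n : ℝ) • u‖ := by
    rw [EuclideanSpace.norm_eq, EuclideanSpace.norm_eq]
    refine Real.sqrt_le_sqrt (sum_le_sum fun p _ => ?_)
    refine pow_le_pow_left₀ (norm_nonneg _) ?_ 2
    simp only [sampled, PiLp.smul_apply, smul_eq_mul, Real.norm_eq_abs]
    rw [abs_mul, abs_of_nonneg hK0]
    split_ifs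
    · exact mul_le_of_le_one_left (abs_nonneg _) hK1
    · rw [abs_zero, mul_zero]
      exact abs_nonneg _
  simpa [norm_smul] using h

theorem featureMap_sampled (x : Fin K → Fin n → EuclideanSpace ℝ (Fin d)) (v : Fin m → ℝ)
    (W₀ : Weights m d) (J : Fin K → Fin n) (u : EuclideanSpace ℝ (Fin K × Fin n)) :
    featureMap x v W₀ (sampled J u)
      = (K : ℝ)⁻¹ • ∑ i, (n * u (i, J i)) • flat (feature v W₀ (x i (J i))) := by
  rw [featureMap_apply, Fintype.sum_prod_type, smul_sum]
  refine sum_congr rfl fun i _ => ?_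
  simp [sampled, smul_smul]

section Patterns

variable {v : Fin m → ℝ} {W₀ W W' : Weights m d} {z : EuclideanSpace ℝ (Fin d)} {ρ θ b : ℝ}

theorem reluDeriv_preact_eq {r : Fin m} (hW : |preact (W - W₀) z r| ≤ |v r| * ρ)
    (hr : ¬ |preact W₀ z r| ≤ |v r| * ρ) :
    reluDeriv (preact W z r) = reluDeriv (preact W₀ z r) := by
  refine reluDeriv_eq_of_abs_lt ?_
  rw [← preact_sub]
  exact hW.trans_lt (not_le.mp hr)

/-- Outside the flip set both ReLUs have the slope they had at W₀, so the increment is exactly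
linear. On the flip set the remainder is at most the increment, |v_r| b, and a second factor |v_r|
comes from the output layer. -/
theorem abs_network_sub_sub_inner_le
    (hθ : ∑ r, (if |preact W₀ z r| ≤ |v r| * ρ then v r ^ 2 else 0) ≤ θ) (hb : 0 ≤ b)
    (hW : ∀ r, |preact (W - W₀) z r| ≤ |v r| * ρ)
    (hW' : ∀ r, |preact (W' - W₀) z r| ≤ |v r| * ρ)
    (hWW' : ∀ r, |preact (W' - W) z r| ≤ |v r| * b) :
    |network v W' z - network v W z - inner ℝ (flat (feature v W₀ z)) (flat (W' - W))| ≤ b * θ := by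
  rw [network_sub_network, inner_flat_feature, ← sum_sub_distrib]
  refine (abs_sum_le_sum_abs _ _).trans (le_trans ?_ (mul_le_mul_of_nonneg_left hθ hb))
  rw [mul_sum]
  refine sum_le_sum fun r _ => ?_
  rw [show v r * (relu (preact W' z r) - relu (preact W z r))
      - reluDeriv (preact W₀ z r) * v r * preact (W' - W) z r
      = v r * (relu (preact W' z r) - relu (preact W z r)
        - reluDeriv (preact W₀ z r) * (preact W' z r - preact W z r)) by
      rw [preact_sub]; ring, abs_mul]
  split_ifs with h
  · have h1 := abs_relu_sub_sub_le (preact W z r) (preact W' z r)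
      (reluDeriv_nonneg (preact W₀ z r)) (reluDeriv_le_one _)
    have h2 := hWW' r
    rw [preact_sub] at h2
    calc _ ≤ |v r| * (|v r| * b) := mul_le_mul_of_nonneg_left (h1.trans h2) (abs_nonneg _)
      _ = b * v r ^ 2 := by rw [← sq_abs (v r)]; ring
  · have h1 := reluDeriv_preact_eq (hW r) h
    have h2 := reluDeriv_preact_eq (hW' r) h
    rw [relu_eq (preact W' z r), relu_eq (preact W z r), h1, h2, mul_zero]
    refine le_of_eq ?_
    rw [mul_eq_zero]
    exact Or.inr (by rw [abs_eq_zero]; ring)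

theorem norm_flat_feature_sub_sq_le
    (hθ : ∑ r, (if |preact W₀ z r| ≤ |v r| * ρ then v r ^ 2 else 0) ≤ θ) (hz : ‖z‖ = 1)
    (hW : ∀ r, |preact (W - W₀) z r| ≤ |v r| * ρ) :
    ‖flat (feature v W z - feature v W₀ z)‖ ^ 2 ≤ θ := by
  refine le_trans ?_ hθ
  rw [norm_flat_sq]
  refine sum_le_sum fun r _ => ?_
  have h1 : ∑ k, (feature v W z - feature v W₀ z) r k ^ 2
      = (reluDeriv (preact W z r) - reluDeriv (preact W₀ z r)) ^ 2 * v r ^ 2 := by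
    have : ∀ k, (feature v W z - feature v W₀ z) r k ^ 2
        = (reluDeriv (preact W z r) - reluDeriv (preact W₀ z r)) ^ 2 * v r ^ 2 * z k ^ 2 := by
      intro k
      simp only [Pi.sub_apply, feature]
      ring
    simp only [this, ← mul_sum, sum_sq_eq_norm_sq, hz, one_pow, mul_one]
  rw [h1]
  split_ifs with h
  · have h2 := abs_reluDeriv_sub_le (preact W z r) (preact W₀ z r)
    exact mul_le_of_le_one_left (sq_nonneg _) ((sq_le_one_iff_abs_le_one _).mpr h2)
  · rw [reluDeriv_preact_eq (hW r) h]
    simp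

/-- The feature change lives on the flip set, where each of the two features contributes one factor
v_r. Cauchy–Schwarz would only give √V · √θ instead of θ. -/
theorem abs_inner_feature_sub_le
    (hθ : ∑ r, (if |preact W₀ z r| ≤ |v r| * ρ then v r ^ 2 else 0) ≤ θ) (hz : ‖z‖ = 1)
    (hW : ∀ r, |preact (W - W₀) z r| ≤ |v r| * ρ) {w : EuclideanSpace ℝ (Fin d)} (hw : ‖w‖ = 1) :
    |inner ℝ (flat (feature v W₀ w)) (flat (feature v W z - feature v W₀ z))| ≤ θ := by
  refine le_trans ?_ hθ
  rw [inner_flat_feature]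
  refine (abs_sum_le_sum_abs _ _).trans (sum_le_sum fun r _ => ?_)
  rw [preact_sub, preact_feature, preact_feature]
  split_ifs with h
  · have h1 := abs_real_inner_le_norm z w
    rw [hz, hw, one_mul] at h1
    have h2 := abs_reluDeriv_sub_le (preact W z r) (preact W₀ z r)
    have h3 : |reluDeriv (preact W₀ w r)| ≤ 1 := by
      rw [abs_of_nonneg (reluDeriv_nonneg _)]; exact reluDeriv_le_one _
    rw [← sub_mul, ← sub_mul, abs_mul, abs_mul, abs_mul, abs_mul, ← sq_abs (v r)]
    calc |reluDeriv (preact W₀ w r)| * |v r|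
          * (|reluDeriv (preact W z r) - reluDeriv (preact W₀ z r)| * |v r| * |inner ℝ z w|)
        ≤ 1 * |v r| * (1 * |v r| * 1) := by gcongr
      _ = _ := by ring
  · rw [reluDeriv_preact_eq (hW r) h]
    simp

end Patterns

section Step

variable {x : Fin K → Fin n → EuclideanSpace ℝ (Fin d)} {y : Fin K → Fin n → ℝ} {η : ℝ} {τ : ℕ}
  {v : Fin m → ℝ} {W₀ : Weights m d} {J : ℕ → Fin K → Fin n} {V δ ρ θ : ℝ}

/-- As long as the neurons outside of the flip sets keep their patterns, the averaged model follows
the linearized dynamics up to a small relative error. -/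
theorem linearized_step (hK : 0 < K) (hx : ∀ i j, ‖x i j‖ = 1) (hη : 0 ≤ η)
    (hτ : 0 < τ) (hV : ∑ r, v r ^ 2 ≤ V) (hδ : 8 * √(K * n) * n * τ * η * V ≤ δ) (hδ1 : δ ≤ 1)
    (hθ : ∀ i j, ∑ r, (if |preact W₀ (x i j) r| ≤ |v r| * ρ then v r ^ 2 else 0) ≤ θ)
    (t : ℕ)
    (hρ : 2 * n * ∑ s ∈ range (t + 1), η * ‖residual x y v (avgIterate x y η τ v W₀ J s)‖ ≤ ρ) :
    let u := fun t => residual x y v (avgIterate x y η τ v W₀ J t)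
    let Φ := featureMap x v W₀
    ‖flat (avgIterate x y η τ v W₀ J (t + 1))
        - (flat (avgIterate x y η τ v W₀ J t) - η • Φ (sampled (J t) (u t)))‖
      ≤ η * (n * (δ * √V + √θ)) * ‖u t‖ ∧
    ‖u (t + 1) - (u t - η • Φ.adjoint (Φ (sampled (J t) (u t))))‖
      ≤ η * (√(K * n) * (n * (δ * V + 3 * θ))) * ‖u t‖ := by
  intro u Φ
  have hV0 : 0 ≤ V := (sum_nonneg fun r _ => sq_nonneg _).trans hV
  have hδ0 : 0 ≤ δ := le_trans (by positivity) hδ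
  set L := localIterate x y η τ v W₀ J t with hL
  set W := avgIterate x y η τ v W₀ J t with hW
  set W' := avgIterate x y η τ v W₀ J (t + 1) with hW'
  have hnK : 0 ≤ (n : ℝ) := Nat.cast_nonneg n
  have hθ0 : ∀ i : Fin K, 0 ≤ θ := fun i =>
    (sum_nonneg fun r _ => by split_ifs <;> positivity).trans (hθ i (J t i))
  have i₀ : Fin K := ⟨0, hK⟩
  have hθ0 := hθ0 i₀
  have hmono : 2 * n * ∑ s ∈ range t, η * ‖residual x y v (avgIterate x y η τ v W₀ J s)‖ ≤ ρ := by
    refine le_trans ?_ hρ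
    rw [sum_range_succ]
    have : 0 ≤ η * ‖residual x y v (avgIterate x y η τ v W₀ J t)‖ := by positivity
    nlinarith
  have rowL : ∀ (i : Fin K) (a : Fin K) (j : Fin n) (r : Fin m),
      |preact (L i - W₀) (x a j) r| ≤ |v r| * ρ := fun i a j r =>
    (abs_preact_localIterate_sub_le hK hx hη hτ hV hδ hδ1 (hx a j) r t i).trans
      (mul_le_mul_of_nonneg_left hmono (abs_nonneg _))
  have rowW : ∀ (a : Fin K) (j : Fin n) (r : Fin m),
      |preact (W - W₀) (x a j) r| ≤ |v r| * ρ := fun a j r =>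
    (abs_preact_avgIterate_sub_le hK hx hη hτ hV hδ hδ1 (hx a j) r t).trans
      (mul_le_mul_of_nonneg_left hmono (abs_nonneg _))
  have rowW' : ∀ (a : Fin K) (j : Fin n) (r : Fin m),
      |preact (W' - W₀) (x a j) r| ≤ |v r| * ρ := fun a j r =>
    (abs_preact_avgIterate_sub_le hK hx hη hτ hV hδ hδ1 (hx a j) r (t + 1)).trans
      (mul_le_mul_of_nonneg_left hρ (abs_nonneg _))
  have hdrift := fun i => (norm_residual_localIterate_sub_le (y := y) (W₀ := W₀) (J := J) hK hx hη
    hτ hV hδ hδ1 t i).1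
  have hres := fun i => norm_residual_localIterate_le (y := y) (W₀ := W₀) (J := J) hK hx hη
    hτ hV hδ hδ1 t i
  set g : Fin K → ℝ := fun i => network v (L i) (x i (J t i)) - y i (J t i) with hg
  have hgu : ∀ i, |g i - u t (i, J t i)| ≤ δ * ‖u t‖ := fun i =>
    (abs_apply_le_norm (residual x y v (L i) - residual x y v W) (i, J t i)).trans (hdrift i)
  have hg2 : ∀ i, |g i| ≤ 2 * ‖u t‖ := fun i =>
    (abs_apply_le_norm (residual x y v (L i)) (i, J t i)).trans (hres i)
  have hu : ∀ i, |u t (i, J t i)| ≤ ‖u t‖ := fun i => abs_apply_le_norm _ _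
  -- the error of the step in weight space
  set D : Fin K → Weights m d := fun i => g i • feature v (L i) (x i (J t i))
    - u t (i, J t i) • feature v W₀ (x i (J t i)) with hD
  -- The error of one device splits into residual drift times a feature (size δ) and residual times
  -- a feature change (governed by θ).
  have hDeq : ∀ i, D i = (g i - u t (i, J t i)) • feature v (L i) (x i (J t i))
      + u t (i, J t i) • (feature v (L i) (x i (J t i)) - feature v W₀ (x i (J t i))) := by
    intro i
    simp only [hD, sub_smul, smul_sub]
    abel
  have hstepW : W' - W = -(η • ((K : ℝ)⁻¹ • ∑ i, (n : ℝ) • g i •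
      feature v (L i) (x i (J t i)))) := by
    rw [hW', avgIterate_succ_eq_sub hK]
    simp only [pointGrad_eq_smul_feature]
    simp [hW, hg, hL]
  have hq : flat W' - (flat W - η • Φ (sampled (J t) (u t)))
      = -(η • ((K : ℝ)⁻¹ • ∑ i, (n : ℝ) • flat (D i))) := by
    have : flat W' - (flat W - η • Φ (sampled (J t) (u t)))
        = flat (W' - W) + η • Φ (sampled (J t) (u t)) := by rw [flat_sub]; abel
    rw [this, hstepW, featureMap_sampled]
    rw [show -(η • ((K : ℝ)⁻¹ • ∑ i, (n : ℝ) • g i • feature v (L i) (x i (J t i))))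
      = (-1 : ℝ) • (η • ((K : ℝ)⁻¹ • ∑ i, (n : ℝ) • g i • feature v (L i) (x i (J t i)))) by
      rw [neg_one_smul]]
    simp only [flat_smul, flat_sum, hD, flat_sub, smul_sub, sum_sub_distrib, mul_smul]
    rw [neg_one_smul]
    abel
  have hcomb : ∀ (f : Fin K → ℝ) (b : ℝ), (∀ i, f i ≤ b) →
      η * ((K : ℝ)⁻¹ * ∑ i, (n : ℝ) * f i) ≤ η * (n * b) := fun f b hf =>
    mul_le_mul_of_nonneg_left
      (inv_mul_sum_le hK fun i => mul_le_mul_of_nonneg_left (hf i) hnK) hη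
  have hDnorm : ∀ i, ‖flat (D i)‖ ≤ (δ * √V + √θ) * ‖u t‖ := by
    intro i
    rw [hDeq, flat_add, flat_smul, flat_smul]
    refine (norm_add_le _ _).trans ?_
    rw [norm_smul, norm_smul, Real.norm_eq_abs, Real.norm_eq_abs]
    have h1 := norm_flat_feature_le hV (L i) (hx i (J t i))
    have h2 := Real.le_sqrt_of_sq_le (norm_flat_feature_sub_sq_le (hθ i (J t i)) (hx i (J t i))
      (rowL i i (J t i)))
    have h3 := mul_le_mul (hgu i) h1 (norm_nonneg _) (by positivity)
    have h4 := mul_le_mul (hu i) h2 (norm_nonneg _) (by positivity)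
    linarith
  constructor
  · rw [hq, norm_neg, norm_smul, norm_smul, Real.norm_of_nonneg hη,
      Real.norm_of_nonneg (by positivity)]
    calc η * ((K : ℝ)⁻¹ * ‖∑ i, (n : ℝ) • flat (D i)‖)
        ≤ η * ((K : ℝ)⁻¹ * ∑ i, (n : ℝ) * ‖flat (D i)‖) := by
          gcongr
          refine (norm_sum_le _ _).trans (sum_le_sum fun i _ => ?_)
          rw [norm_smul, Real.norm_of_nonneg hnK]
      _ ≤ η * (n * ((δ * √V + √θ) * ‖u t‖)) := hcomb _ _ hDnorm
      _ = _ := by ring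
  · have hcoord : ∀ p : Fin K × Fin n,
        |(u (t + 1) - (u t - η • Φ.adjoint (Φ (sampled (J t) (u t))))) p|
          ≤ η * (n * (δ * V + 3 * θ)) * ‖u t‖ := by
      intro p
      set G := flat (feature v W₀ (x p.1 p.2)) with hG
      -- The ReLU remainder contributes 2θ, and the weight-space error tested against a feature
      -- contributes δV + θ.
      have h1 : (u (t + 1) - (u t - η • Φ.adjoint (Φ (sampled (J t) (u t))))) p
          = (network v W' (x p.1 p.2) - network v W (x p.1 p.2) - inner ℝ G (flat (W' - W)))
            + inner ℝ G (flat W' - (flat W - η • Φ (sampled (J t) (u t)))) := by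
        simp only [PiLp.sub_apply, PiLp.smul_apply, smul_eq_mul, u, residual_apply, Φ,
          adjoint_featureMap_apply, inner_sub_right, inner_smul_right, flat_sub]
        ring
      rw [h1]
      refine (abs_add_le _ _).trans ?_
      have hrow : ∀ r, |preact (W' - W) (x p.1 p.2) r| ≤ |v r| * (2 * η * n * ‖u t‖) := by
        intro r
        rw [hstepW, ← neg_one_smul ℝ, preact_smul, preact_smul, preact_smul, preact_sum]
        rw [abs_mul, abs_mul, abs_mul, abs_of_nonneg hη, abs_of_nonneg (by positivity : 0 ≤ (K:ℝ)⁻¹)]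
        calc |(-1 : ℝ)| * (η * ((K : ℝ)⁻¹ * |∑ i, preact ((n : ℝ) • g i •
              feature v (L i) (x i (J t i))) (x p.1 p.2) r|))
            ≤ η * ((K : ℝ)⁻¹ * ∑ i, (n : ℝ) * |preact (g i •
              feature v (L i) (x i (J t i))) (x p.1 p.2) r|) := by
              rw [abs_neg, abs_one, one_mul]
              gcongr
              refine (abs_sum_le_sum_abs _ _).trans (sum_le_sum fun i _ => ?_)
              rw [preact_smul, abs_mul, abs_of_nonneg hnK]
          _ ≤ η * (n * (2 * ‖u t‖ * |v r|)) := by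
              refine hcomb _ _ fun i => ?_
              have h2 := abs_preact_pointGrad_le v (L i) (hx i (J t i)) (hx p.1 p.2)
                (y i (J t i)) r
              rw [pointGrad_eq_smul_feature] at h2
              exact h2.trans (mul_le_mul_of_nonneg_right (hg2 i) (abs_nonneg _))
          _ = _ := by ring
      have h2 := abs_network_sub_sub_inner_le (hθ p.1 p.2) (by positivity) (rowW p.1 p.2)
        (rowW' p.1 p.2) hrow
      have h3 : |inner ℝ G (flat W' - (flat W - η • Φ (sampled (J t) (u t))))|
          ≤ η * (n * ((δ * V + θ) * ‖u t‖)) := by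
        rw [hq, inner_neg_right, abs_neg, inner_smul_right, inner_smul_right, inner_sum, abs_mul,
          abs_mul, abs_of_nonneg hη, abs_of_nonneg (by positivity : 0 ≤ (K:ℝ)⁻¹)]
        calc η * ((K : ℝ)⁻¹ * |∑ i, inner ℝ G ((n : ℝ) • flat (D i))|)
            ≤ η * ((K : ℝ)⁻¹ * ∑ i, (n : ℝ) * |inner ℝ G (flat (D i))|) := by
              gcongr
              refine (abs_sum_le_sum_abs _ _).trans (sum_le_sum fun i _ => ?_)
              rw [inner_smul_right, abs_mul, abs_of_nonneg hnK]
          _ ≤ η * (n * ((δ * V + θ) * ‖u t‖)) := by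
              refine hcomb _ _ fun i => ?_
              rw [hDeq, flat_add, flat_smul, flat_smul, inner_add_right, inner_smul_right,
                inner_smul_right]
              refine (abs_add_le _ _).trans ?_
              rw [abs_mul, abs_mul]
              have h4 : |inner ℝ G (flat (feature v (L i) (x i (J t i))))| ≤ V := by
                refine (abs_real_inner_le_norm _ _).trans ?_
                rw [← Real.mul_self_sqrt hV0]
                exact mul_le_mul (norm_flat_feature_le hV W₀ (hx _ _))
                  (norm_flat_feature_le hV (L i) (hx _ _)) (norm_nonneg _) (Real.sqrt_nonneg _)
              have h5 := abs_inner_feature_sub_le (hθ i (J t i)) (hx i (J t i))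
                (rowL i i (J t i)) (hx p.1 p.2)
              have h6 := mul_le_mul (hgu i) h4 (abs_nonneg _) (by positivity)
              have h7 := mul_le_mul (hu i) h5 (abs_nonneg _) (norm_nonneg _)
              linarith
      linarith
    have h := norm_le_sqrt_card_mul _ (by positivity) hcoord
    refine h.trans (le_of_eq ?_)
    simp
    ring

end Step

end LocalSGD
end

/-! ### Decay of the residual and distance from initialization. -/

noncomputable section

namespace LocalSGD

open Finset

variable {K n m d : ℕ}

/-- Expanding the square, the drift -2ηl beats the error and second-order terms with half of its
strength. Writing 1 + a ≤ exp a puts the noise in an exponent, so that over many steps it simply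
adds up. -/
theorem norm_sub_smul_add_sq_le {F : Type*} [NormedAddCommGroup F] [InnerProductSpace ℝ F]
    {u u' z : F} {η ε b l X : ℝ} (hη : 0 ≤ η) (hz : ‖z‖ ≤ b * ‖u‖)
    (he : ‖u' - (u - η • z)‖ ≤ η * ε * ‖u‖)
    (hin : -2 * inner ℝ u z ≤ (-2 * l + X) * ‖u‖ ^ 2)
    (hsmall : 2 * ε + 2 * η * b ^ 2 + 2 * η * ε ^ 2 ≤ l) :
    ‖u'‖ ^ 2 ≤ ‖u‖ ^ 2 * Real.exp (-(η * l) + η * X) := by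
  set e := u' - (u - η • z) with hedef
  have hu' : u' = u - (η • z - e) := by rw [hedef]; abel
  have h1 : ‖u'‖ ^ 2 = ‖u‖ ^ 2 - 2 * inner ℝ u (η • z - e) + ‖η • z - e‖ ^ 2 := by
    rw [hu', norm_sub_sq_real]
  rw [inner_sub_right, inner_smul_right] at h1
  have h2 : inner ℝ u e ≤ ‖u‖ * (η * ε * ‖u‖) :=
    (real_inner_le_norm _ _).trans (mul_le_mul_of_nonneg_left he (norm_nonneg _))
  have h3 : ‖η • z - e‖ ≤ η * b * ‖u‖ + η * ε * ‖u‖ := by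
    refine (norm_sub_le _ _).trans (add_le_add ?_ he)
    rw [norm_smul, Real.norm_of_nonneg hη, mul_assoc]
    exact mul_le_mul_of_nonneg_left hz hη
  have h4 : ‖η • z - e‖ ^ 2 ≤ (2 * (η * b) ^ 2 + 2 * (η * ε) ^ 2) * ‖u‖ ^ 2 := by
    refine (pow_le_pow_left₀ (norm_nonneg _) h3 2).trans ?_
    nlinarith [mul_nonneg (sq_nonneg (η * b - η * ε)) (sq_nonneg ‖u‖)]
  have h5 : ‖u'‖ ^ 2 ≤ ‖u‖ ^ 2 * (-(η * l) + η * X + 1) := by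
    have h6 := mul_le_mul_of_nonneg_left hin hη
    have h7 := mul_le_mul_of_nonneg_right (mul_le_mul_of_nonneg_left hsmall hη) (sq_nonneg ‖u‖)
    nlinarith
  exact h5.trans (mul_le_mul_of_nonneg_left (Real.add_one_le_exp _) (sq_nonneg _))

theorem mul_sum_range_exp_le {a η : ℝ} (hη : 0 < η) (ha : 0 < a) (hηa : η * a ≤ 1) (t : ℕ) :
    ∑ s ∈ range t, η * Real.exp (-(η * a / 2)) ^ s ≤ 3 / a := by
  set r := Real.exp (-(η * a / 2)) with hr
  have hpos : 0 < η * a := mul_pos hη ha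
  have hr1 : r * (1 + η * a / 2) ≤ 1 := by
    have h1 := Real.add_one_le_exp (η * a / 2)
    calc r * (1 + η * a / 2) ≤ r * Real.exp (η * a / 2) := by
          refine mul_le_mul_of_nonneg_left (by linarith) (Real.exp_pos _).le
      _ = 1 := by rw [hr, ← Real.exp_add]; simp
  have hr0 : 0 < r := Real.exp_pos _
  -- From r(1 + ηa/2) ≤ 1 and ηa ≤ 1.
  have h1r : η * a / 3 ≤ 1 - r := by nlinarith
  have hgeom : (∑ s ∈ range t, r ^ s) * (1 - r) ≤ 1 := by
    have := geom_sum_mul_neg r t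
    rw [this]
    linarith [pow_nonneg hr0.le t]
  have hS : 0 ≤ ∑ s ∈ range t, r ^ s := sum_nonneg fun s _ => pow_nonneg hr0.le s
  rw [← mul_sum, le_div_iff₀ ha]
  nlinarith [mul_le_mul_of_nonneg_left h1r hS]

/-- The relative sampling noise in the decrease of the squared residual. -/
def noise (x : Fin K → Fin n → EuclideanSpace ℝ (Fin d)) (y : Fin K → Fin n → ℝ) (η : ℝ) (τ : ℕ)
    (v : Fin m → ℝ) (W₀ : Weights m d) (t : ℕ) (J : ℕ → Fin K → Fin n) : ℝ :=
  let u := residual x y v (avgIterate x y η τ v W₀ J t)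
  2 * ((K : ℝ)⁻¹ * ‖featureMap x v W₀ u‖ ^ 2
    - inner ℝ (featureMap x v W₀ u) (featureMap x v W₀ (sampled (J t) u))) / ‖u‖ ^ 2

section Main

variable {x : Fin K → Fin n → EuclideanSpace ℝ (Fin d)} {y : Fin K → Fin n → ℝ} {η : ℝ} {τ : ℕ}
  {v : Fin m → ℝ} {W₀ : Weights m d} {J : ℕ → Fin K → Fin n} {V δ ρ θ ε lam : ℝ} {T : ℕ}

theorem sum_norm_le_of_sq_le {F : Type*} [NormedAddCommGroup F] {u : ℕ → F} {η a : ℝ}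
    (hη : 0 < η) (ha : 0 < a) (hηa : η * a ≤ 1) {t : ℕ}
    (hu : ∀ s < t, ‖u s‖ ^ 2 ≤ 4 * ‖u 0‖ ^ 2 * Real.exp (-(η * a)) ^ s) :
    ∑ s ∈ range t, η * ‖u s‖ ≤ 6 * ‖u 0‖ / a := by
  have h1 : ∀ s < t, ‖u s‖ ≤ 2 * ‖u 0‖ * Real.exp (-(η * a / 2)) ^ s := by
    intro s hs
    refine le_of_sq_le_sq ?_ (by positivity)
    refine (hu s hs).trans_eq ?_
    have : Real.exp (-(η * a)) = Real.exp (-(η * a / 2)) ^ 2 := by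
      rw [← Real.exp_nat_mul]
      congr 1
      push_cast
      ring
    rw [this]
    ring
  calc ∑ s ∈ range t, η * ‖u s‖
      ≤ ∑ s ∈ range t, 2 * ‖u 0‖ * (η * Real.exp (-(η * a / 2)) ^ s) := by
        refine sum_le_sum fun s hs => ?_
        have := mul_le_mul_of_nonneg_left (h1 s (mem_range.mp hs)) hη.le
        linarith
    _ ≤ 2 * ‖u 0‖ * (3 / a) := by
        rw [← mul_sum]
        exact mul_le_mul_of_nonneg_left (mul_sum_range_exp_le hη ha hηa t) (by positivity)
    _ = _ := by ring

/-- Bootstrap: decay up to time t bounds ∑ η‖u_s‖ by a geometric series, hence keeps the patterns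
within radius ρ, hence allows one more linearized step. The induction is strong since the sum
involves all earlier residuals. -/
theorem norm_residual_sq_le (hK : 0 < K) (hx : ∀ i j, ‖x i j‖ = 1) (hη : 0 < η)
    (hτ : 0 < τ) (hV : ∑ r, v r ^ 2 ≤ V) (hδ : 8 * √(K * n) * n * τ * η * V ≤ δ) (hδ1 : δ ≤ 1)
    (hθ0 : 0 ≤ θ)
    (hθ : ∀ i j, ∑ r, (if |preact W₀ (x i j) r| ≤ |v r| * ρ then v r ^ 2 else 0) ≤ θ)
    (hlam0 : 0 < lam) (hlam : ∀ c, lam * ‖c‖ ^ 2 ≤ ‖featureMap x v W₀ c‖ ^ 2)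
    (hε : √(K * n) * (n * (δ * V + 3 * θ)) ≤ ε)
    (hsmall : 2 * ε + 2 * η * ((K * n) ^ 2 * V * n) ^ 2 + 2 * η * ε ^ 2 ≤ lam / K)
    (hηlam : η * (lam / K) ≤ 1)
    (hnoise : ∀ t ≤ T, η * ∑ s ∈ range t, noise x y η τ v W₀ s J ≤ 1)
    (hρ : 2 * n * (6 * ‖residual x y v W₀‖ / (lam / K)) ≤ ρ) (t : ℕ) (ht : t ≤ T) :
    ‖residual x y v (avgIterate x y η τ v W₀ J t)‖ ^ 2
      ≤ 4 * ‖residual x y v W₀‖ ^ 2 * Real.exp (-(η * (lam / K))) ^ t := by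
  have hV0 : 0 ≤ V := (sum_nonneg fun r _ => sq_nonneg _).trans hV
  have hδ0 : 0 ≤ δ := le_trans (by positivity) hδ
  have hε0 : 0 ≤ ε := le_trans (by positivity) hε
  have hK' : (0 : ℝ) < K := by positivity
  set u : ℕ → _ := fun t => residual x y v (avgIterate x y η τ v W₀ J t) with hu
  have hu0 : u 0 = residual x y v W₀ := by simp [hu, avgIterate_zero hK]
  -- The accumulated noise costs a factor e, which is less than 4.
  have hweak : ∀ t ≤ T, ‖u t‖ ^ 2 ≤ ‖u 0‖ ^ 2 * Real.exp (-(η * (lam / K)) * t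
      + η * ∑ s ∈ range t, noise x y η τ v W₀ s J) →
      ‖u t‖ ^ 2 ≤ 4 * ‖u 0‖ ^ 2 * Real.exp (-(η * (lam / K))) ^ t := by
    intro t ht h
    refine h.trans ?_
    rw [Real.exp_add, mul_comm (-(η * (lam / K))), Real.exp_nat_mul]
    have h1 : Real.exp (η * ∑ s ∈ range t, noise x y η τ v W₀ s J) ≤ 4 :=
      (Real.exp_le_exp.mpr (hnoise t ht)).trans (by linarith [Real.exp_one_lt_d9])
    have h2 : 0 ≤ ‖u 0‖ ^ 2 * Real.exp (-(η * (lam / K))) ^ t := by positivity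
    nlinarith
  suffices h : ∀ t ≤ T, ‖u t‖ ^ 2 ≤ ‖u 0‖ ^ 2 * Real.exp (-(η * (lam / K)) * t
      + η * ∑ s ∈ range t, noise x y η τ v W₀ s J) by
    have := hweak t ht (h t ht)
    rwa [hu0] at this
  intro t
  induction t using Nat.strong_induction_on with
  | _ t ih =>
    intro ht
    rcases t with _ | t
    · simp
    have hsum := sum_norm_le_of_sq_le (u := u) hη (div_pos hlam0 hK') hηlam (t := t + 1)
      fun s hs => hweak s (by omega) (ih s hs (by omega))
    rw [hu0] at hsum
    have hstep := (linearized_step (y := y) (J := J) hK hx hη.le hτ hV hδ hδ1 hθ t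
      ((mul_le_mul_of_nonneg_left hsum (by positivity)).trans hρ)).2
    simp only at hstep
    have hone := norm_sub_smul_add_sq_le (u' := u (t + 1)) (u := u t)
      (z := (featureMap x v W₀).adjoint (featureMap x v W₀ (sampled (J t) (u t))))
      (b := (K * n) ^ 2 * V * n) (l := lam / K) (X := noise x y η τ v W₀ t J) hη.le
      ((norm_adjoint_featureMap_featureMap_le hx hV W₀ _).trans (by
        rw [mul_assoc _ (n : ℝ)]
        exact mul_le_mul_of_nonneg_left (norm_sampled_le hK _ _) (by positivity)))
      (hstep.trans (by gcongr))
      (by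
        rw [ContinuousLinearMap.adjoint_inner_right]
        -- The division by ‖u‖² in `noise` is meaningful only for u ≠ 0; for u = 0 both sides
        -- vanish.
        rcases eq_or_ne (u t) 0 with h0 | h0
        · simp [h0]
        · have hpos : 0 < ‖u t‖ ^ 2 := by positivity
          have hn : noise x y η τ v W₀ t J * ‖u t‖ ^ 2
              = 2 * ((K : ℝ)⁻¹ * ‖featureMap x v W₀ (u t)‖ ^ 2
                - inner ℝ (featureMap x v W₀ (u t))
                  (featureMap x v W₀ (sampled (J t) (u t)))) := by
            rw [noise]
            exact div_mul_cancel₀ _ hpos.ne'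
          have hl := mul_le_mul_of_nonneg_left (hlam (u t)) (inv_nonneg.mpr hK'.le)
          rw [add_mul, hn, div_eq_inv_mul]
          linarith)
      hsmall
    refine hone.trans ?_
    have hih := ih t (by omega) (by omega)
    calc ‖u t‖ ^ 2 * Real.exp (-(η * (lam / K)) + η * noise x y η τ v W₀ t J)
        ≤ ‖u 0‖ ^ 2 * Real.exp (-(η * (lam / K)) * t
          + η * ∑ s ∈ range t, noise x y η τ v W₀ s J)
          * Real.exp (-(η * (lam / K)) + η * noise x y η τ v W₀ t J) := by gcongr
      _ = _ := by
        rw [mul_assoc, ← Real.exp_add, sum_range_succ]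
        push_cast
        ring_nf

/-- ‖Φc‖² = ⟨c, Φ*Φc⟩ ≤ ‖c‖ ‖Φ*Φc‖, and ‖c‖ ≤ ‖Φc‖/√λ. It turns a bound on the change of the outputs
into a bound on the displacement of the weights. -/
theorem norm_le_div_sqrt_of_adjoint {E F : Type*} [NormedAddCommGroup E] [InnerProductSpace ℝ E]
    [NormedAddCommGroup F] [InnerProductSpace ℝ F] [CompleteSpace E] [CompleteSpace F]
    (Φ : F →L[ℝ] E) (hlam0 : 0 < lam) (hlam : ∀ c, lam * ‖c‖ ^ 2 ≤ ‖Φ c‖ ^ 2) (c : F) :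
    ‖Φ c‖ ≤ ‖Φ.adjoint (Φ c)‖ / √lam := by
  have h1 : ‖Φ c‖ ^ 2 ≤ ‖c‖ * ‖Φ.adjoint (Φ c)‖ := by
    rw [← real_inner_self_eq_norm_sq, ← ContinuousLinearMap.adjoint_inner_right]
    exact real_inner_le_norm _ _
  have h2 : √lam * ‖c‖ ≤ ‖Φ c‖ := by
    refine le_of_sq_le_sq ?_ (norm_nonneg _)
    rw [mul_pow, Real.sq_sqrt hlam0.le]
    exact hlam c
  have hs : 0 < √lam := Real.sqrt_pos.mpr hlam0
  rw [le_div_iff₀ hs]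
  rcases eq_or_lt_of_le (norm_nonneg (Φ c)) with h0 | h0
  · rw [← h0, zero_mul]; exact norm_nonneg _
  · have h3 : √lam * ‖Φ c‖ ^ 2 ≤ ‖Φ c‖ * ‖Φ.adjoint (Φ c)‖ := by
      calc √lam * ‖Φ c‖ ^ 2 ≤ √lam * (‖c‖ * ‖Φ.adjoint (Φ c)‖) :=
            mul_le_mul_of_nonneg_left h1 hs.le
        _ = (√lam * ‖c‖) * ‖Φ.adjoint (Φ c)‖ := by ring
        _ ≤ _ := mul_le_mul_of_nonneg_right h2 (norm_nonneg _)
    nlinarith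

theorem sqrt_div_mul_div_div {l k : ℝ} (hl : 0 < l) (hk : k ≠ 0) (b : ℝ) :
    √l / k * (b / (l / k)) = b / √l := by
  have hs : √l ≠ 0 := (Real.sqrt_pos.mpr hl).ne'
  conv_lhs => rw [← Real.mul_self_sqrt hl.le, Real.sqrt_mul_self (Real.sqrt_nonneg l)]
  field_simp

/-- Test the lower bound on a single coordinate vector. -/
theorem le_of_mul_norm_sq_le (hK : 0 < K) (hn : 0 < n) (hx : ∀ i j, ‖x i j‖ = 1)
    (hV : ∑ r, v r ^ 2 ≤ V) (hlam : ∀ c, lam * ‖c‖ ^ 2 ≤ ‖featureMap x v W₀ c‖ ^ 2) :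
    lam ≤ V := by
  have hV0 : 0 ≤ V := (sum_nonneg fun r _ => sq_nonneg _).trans hV
  set p : Fin K × Fin n := (⟨0, hK⟩, ⟨0, hn⟩) with hp
  have h := hlam (EuclideanSpace.single p 1)
  have h1 : featureMap x v W₀ (EuclideanSpace.single p 1)
      = flat (feature v W₀ (x p.1 p.2)) := by
    rw [featureMap_apply, Finset.sum_eq_single p]
    · simp
    · intro q _ hq
      simp [hq]
    · simp
  rw [h1, PiLp.norm_single, norm_one, one_pow, mul_one] at h
  refine h.trans ?_
  rw [← Real.sq_sqrt hV0]
  exact pow_le_pow_left₀ (norm_nonneg _) (norm_flat_feature_le hV W₀ (hx _ _)) 2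

-- Telescoping both linearized recursions with C = ∑ η s_t gives W(t) ≈ W₀ - ΦC and u_t ≈ u_0 -
-- Φ*ΦC. The second relation bounds ‖Φ*ΦC‖ by a multiple of ‖u_0‖, and invertibility of the Gram
-- matrix then bounds ‖ΦC‖. Both accumulated errors are controlled by ∑ η‖u_s‖.
set_option maxHeartbeats 1000000 in
theorem norm_flat_sub_le (hK : 0 < K) (hn : 0 < n) (hx : ∀ i j, ‖x i j‖ = 1) (hη : 0 < η)
    (hτ : 0 < τ) (hV : ∑ r, v r ^ 2 ≤ V) (hδ : 8 * √(K * n) * n * τ * η * V ≤ δ) (hδ1 : δ ≤ 1)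
    (hθ0 : 0 ≤ θ)
    (hθ : ∀ i j, ∑ r, (if |preact W₀ (x i j) r| ≤ |v r| * ρ then v r ^ 2 else 0) ≤ θ)
    (hlam0 : 0 < lam) (hlam : ∀ c, lam * ‖c‖ ^ 2 ≤ ‖featureMap x v W₀ c‖ ^ 2)
    (hε : √(K * n) * (n * (δ * V + 3 * θ)) ≤ ε)
    (hsmall : 2 * ε + 2 * η * ((K * n) ^ 2 * V * n) ^ 2 + 2 * η * ε ^ 2 ≤ lam / K)
    (hηlam : η * (lam / K) ≤ 1)
    (hnoise : ∀ t ≤ T, η * ∑ s ∈ range t, noise x y η τ v W₀ s J ≤ 1)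
    (hρ : 2 * n * (6 * ‖residual x y v W₀‖ / (lam / K)) ≤ ρ)
    (hq : n * (δ * √V + √θ) ≤ √lam / K) (t : ℕ) (ht : t ≤ T) :
    ‖flat (avgIterate x y η τ v W₀ J t - W₀)‖ ≤ 14 * ‖residual x y v W₀‖ / √lam ∧
    ∀ i, ‖flat (localIterate x y η τ v W₀ J t i - W₀)‖ ≤ 14 * ‖residual x y v W₀‖ / √lam := by
  have hV0 : 0 ≤ V := (sum_nonneg fun r _ => sq_nonneg _).trans hV
  have hδ0 : 0 ≤ δ := le_trans (by positivity) hδ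
  have hε0 : 0 ≤ ε := le_trans (by positivity) hε
  have hK' : (0 : ℝ) < K := by positivity
  have hs : 0 < √lam := Real.sqrt_pos.mpr hlam0
  have hsq := norm_residual_sq_le (y := y) hK hx hη hτ hV hδ hδ1 hθ0 hθ hlam0 hlam hε hsmall
    hηlam hnoise hρ
  set u : ℕ → _ := fun t => residual x y v (avgIterate x y η τ v W₀ J t) with hu
  have hu0 : u 0 = residual x y v W₀ := by simp [hu, avgIterate_zero hK]
  set b := ‖residual x y v W₀‖ with hb
  set Φ := featureMap x v W₀ with hΦ
  have hb0 : 0 ≤ b := norm_nonneg _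
  have hsum : ∀ t ≤ T + 1, ∑ s ∈ range t, η * ‖u s‖ ≤ 6 * b / (lam / K) := by
    intro t ht
    have := sum_norm_le_of_sq_le (u := u) hη (div_pos hlam0 hK') hηlam (t := t)
      fun s hs => by rw [hu0]; exact hsq s (by omega)
    rwa [hu0] at this
  have hstep := fun s (hs : s < T) => linearized_step (y := y) (J := J) hK hx hη.le hτ hV hδ hδ1
    hθ s ((mul_le_mul_of_nonneg_left (hsum (s + 1) (by omega)) (by positivity)).trans hρ)
  have hut : ‖u t‖ ≤ 2 * b := by
    refine le_of_sq_le_sq ((hsq t ht).trans ?_) (by positivity)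
    have : Real.exp (-(η * (lam / K))) ^ t ≤ 1 :=
      pow_le_one₀ (Real.exp_pos _).le (Real.exp_le_one_iff.mpr (by
        have : 0 < η * (lam / K) := by positivity
        linarith))
    nlinarith [sq_nonneg b]
  set C := ∑ s ∈ range t, η • sampled (J s) (u s) with hC
  have hW : ‖flat (avgIterate x y η τ v W₀ J t) - (flat W₀ - Φ C)‖
      ≤ ∑ s ∈ range t, n * (δ * √V + √θ) * (η * ‖u s‖) := by
    have h1 : flat (avgIterate x y η τ v W₀ J t) - (flat W₀ - Φ C)
        = ∑ s ∈ range t, (flat (avgIterate x y η τ v W₀ J (s + 1))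
          - (flat (avgIterate x y η τ v W₀ J s) - η • Φ (sampled (J s) (u s)))) := by
      simp only [sum_sub_distrib, sub_sub_eq_add_sub, sum_add_distrib]
      rw [hC, map_sum]
      have h2 := sum_range_sub (fun s => flat (avgIterate x y η τ v W₀ J s)) t
      simp only [sum_sub_distrib, avgIterate_zero hK] at h2
      simp only [map_smul]
      rw [add_sub_right_comm, ← h2]
      abel
    rw [h1]
    refine (norm_sum_le _ _).trans (sum_le_sum fun s hs => ?_)
    refine ((hstep s (by have := mem_range.mp hs; omega)).1).trans_eq ?_
    simp only [hu]
    ring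
  have hU : ‖u t - (u 0 - Φ.adjoint (Φ C))‖ ≤ ∑ s ∈ range t, ε * (η * ‖u s‖) := by
    have h1 : u t - (u 0 - Φ.adjoint (Φ C))
        = ∑ s ∈ range t, (u (s + 1) - (u s - η • Φ.adjoint (Φ (sampled (J s) (u s))))) := by
      simp only [sum_sub_distrib, sub_sub_eq_add_sub, sum_add_distrib]
      rw [hC, map_sum, map_sum]
      have h2 := sum_range_sub u t
      simp only [sum_sub_distrib] at h2
      simp only [map_smul]
      rw [add_sub_right_comm, ← h2]
      abel
    rw [h1]
    refine (norm_sum_le _ _).trans (sum_le_sum fun s hs => ?_)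
    refine ((hstep s (by have := mem_range.mp hs; omega)).2).trans ?_
    calc η * (√(K * n) * (n * (δ * V + 3 * θ))) * ‖u s‖ ≤ η * ε * ‖u s‖ := by gcongr
      _ = _ := by ring
  rw [← mul_sum] at hW hU
  have hS := hsum t (by omega)
  have hε1 : ε ≤ (lam / K) / 2 := by
    have : 0 ≤ 2 * η * ((K * n) ^ 2 * V * n) ^ 2 + 2 * η * ε ^ 2 := by positivity
    linarith
  -- 6b = b + 2b + 3b: the initial residual, the current residual and the accumulated error.
  have h1 : ‖Φ.adjoint (Φ C)‖ ≤ 6 * b := by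
    have h2 : ε * ∑ s ∈ range t, η * ‖u s‖ ≤ 3 * b := by
      calc ε * ∑ s ∈ range t, η * ‖u s‖ ≤ (lam / K) / 2 * (6 * b / (lam / K)) := by
            refine mul_le_mul hε1 hS (sum_nonneg fun s _ => by positivity) (by positivity)
        _ = 3 * b := by field_simp; ring
    have h3 : Φ.adjoint (Φ C) = u 0 - u t + (u t - (u 0 - Φ.adjoint (Φ C))) := by abel
    rw [h3]
    have h4 := norm_sub_le (u 0) (u t)
    rw [hu0] at h4 hU ⊢
    exact (norm_add_le _ _).trans (by linarith)
  have h2 : ‖Φ C‖ ≤ 6 * b / √lam :=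
    (norm_le_div_sqrt_of_adjoint Φ hlam0 hlam C).trans (by gcongr)
  have h3 : n * (δ * √V + √θ) * ∑ s ∈ range t, η * ‖u s‖ ≤ 6 * b / √lam := by
    calc n * (δ * √V + √θ) * ∑ s ∈ range t, η * ‖u s‖ ≤ √lam / K * (6 * b / (lam / K)) := by
          refine mul_le_mul hq hS (sum_nonneg fun s _ => by positivity) (by positivity)
      _ = 6 * b / √lam := sqrt_div_mul_div_div hlam0 hK'.ne' (6 * b)
  have havg : ‖flat (avgIterate x y η τ v W₀ J t - W₀)‖ ≤ 12 * b / √lam := by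
    have h4 : flat (avgIterate x y η τ v W₀ J t - W₀)
        = (flat (avgIterate x y η τ v W₀ J t) - (flat W₀ - Φ C)) - Φ C := by
      rw [flat_sub]; abel
    rw [h4]
    refine (norm_sub_le _ _).trans ?_
    calc _ ≤ 6 * b / √lam + 6 * b / √lam := add_le_add (hW.trans h3) h2
      _ = _ := by ring
  have hle : 12 * b / √lam ≤ 14 * b / √lam := by gcongr; norm_num
  refine ⟨havg.trans hle, fun i => ?_⟩
  have hlV : √lam ≤ √V := Real.sqrt_le_sqrt (le_of_mul_norm_sq_le hK hn hx hV hlam)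
  have hVs : 0 < √V := hs.trans_le hlV
  -- The drift condition yields a bound by 1/(8√V), and λ ≤ V; so the local drift adds at most 3/2
  -- to the constant 12.
  have hloc : τ * η * n * √V ≤ 1 / (8 * √lam) := by
    have h1K : 1 ≤ √(K * n : ℝ) := by
      rw [Real.one_le_sqrt]
      exact_mod_cast Nat.mul_pos hK hn
    rw [le_div_iff₀ (by positivity)]
    calc τ * η * n * √V * (8 * √lam) ≤ τ * η * n * √V * (8 * √V) := by gcongr
      _ = 1 * (8 * n * τ * η * (√V * √V)) := by ring
      _ ≤ √(K * n) * (8 * n * τ * η * (√V * √V)) := by gcongr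
      _ = 8 * √(K * n) * n * τ * η * V := by rw [Real.mul_self_sqrt hV0]; ring
      _ ≤ 1 := hδ.trans hδ1
  have hdr := (norm_residual_localIterate_sub_le (y := y) (W₀ := W₀) (J := J) hK hx hη.le hτ hV hδ
    hδ1 t i).2
  have h5 : flat (localIterate x y η τ v W₀ J t i - W₀)
      = flat (localIterate x y η τ v W₀ J t i - avgIterate x y η τ v W₀ J t)
        + flat (avgIterate x y η τ v W₀ J t - W₀) := by
    rw [← flat_add]; congr 1; abel
  rw [h5]
  refine (norm_add_le _ _).trans ?_
  calc _ ≤ 6 * (τ * η * n * √V) * ‖u t‖ + 12 * b / √lam := by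
        refine add_le_add (hdr.trans_eq ?_) havg
        simp only [hu]; ring
    _ ≤ 6 * (1 / (8 * √lam)) * (2 * b) + 12 * b / √lam := by gcongr
    _ ≤ 14 * b / √lam := by
        have : 6 * (1 / (8 * √lam)) * (2 * b) = (3 / 2) * b / √lam := by field_simp; ring
        rw [this, ← add_div]
        gcongr
        linarith

end Main

end LocalSGD
end

/-! ### Kolmogorov's maximal inequality for functions of an i.i.d. sequence. -/

noncomputable section

namespace LocalSGD

section Maximal

variable {α : Type*} [MeasurableSpace α]

/-- Prepend an element to a sequence. -/
def seqCons (p : α × (ℕ → α)) : ℕ → α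
  | 0 => p.1
  | n + 1 => p.2 n

theorem measurable_seqCons : Measurable (seqCons : α × (ℕ → α) → ℕ → α) := by
  refine measurable_pi_lambda _ fun n => ?_
  cases n with
  | zero => exact measurable_fst
  | succ n => exact (measurable_pi_apply n).comp measurable_snd

omit [MeasurableSpace α] in
theorem update_seqCons_succ (a b : α) (J : ℕ → α) (t : ℕ) :
    Function.update (seqCons (a, J)) (t + 1) b = seqCons (a, Function.update J t b) := by
  ext s
  cases s with
  | zero => simp [seqCons]
  | succ s => simp [seqCons, Function.update_apply]

/-- An i.i.d. sequence preceded by an independent copy is again i.i.d.; it suffices to compare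
finite boxes. This permits conditioning on the first sample by Fubini. -/
theorem map_seqCons (μ : Measure α) [IsProbabilityMeasure μ] :
    (μ.prod (Measure.infinitePi fun _ : ℕ => μ)).map seqCons = Measure.infinitePi fun _ => μ := by
  classical
  refine Measure.eq_infinitePi _ fun s t ht => ?_
  rw [Measure.map_apply measurable_seqCons (MeasurableSet.pi s.countable_toSet fun i _ => ht i)]
  set s' : Finset ℕ := s.preimage Nat.succ (Nat.succ_injective.injOn) with hs'
  have hset : seqCons ⁻¹' (Set.pi s t)
      = (if 0 ∈ s then t 0 else Set.univ) ×ˢ (Set.pi s' fun n => t (n + 1)) := by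
    ext ⟨a, J⟩
    simp only [Set.mem_preimage, Set.mem_pi, Finset.mem_coe, Set.mem_prod, hs',
      Finset.mem_preimage]
    constructor
    · intro h
      refine ⟨?_, fun n hn => h (n + 1) hn⟩
      split_ifs with h0
      · exact h 0 h0
      · trivial
    · rintro ⟨h0, h1⟩ n hn
      cases n with
      | zero =>
        rw [if_pos hn] at h0
        exact h0
      | succ n => exact h1 n hn
  rw [hset, Measure.prod_prod, Measure.infinitePi_pi _ (fun i _ => ht (i + 1))]
  have h1 : ∏ i ∈ s', μ (t (i + 1)) = ∏ i ∈ s.erase 0, μ (t i) := by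
    refine Finset.prod_bij (fun i _ => i + 1) ?_ ?_ ?_ ?_
    · intro i hi
      simpa [hs'] using hi
    · intro i _ j _ h
      omega
    · intro i hi
      obtain ⟨h0, hi⟩ := Finset.mem_erase.mp hi
      obtain ⟨j, rfl⟩ := Nat.exists_eq_succ_of_ne_zero h0
      exact ⟨j, by simpa [hs'] using hi, rfl⟩
    · intro i _
      rfl
  rw [h1]
  split_ifs with h0
  · exact Finset.mul_prod_erase s (fun i => μ (t i)) h0
  · rw [measure_univ, one_mul, Finset.erase_eq_of_notMem h0]

/-- **Kolmogorov's maximal inequality** for bounded martingale differences of an i.i.d. sequence. -/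
theorem measure_exists_le_abs_sum_le (μ : Measure α) [IsProbabilityMeasure μ] {b c : ℝ}
    (hc : 0 < c) (T : ℕ) (s₀ : ℝ) (X : ℕ → (ℕ → α) → ℝ) (hX : ∀ t, Measurable (X t))
    (hadapted : ∀ t J J', (∀ s ≤ t, J s = J' s) → X t J = X t J') (hb : ∀ t J, |X t J| ≤ b)
    (hmean : ∀ t J, ∫ a, X t (Function.update J t a) ∂μ = 0) :
    Measure.infinitePi (fun _ : ℕ => μ) {J | ∃ t ≤ T, c ≤ |s₀ + ∑ s ∈ Finset.range t, X s J|}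
      ≤ ENNReal.ofReal ((s₀ ^ 2 + T * b ^ 2) / c ^ 2) := by
  have hbig : ∀ (s₀ : ℝ) (T : ℕ), c ≤ |s₀| →
      1 ≤ ENNReal.ofReal ((s₀ ^ 2 + T * b ^ 2) / c ^ 2) := by
    intro s₀ T h
    rw [ENNReal.one_le_ofReal, one_le_div (by positivity)]
    have h1 : c ^ 2 ≤ s₀ ^ 2 := by
      rw [← sq_abs s₀]
      exact pow_le_pow_left₀ hc.le h 2
    have h2 : 0 ≤ T * b ^ 2 := by positivity
    linarith
  -- Conditioning on the first sample replaces s₀ by s₀ + Y and shortens the horizon. Averaging (s₀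
  -- + Y)² + Tb² reproduces the bound, as Y is centred with second moment at most b². If |s₀| ≥ c
  -- already, the bound is at least 1.
  induction T generalizing s₀ X with
  | zero =>
    by_cases h : c ≤ |s₀|
    · exact prob_le_one.trans (hbig s₀ 0 h)
    · have : {J : ℕ → α | ∃ t ≤ 0, c ≤ |s₀ + ∑ s ∈ Finset.range t, X s J|} = ∅ := by
        ext J
        simp only [Set.mem_ofPred_eq, Set.mem_empty_iff_false, iff_false]
        rintro ⟨t, ht, h'⟩
        obtain rfl : t = 0 := by omega
        simp [h] at h'
      rw [this, measure_empty]
      exact zero_le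
  | succ T ih =>
    by_cases h : c ≤ |s₀|
    · exact prob_le_one.trans (hbig s₀ (T + 1) h)
    set A := {J : ℕ → α | ∃ t ≤ T + 1, c ≤ |s₀ + ∑ s ∈ Finset.range t, X s J|} with hA
    have hAm : MeasurableSet A := by
      have : A = ⋃ t ∈ Finset.range (T + 2), {J | c ≤ |s₀ + ∑ s ∈ Finset.range t, X s J|} := by
        ext J
        simp only [hA, Set.mem_ofPred_eq, Set.mem_iUnion, Finset.mem_range, exists_prop]
        exact exists_congr fun t => and_congr_left fun _ => by omega
      rw [this]
      refine Finset.measurableSet_biUnion _ fun t _ => measurableSet_le measurable_const ?_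
      exact (measurable_const.add (Finset.measurable_sum _ fun s _ => hX s)).abs
    have : Nonempty α := nonempty_of_isProbabilityMeasure μ
    obtain ⟨a₀⟩ := this
    -- `X 0` depends on the first sample only, so the tail may be filled arbitrarily.
    set Y : α → ℝ := fun a => X 0 (seqCons (a, fun _ => a₀)) with hY
    have hYm : Measurable Y :=
      (hX 0).comp (measurable_seqCons.comp (measurable_id.prodMk measurable_const))
    have hYX : ∀ a J, X 0 (seqCons (a, J)) = Y a := fun a J =>
      hadapted 0 _ _ fun s hs => by
        obtain rfl : s = 0 := by omega
        rfl
    have hYb : ∀ a, |Y a| ≤ b := fun a => hb 0 _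
    have hYint : Integrable Y μ :=
      Integrable.of_bound hYm.aestronglyMeasurable b (Filter.Eventually.of_forall hYb)
    have hY0 : ∫ a, Y a ∂μ = 0 := by
      rw [← hmean 0 (fun _ => a₀)]
      congr 1
      ext a
      exact hadapted 0 _ _ fun s hs => by
        obtain rfl : s = 0 := by omega
        simp [seqCons]
    have hY2int : Integrable (fun a => Y a ^ 2) μ := by
      refine Integrable.of_bound (hYm.pow_const 2).aestronglyMeasurable (b ^ 2)
        (Filter.Eventually.of_forall fun a => ?_)
      rw [Real.norm_eq_abs, abs_pow]
      exact pow_le_pow_left₀ (abs_nonneg _) (hYb a) 2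
    have hY2 : ∫ a, Y a ^ 2 ∂μ ≤ b ^ 2 := by
      have h1 : ∫ a, Y a ^ 2 ∂μ ≤ ∫ _a, b ^ 2 ∂μ := by
        refine integral_mono hY2int (integrable_const _) fun a => ?_
        simp only
        rw [← sq_abs]
        exact pow_le_pow_left₀ (abs_nonneg _) (hYb a) 2
      simpa using h1
    rw [← map_seqCons μ, Measure.map_apply measurable_seqCons hAm,
      Measure.prod_apply (measurable_seqCons hAm)]
    have hsec : ∀ a, Measure.infinitePi (fun _ : ℕ => μ) (Prod.mk a ⁻¹' (seqCons ⁻¹' A))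
        ≤ ENNReal.ofReal (((s₀ + Y a) ^ 2 + T * b ^ 2) / c ^ 2) := by
      intro a
      refine le_trans (measure_mono ?_) (ih (s₀ + Y a) (fun t J => X (t + 1) (seqCons (a, J)))
        (fun t => (hX _).comp (measurable_seqCons.comp (measurable_const.prodMk measurable_id)))
        (fun t J J' hJ => hadapted _ _ _ fun s hs => ?_) (fun t J => hb _ _)
        fun t J => ?_)
      · rintro J ⟨t, ht, hJ⟩
        rcases t with _ | t
        · simp [h] at hJ
        · refine ⟨t, by omega, ?_⟩
          rw [Finset.sum_range_succ', hYX] at hJ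
          rwa [add_assoc, add_comm (Y a)]
      · cases s with
        | zero => rfl
        | succ s => exact hJ s (by omega)
      · simp only [← update_seqCons_succ]
        exact hmean (t + 1) _
    refine (lintegral_mono hsec).trans ?_
    have hint : Integrable (fun a => ((s₀ + Y a) ^ 2 + T * b ^ 2) / c ^ 2) μ := by
      have : (fun a => ((s₀ + Y a) ^ 2 + T * b ^ 2) / c ^ 2)
          = fun a => (s₀ ^ 2 + T * b ^ 2 + 2 * s₀ * Y a + Y a ^ 2) / c ^ 2 := by
        ext a; ring
      rw [this]
      exact (((integrable_const _).add (hYint.const_mul _)).add hY2int).div_const _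
    rw [← ofReal_integral_eq_lintegral_ofReal hint
      (Filter.Eventually.of_forall fun a => by positivity)]
    refine ENNReal.ofReal_le_ofReal ?_
    rw [integral_div]
    refine div_le_div_of_nonneg_right ?_ (by positivity)
    have : ∫ a, ((s₀ + Y a) ^ 2 + T * b ^ 2) ∂μ = s₀ ^ 2 + T * b ^ 2 + ∫ a, Y a ^ 2 ∂μ := by
      have h1 : (fun a => (s₀ + Y a) ^ 2 + T * b ^ 2)
          = fun a => (s₀ ^ 2 + T * b ^ 2 + 2 * s₀ * Y a) + Y a ^ 2 := by
        ext a; ring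
      have h2 : Integrable (fun a => s₀ ^ 2 + T * b ^ 2 + 2 * s₀ * Y a) μ :=
        (integrable_const _).add (hYint.const_mul _)
      rw [h1, integral_add h2 hY2int,
        integral_add (integrable_const _) (hYint.const_mul _), integral_const_mul, hY0]
      simp
    rw [this]
    push_cast
    linarith

end Maximal

end LocalSGD
end

/-! ### Measurability of the trajectory and the sampling noise. -/

noncomputable section

namespace LocalSGD

open Finset

variable {K n m d : ℕ}

section Measurability

variable {Ω : Type*} [MeasurableSpace Ω]

theorem measurable_reluDeriv : Measurable reluDeriv :=
  Measurable.ite (measurableSet_lt measurable_const measurable_id) measurable_const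
    measurable_const

theorem measurable_relu : Measurable relu := measurable_id.max measurable_const

theorem measurable_preact {f : Ω → Weights m d} (hf : Measurable f)
    (x : EuclideanSpace ℝ (Fin d)) (r : Fin m) : Measurable fun ω => preact (f ω) x r := by
  unfold preact
  fun_prop

theorem measurable_network {f : Ω → Weights m d} {v : Ω → Fin m → ℝ} (hf : Measurable f)
    (hv : Measurable v) (x : EuclideanSpace ℝ (Fin d)) :
    Measurable fun ω => network (v ω) (f ω) x := by
  unfold network
  refine Finset.measurable_sum _ fun r _ => ?_
  exact ((measurable_pi_apply r).comp hv).mul (measurable_relu.comp (measurable_preact hf x r))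

theorem measurable_feature {f : Ω → Weights m d} {v : Ω → Fin m → ℝ} (hf : Measurable f)
    (hv : Measurable v) (x : EuclideanSpace ℝ (Fin d)) :
    Measurable fun ω => feature (v ω) (f ω) x := by
  refine measurable_pi_lambda _ fun r => measurable_pi_lambda _ fun k => ?_
  exact ((measurable_reluDeriv.comp (measurable_preact hf x r)).mul
    ((measurable_pi_apply r).comp hv)).mul_const _

theorem measurable_pointGrad {f : Ω → Weights m d} {v : Ω → Fin m → ℝ} (hf : Measurable f)
    (hv : Measurable v) (x : EuclideanSpace ℝ (Fin d)) (y : ℝ) :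
    Measurable fun ω => pointGrad (v ω) (f ω) x y := by
  simp only [pointGrad_eq_smul_feature]
  exact ((measurable_network hf hv x).sub_const y).smul (measurable_feature hf hv x)

theorem measurable_flat {f : Ω → Weights m d} (hf : Measurable f) :
    Measurable fun ω => flat (f ω) := by
  unfold flat
  refine (WithLp.measurable_toLp 2 _).comp (measurable_pi_lambda _ fun p => ?_)
  exact (measurable_pi_apply p.2).comp ((measurable_pi_apply p.1).comp hf)

theorem measurable_apply_of_countable {β ι : Type*} [MeasurableSpace β] [MeasurableSpace ι]
    [Countable ι] [MeasurableSingletonClass ι] {F : ι → Ω → β} (hF : ∀ i, Measurable (F i))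
    {j : Ω → ι} (hj : Measurable j) : Measurable fun ω => F (j ω) ω :=
  (measurable_from_prod_countable_right hF : Measurable fun p : ι × Ω => F p.1 p.2).comp
    (hj.prodMk measurable_id)

variable (x : Fin K → Fin n → EuclideanSpace ℝ (Fin d)) (y : Fin K → Fin n → ℝ) (η : ℝ) (τ : ℕ)
  {f : Ω → Weights m d} {v : Ω → Fin m → ℝ} {J : Ω → ℕ → Fin K → Fin n}

theorem measurable_sample (hJ : Measurable J) (t : ℕ) (i : Fin K) :
    Measurable fun ω => J ω t i :=
  (measurable_pi_apply i).comp ((measurable_pi_apply t).comp hJ)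

theorem measurable_average {U : Ω → Fin K → Weights m d} (hU : ∀ i, Measurable fun ω => U ω i) :
    Measurable fun ω => average (U ω) := by
  unfold average
  exact (Finset.measurable_sum _ fun i _ => hU i).const_smul ((K : ℝ)⁻¹)

theorem measurable_localIterate (hf : Measurable f) (hv : Measurable v) (hJ : Measurable J)
    (t : ℕ) (i : Fin K) :
    Measurable fun ω => localIterate x y η τ (v ω) (f ω) (J ω) t i := by
  induction t generalizing i with
  | zero => exact hf
  | succ t ih =>
    have hstep : ∀ i, Measurable fun ω =>
        localStep x y η (v ω) (localIterate x y η τ (v ω) (f ω) (J ω) t) (J ω t) i := by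
      intro i
      have hgrad := measurable_apply_of_countable
        (F := fun j ω => pointGrad (v ω) (localIterate x y η τ (v ω) (f ω) (J ω) t i)
          (x i j) (y i j))
        (fun j => measurable_pointGrad (ih i) hv _ _) (measurable_sample hJ t i)
      exact (ih i).sub ((hgrad.const_smul (n : ℝ)).const_smul η)
    simp only [localIterate_succ]
    split_ifs
    · exact measurable_average hstep
    · exact hstep i

theorem measurable_avgIterate (hf : Measurable f) (hv : Measurable v) (hJ : Measurable J)
    (t : ℕ) : Measurable fun ω => avgIterate x y η τ (v ω) (f ω) (J ω) t :=
  measurable_average (measurable_localIterate x y η τ hf hv hJ t)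

theorem measurable_residual (hf : Measurable f) (hv : Measurable v) :
    Measurable fun ω => residual x y (v ω) (f ω) := by
  unfold residual
  refine (WithLp.measurable_toLp 2 _).comp (measurable_pi_lambda _ fun p => ?_)
  exact (measurable_network hf hv _).sub_const _

theorem measurable_featureMap (hf : Measurable f) (hv : Measurable v)
    {c : Ω → EuclideanSpace ℝ (Fin K × Fin n)} (hc : Measurable c) :
    Measurable fun ω => featureMap x (v ω) (f ω) (c ω) := by
  simp only [featureMap_apply]
  refine Finset.measurable_sum _ fun p _ => ?_
  have h1 : Measurable fun ω => c ω p := by fun_prop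
  exact h1.smul (measurable_flat (measurable_feature hf hv _))

theorem measurable_sampled {J : Ω → Fin K → Fin n} (hJ : Measurable J)
    {c : Ω → EuclideanSpace ℝ (Fin K × Fin n)} (hc : Measurable c) :
    Measurable fun ω => sampled (J ω) (c ω) := by
  unfold sampled
  refine (WithLp.measurable_toLp 2 _).comp (measurable_pi_lambda _ fun p => ?_)
  refine Measurable.const_mul (Measurable.ite ?_ (by fun_prop) measurable_const) _
  exact ((measurable_pi_apply p.1).comp hJ) (measurableSet_singleton p.2)

theorem measurable_noise (hf : Measurable f) (hv : Measurable v) (hJ : Measurable J) (t : ℕ) :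
    Measurable fun ω => noise x y η τ (v ω) (f ω) t (J ω) := by
  unfold noise
  have hu := measurable_residual x y (measurable_avgIterate x y η τ hf hv hJ t) hv
  have hΦ := measurable_featureMap x hf hv hu
  have hΦc := measurable_featureMap x hf hv
    (measurable_sampled ((measurable_pi_apply t).comp hJ) hu)
  exact ((((hΦ.norm.pow_const 2).const_mul _).sub (hΦ.inner hΦc)).const_mul 2).div
    (hu.norm.pow_const 2)

end Measurability

section Noise

variable (x : Fin K → Fin n → EuclideanSpace ℝ (Fin d)) (y : Fin K → Fin n → ℝ) (η : ℝ) (τ : ℕ)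
  (v : Fin m → ℝ) (W₀ : Weights m d)

theorem localIterate_congr {J J' : ℕ → Fin K → Fin n} {t : ℕ} (h : ∀ s < t, J s = J' s) :
    localIterate x y η τ v W₀ J t = localIterate x y η τ v W₀ J' t := by
  induction t with
  | zero => rfl
  | succ t ih =>
    rw [localIterate_succ, localIterate_succ, ih fun s hs => h s (by omega), h t (by omega)]

theorem noise_congr {J J' : ℕ → Fin K → Fin n} {t : ℕ} (h : ∀ s ≤ t, J s = J' s) :
    noise x y η τ v W₀ t J = noise x y η τ v W₀ t J' := by
  unfold noise avgIterate
  rw [localIterate_congr x y η τ v W₀ fun s hs => h s hs.le, h t le_rfl]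

/-- The numerator is quadratic in the residual, so the quotient is bounded whatever the trajectory
does. -/
theorem abs_noise_le (hK : 0 < K) (hx : ∀ i j, ‖x i j‖ = 1) {V : ℝ} (hV : ∑ r, v r ^ 2 ≤ V)
    (t : ℕ) (J : ℕ → Fin K → Fin n) :
    |noise x y η τ v W₀ t J| ≤ 4 * ((K * n) ^ 2 * V * n) := by
  have hV0 : 0 ≤ V := (sum_nonneg fun r _ => sq_nonneg _).trans hV
  unfold noise
  set u := residual x y v (avgIterate x y η τ v W₀ J t)
  rcases eq_or_ne u 0 with h0 | h0
  · simp only [h0, norm_zero]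
    norm_num
    positivity
  have hu : 0 < ‖u‖ ^ 2 := by positivity
  rw [abs_div, abs_of_pos hu, div_le_iff₀ hu, abs_mul]
  have hn : (1 : ℝ) ≤ n := by
    rcases Nat.eq_zero_or_pos n with rfl | h
    · exact absurd (Subsingleton.elim u 0) h0
    · exact_mod_cast h
  have hK1 : (K : ℝ)⁻¹ ≤ 1 := inv_le_one_of_one_le₀ (by exact_mod_cast hK)
  have hK0 : 0 ≤ (K : ℝ)⁻¹ := by positivity
  have h1 := norm_featureMap_le hx hV W₀ u
  have h2 : ‖featureMap x v W₀ (sampled (J t) u)‖ ≤ (K * n) * √V * (n * ‖u‖) :=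
    (norm_featureMap_le hx hV W₀ _).trans
      (mul_le_mul_of_nonneg_left (norm_sampled_le hK _ _) (by positivity))
  have h3 : |inner ℝ (featureMap x v W₀ u) (featureMap x v W₀ (sampled (J t) u))|
      ≤ (K * n) ^ 2 * V * n * ‖u‖ ^ 2 := by
    refine (abs_real_inner_le_norm _ _).trans ?_
    refine (mul_le_mul h1 h2 (norm_nonneg _) (by positivity)).trans_eq ?_
    rw [show (K * n) * √V * ‖u‖ * ((K * n) * √V * (n * ‖u‖))
      = (K * n) ^ 2 * (√V * √V) * n * ‖u‖ ^ 2 by ring, Real.mul_self_sqrt hV0]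
  have h4 : |(K : ℝ)⁻¹ * ‖featureMap x v W₀ u‖ ^ 2| ≤ (K * n) ^ 2 * V * n * ‖u‖ ^ 2 := by
    rw [abs_of_nonneg (by positivity)]
    calc (K : ℝ)⁻¹ * ‖featureMap x v W₀ u‖ ^ 2 ≤ 1 * ((K * n) * √V * ‖u‖) ^ 2 := by gcongr
      _ = (K * n) ^ 2 * (√V * √V) * 1 * ‖u‖ ^ 2 := by ring
      _ ≤ (K * n) ^ 2 * (√V * √V) * n * ‖u‖ ^ 2 := by gcongr
      _ = _ := by rw [Real.mul_self_sqrt hV0]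
  have h5 := abs_sub ((K : ℝ)⁻¹ * ‖featureMap x v W₀ u‖ ^ 2)
    (inner ℝ (featureMap x v W₀ u) (featureMap x v W₀ (sampled (J t) u)))
  rw [abs_two]
  linarith

theorem integral_uniformOn_univ [NeZero n] (f : Fin n → ℝ) :
    ∫ j, f j ∂(uniformOn (Set.univ : Set (Fin n))) = (n : ℝ)⁻¹ * ∑ j, f j := by
  rw [integral_fintype (Integrable.of_finite), mul_sum]
  refine sum_congr rfl fun j _ => ?_
  rw [Measure.real, uniformOn_univ, Measure.count_singleton]
  simp

/-- The model at time t uses only the samples before t, so resampling at t leaves the residual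
fixed; the factor n in the gradient compensates the uniform weight 1/n. -/
theorem integral_noise_update (hK : 0 < K) [NeZero n] (t : ℕ) (J : ℕ → Fin K → Fin n) :
    ∫ a, noise x y η τ v W₀ t (Function.update J t a)
      ∂(Measure.pi fun _ : Fin K => uniformOn (Set.univ : Set (Fin n))) = 0 := by
  set Φ := featureMap x v W₀ with hΦ
  set u := residual x y v (avgIterate x y η τ v W₀ J t) with hu
  set h : Fin K → Fin n → ℝ := fun i j =>
    (K : ℝ)⁻¹ * (n * u (i, j) * inner ℝ (Φ u) (flat (feature v W₀ (x i j)))) with hh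
  have h1 : ∀ a, noise x y η τ v W₀ t (Function.update J t a)
      = 2 * ((K : ℝ)⁻¹ * ‖Φ u‖ ^ 2 - ∑ i, h i (a i)) / ‖u‖ ^ 2 := by
    intro a
    have h2 : avgIterate x y η τ v W₀ (Function.update J t a) t = avgIterate x y η τ v W₀ J t := by
      unfold avgIterate
      rw [localIterate_congr x y η τ v W₀ (J' := J) fun s hs => by
        rw [Function.update_of_ne hs.ne]]
    unfold noise
    rw [h2, Function.update_self]
    dsimp only
    rw [featureMap_sampled, inner_smul_right, inner_sum]
    simp only [inner_smul_right, hh, mul_sum, ← hu, ← hΦ]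
  have hn : (n : ℝ) ≠ 0 := Nat.cast_ne_zero.mpr (NeZero.ne n)
  have hint : ∀ i, ∫ a : Fin K → Fin n, h i (a i)
      ∂(Measure.pi fun _ : Fin K => uniformOn (Set.univ : Set (Fin n)))
      = (K : ℝ)⁻¹ * ∑ j, u (i, j) * inner ℝ (Φ u) (flat (feature v W₀ (x i j))) := by
    intro i
    rw [integral_comp_eval (μ := fun _ : Fin K => uniformOn (Set.univ : Set (Fin n)))
      (f := h i) (measurable_of_finite _).aestronglyMeasurable, integral_uniformOn_univ,
      mul_sum, mul_sum]
    refine sum_congr rfl fun j _ => ?_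
    simp only [hh]
    field_simp
  have hsum : ∑ i, (K : ℝ)⁻¹ * ∑ j, u (i, j) * inner ℝ (Φ u) (flat (feature v W₀ (x i j)))
      = (K : ℝ)⁻¹ * ‖Φ u‖ ^ 2 := by
    have h2 : inner ℝ (Φ u) (Φ u)
        = inner ℝ (Φ u) (∑ p, u p • flat (feature v W₀ (x p.1 p.2))) :=
      congrArg _ (featureMap_apply x v W₀ u)
    rw [← real_inner_self_eq_norm_sq, h2, inner_sum, Fintype.sum_prod_type, mul_sum]
    simp only [inner_smul_right]
  simp only [h1]
  rw [integral_div, integral_const_mul, integral_sub (integrable_const _) .of_finite,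
    integral_finsetSum _ fun i _ => .of_finite]
  simp only [hint, hsum]
  simp

/-- The maximal inequality started at 0, with threshold 1/η. -/
theorem infinitePi_exists_noise_le (hK : 0 < K) [NeZero n] (hη : 0 < η)
    (hx : ∀ i j, ‖x i j‖ = 1) {V : ℝ} (hV : ∑ r, v r ^ 2 ≤ V) (T : ℕ) :
    samplingLaw K n {J | ∃ t ≤ T, 1 < η * ∑ s ∈ range t, noise x y η τ v W₀ s J}
      ≤ ENNReal.ofReal (T * (4 * η * ((K * n) ^ 2 * V * n)) ^ 2) := by
  have h := measure_exists_le_abs_sum_le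
    (Measure.pi fun _ : Fin K => uniformOn (Set.univ : Set (Fin n)))
    (c := η⁻¹) (by positivity) T 0 (noise x y η τ v W₀)
    (fun t => measurable_noise x y η τ (f := fun _ => W₀) (v := fun _ => v) (J := id)
      measurable_const measurable_const measurable_id t)
    (fun t J J' hJ => noise_congr x y η τ v W₀ hJ)
    (abs_noise_le x y η τ v W₀ hK hx hV) (integral_noise_update x y η τ v W₀ hK)
  refine (measure_mono ?_).trans (h.trans_eq ?_)
  · rintro J ⟨t, ht, hJ⟩
    refine ⟨t, ht, ?_⟩
    rw [zero_add]
    refine le_trans ?_ (le_abs_self _)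
    rw [inv_le_iff_one_le_mul₀' hη]
    exact hJ.le
  · congr 1
    field_simp
    ring

end Noise

end LocalSGD
end

/-! ### Gaussian estimates and projections of a Gaussian vector. -/

noncomputable section

namespace LocalSGD

open Finset

section Gaussian

/-- The density is at most 1/(2√v), because 2π ≥ 4. -/
theorem gaussianReal_Icc_le {v : ℝ≥0} (hv : v ≠ 0) (a : ℝ) :
    gaussianReal 0 v (Set.Icc (-a) a) ≤ ENNReal.ofReal (a / √v) := by
  have hv' : (0 : ℝ) < v := by positivity
  have hs : 0 < √(v : ℝ) := Real.sqrt_pos.mpr hv'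
  have hpdf : ∀ x, gaussianPDF 0 v x ≤ ENNReal.ofReal (1 / (2 * √v)) := by
    intro x
    refine ENNReal.ofReal_le_ofReal ?_
    rw [gaussianPDFReal_def]
    have h1 : 2 * √(v : ℝ) ≤ √(2 * Real.pi * v) := by
      refine Real.le_sqrt_of_sq_le ?_
      rw [mul_pow, Real.sq_sqrt hv'.le]
      nlinarith [Real.pi_gt_three]
    calc (√(2 * Real.pi * v))⁻¹ * Real.exp (-(x - 0) ^ 2 / (2 * v))
        ≤ (2 * √v)⁻¹ * 1 := by
          refine mul_le_mul (inv_anti₀ (by positivity) h1) ?_ (Real.exp_pos _).le (by positivity)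
          rw [Real.exp_le_one_iff]
          exact div_nonpos_of_nonpos_of_nonneg (by nlinarith [sq_nonneg (x - 0)]) (by positivity)
      _ = 1 / (2 * √v) := by rw [mul_one, one_div]
  rw [gaussianReal_apply 0 hv]
  calc ∫⁻ x in Set.Icc (-a) a, gaussianPDF 0 v x
      ≤ ∫⁻ _x in Set.Icc (-a) a, ENNReal.ofReal (1 / (2 * √v)) := lintegral_mono hpdf
    _ = ENNReal.ofReal (a / √v) := by
        rw [setLIntegral_const, Real.volume_Icc, ← ENNReal.ofReal_mul (by positivity)]
        congr 1
        field_simp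
        ring

/-- Within one standard deviation the density is at least e^{-1/2}/√(2πv), which exceeds 1/(5√v). -/
theorem le_gaussianReal_of_subset {v : ℝ≥0} (hv : v ≠ 0) {S : Set ℝ}
    (hSv : ∀ x ∈ S, |x| ≤ √v) :
    ENNReal.ofReal (1 / (5 * √v)) * volume S ≤ gaussianReal 0 v S := by
  have hv' : (0 : ℝ) < v := by positivity
  have hs : 0 < √(v : ℝ) := Real.sqrt_pos.mpr hv'
  rw [gaussianReal_apply 0 hv, ← setLIntegral_const]
  refine setLIntegral_mono_ae (measurable_gaussianPDF 0 v).aemeasurable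
    (Filter.Eventually.of_forall fun x hx => ENNReal.ofReal_le_ofReal ?_)
  rw [gaussianPDFReal_def]
  have h1 : √(2 * Real.pi * v) ≤ 2.51 * √v := by
    rw [Real.sqrt_mul (by positivity)]
    refine mul_le_mul_of_nonneg_right ?_ hs.le
    rw [Real.sqrt_le_left (by norm_num)]
    nlinarith [Real.pi_lt_d4]
  have h2 : x ^ 2 ≤ v := by
    rw [← sq_abs, ← Real.sq_sqrt hv'.le]
    exact pow_le_pow_left₀ (abs_nonneg _) (hSv x hx) 2
  have h5 : 1 / (2.51 * √v) ≤ (√(2 * Real.pi * v))⁻¹ := by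
    rw [one_div]
    exact inv_anti₀ (by positivity) h1
  have h6 : (3 / 5 : ℝ) ≤ Real.exp (-(x - 0) ^ 2 / (2 * v)) := by
    have h4 : (-1 / 2 : ℝ) ≤ -(x - 0) ^ 2 / (2 * v) := by
      rw [div_le_div_iff₀ (by norm_num) (by positivity)]
      nlinarith
    refine le_trans ?_ (Real.exp_le_exp.mpr h4)
    have h7 : Real.exp (-1 / 2) ^ 2 = (Real.exp 1)⁻¹ := by
      rw [← Real.exp_nat_mul, ← Real.exp_neg]
      norm_num
    have h8 : (0.36 : ℝ) ≤ (Real.exp 1)⁻¹ := by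
      rw [le_inv_comm₀ (by norm_num) (Real.exp_pos 1)]
      exact Real.exp_one_lt_d9.le.trans (by norm_num)
    nlinarith [Real.exp_pos (-1 / 2 : ℝ)]
  calc 1 / (5 * √v) ≤ 1 / (2.51 * √v) * (3 / 5) := by
        rw [div_mul_div_comm, div_le_div_iff₀ (by positivity) (by positivity)]
        nlinarith
    _ ≤ _ := mul_le_mul h5 h6 (by norm_num) (by positivity)

theorem integral_sq_gaussianReal (v : ℝ≥0) : ∫ z, z ^ 2 ∂gaussianReal 0 v = v := by
  have h := variance_fun_id_gaussianReal (μ := 0) (v := v)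
  rwa [variance_of_integral_eq_zero (by fun_prop) (by simp)] at h

theorem integrable_pow_gaussianReal (v : ℝ≥0) (k : ℕ) :
    Integrable (fun z => z ^ k) (gaussianReal 0 v) := by
  rcases Nat.eq_zero_or_pos k with rfl | hk
  · simp
  have h : MemLp id (k : ENNReal) (gaussianReal 0 v) := memLp_id_gaussianReal' _ (by simp)
  have h1 := h.integrable_norm_pow hk.ne'
  refine (integrable_norm_iff (by fun_prop)).mp ?_
  simpa [norm_pow] using h1

/-- From t⁴ ≤ 24 cosh t (one term of the series) at t = z/√v, the moment generating function gives
24 e^{1/2} < 40. The sharp constant 3 is not needed. -/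
theorem integral_pow_four_gaussianReal_le (v : ℝ≥0) :
    ∫ z, z ^ 4 ∂gaussianReal 0 v ≤ 40 * (v : ℝ) ^ 2 := by
  rcases eq_or_ne v 0 with rfl | hv
  · simp
  have hv' : (0 : ℝ) < v := by positivity
  have hs : 0 < √(v : ℝ) := Real.sqrt_pos.mpr hv'
  set a : ℝ := (√(v : ℝ))⁻¹ with ha
  have ha2 : v * a ^ 2 = 1 := by
    rw [ha, inv_pow, Real.sq_sqrt hv'.le, mul_inv_cancel₀ hv'.ne']
  have hmgf : ∀ b : ℝ, v * b ^ 2 = 1 →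
      ∫ z, Real.exp (b * z) ∂gaussianReal 0 v = Real.exp (1 / 2) := by
    intro b hb
    have h := congrFun (mgf_id_gaussianReal (μ := 0) (v := v)) b
    rw [mgf, zero_mul, zero_add, hb] at h
    simpa using h
  have hpt : ∀ z : ℝ, z ^ 4 ≤ 12 * (v : ℝ) ^ 2 * (Real.exp (a * z) + Real.exp (-a * z)) := by
    intro z
    have h3 : (v : ℝ) ^ 2 * (a * z) ^ 4 = z ^ 4 := by
      calc (v : ℝ) ^ 2 * (a * z) ^ 4 = (v * a ^ 2) ^ 2 * z ^ 4 := by ring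
        _ = z ^ 4 := by rw [ha2]; ring
    have h5 : (a * z) ^ 4 ≤ 12 * (Real.exp (a * z) + Real.exp (-a * z)) := by
      have h7 : ∀ t : ℝ, t ^ 4 ≤ 24 * Real.cosh t := by
        intro t
        have hs := Real.hasSum_cosh t
        have h9 := hs.summable.sum_le_tsum {2} fun i _ => by
          rw [pow_mul]; positivity
        rw [hs.tsum_eq, sum_singleton] at h9
        norm_num [Nat.factorial] at h9
        linarith
      have h10 := h7 (a * z)
      rw [Real.cosh_eq, ← neg_mul] at h10
      linarith
    rw [← h3]
    nlinarith [sq_nonneg (v : ℝ)]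
  have hint : ∀ b : ℝ, Integrable (fun z => Real.exp (b * z)) (gaussianReal 0 v) := fun b =>
    integrable_exp_mul_gaussianReal b
  calc ∫ z, z ^ 4 ∂gaussianReal 0 v
      ≤ ∫ z, 12 * (v : ℝ) ^ 2 * (Real.exp (a * z) + Real.exp (-a * z)) ∂gaussianReal 0 v :=
        integral_mono (integrable_pow_gaussianReal v 4) (((hint a).add (hint (-a))).const_mul _) hpt
    _ = 12 * (v : ℝ) ^ 2 * (Real.exp (1 / 2) + Real.exp (1 / 2)) := by
        rw [integral_const_mul, integral_add (hint a) (hint (-a)), hmgf a ha2,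
          hmgf (-a) (by rw [neg_sq, ha2])]
    _ ≤ 40 * (v : ℝ) ^ 2 := by
        have h1 : Real.exp (1 / 2) ≤ 1.65 := by
          have h7 : Real.exp (1 / 2) ^ 2 = Real.exp 1 := by
            rw [← Real.exp_nat_mul]; norm_num
          nlinarith [Real.exp_one_lt_d9, Real.exp_pos (1 / 2 : ℝ)]
        nlinarith [sq_nonneg (v : ℝ)]

end Gaussian

section Projection

variable {d : ℕ}

/-- The law of the weight vector of one hidden neuron. -/
abbrev neuronLaw (d : ℕ) (s : ℝ≥0) : Measure (Fin d → ℝ) := Measure.pi fun _ => gaussianReal 0 s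

/-- The pre-activation of one neuron. -/
def proj (w : Fin d → ℝ) (z : EuclideanSpace ℝ (Fin d)) : ℝ := ∑ k, w k * z k

theorem preact_eq_proj {m : ℕ} (W : Weights m d) (z : EuclideanSpace ℝ (Fin d)) (r : Fin m) :
    preact W z r = proj (W r) z := rfl

theorem measurable_proj (z : EuclideanSpace ℝ (Fin d)) : Measurable fun w => proj w z := by
  unfold proj
  fun_prop

theorem memLp_coord_mul (s : ℝ≥0) (z : EuclideanSpace ℝ (Fin d)) (k : Fin d) :
    MemLp (fun w => w k * z k) 2 (neuronLaw d s) := by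
  have h : MemLp (fun w : Fin d → ℝ => w k) 2 (neuronLaw d s) :=
    (memLp_id_gaussianReal' (μ := 0) (v := s) 2 (by simp)).comp_measurePreserving
      (measurePreserving_eval (fun _ : Fin d => gaussianReal 0 s) k)
  exact h.mul_const _

theorem covariance_proj (s : ℝ≥0) (a b : EuclideanSpace ℝ (Fin d)) :
    cov[fun w => proj w a, fun w => proj w b; neuronLaw d s] = s * inner ℝ a b := by
  have hmp := fun k => measurePreserving_eval (fun _ : Fin d => gaussianReal 0 s) k
  have hL : ∀ k, MemLp (fun w : Fin d → ℝ => w k) 2 (neuronLaw d s) := fun k =>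
    (memLp_id_gaussianReal' (μ := 0) (v := s) 2 (by simp)).comp_measurePreserving (hmp k)
  have hcov : ∀ k l, cov[fun w : Fin d → ℝ => w k, fun w => w l; neuronLaw d s]
      = if k = l then (s : ℝ) else 0 := by
    intro k l
    split_ifs with h
    · subst h
      rw [covariance_self (measurable_pi_apply k).aemeasurable]
      have := (hmp k).variance_fun_comp (f := fun z : ℝ => z) (by fun_prop)
      rw [this, variance_fun_id_gaussianReal]
    · refine IndepFun.covariance_eq_zero ?_ (hL k) (hL l)
      exact (iIndepFun_pi (μ := fun _ : Fin d => gaussianReal 0 s) (X := fun _ z => z)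
        fun _ => by fun_prop).indepFun h
  unfold proj
  rw [covariance_fun_sum_fun_sum (fun k => memLp_coord_mul s a k) (fun k => memLp_coord_mul s b k),
    ← sum_mul_eq_inner, mul_sum]
  refine sum_congr rfl fun k _ => ?_
  simp only [covariance_mul_const_left, covariance_mul_const_right, hcov]
  simp [mul_assoc]

theorem hasGaussianLaw_id_neuronLaw (s : ℝ≥0) :
    HasGaussianLaw (fun w : Fin d → ℝ => fun k => w k) (neuronLaw d s) := by
  refine iIndepFun.hasGaussianLaw (X := fun k (w : Fin d → ℝ) => w k) (fun k => ⟨?_⟩) ?_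
  · rw [(measurePreserving_eval (fun _ : Fin d => gaussianReal 0 s) k).map_eq]
    infer_instance
  · exact iIndepFun_pi (μ := fun _ : Fin d => gaussianReal 0 s) (X := fun _ z => z)
      fun _ => by fun_prop

/-- `proj` as a continuous linear functional of the weight vector. -/
def projCLM (z : EuclideanSpace ℝ (Fin d)) : (Fin d → ℝ) →L[ℝ] ℝ :=
  ∑ k, z k • ContinuousLinearMap.proj k

theorem projCLM_apply (z : EuclideanSpace ℝ (Fin d)) (w : Fin d → ℝ) :
    projCLM z w = proj w z := by
  simp [projCLM, proj, mul_comm]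

theorem integral_proj (s : ℝ≥0) (z : EuclideanSpace ℝ (Fin d)) :
    ∫ w, proj w z ∂neuronLaw d s = 0 := by
  unfold proj
  rw [integral_finsetSum _ fun k _ => (memLp_coord_mul s z k).integrable (by norm_num)]
  refine sum_eq_zero fun k _ => ?_
  rw [integral_mul_const]
  have h := integral_eval (μ := fun _ : Fin d => gaussianReal 0 s) (i := k)
  rw [h]
  simp

theorem map_proj (s : ℝ≥0) (z : EuclideanSpace ℝ (Fin d)) :
    (neuronLaw d s).map (fun w => proj w z) = gaussianReal 0 (s * ‖z‖₊ ^ 2) := by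
  have h := ((hasGaussianLaw_id_neuronLaw (d := d) s).map_fun (projCLM z)).map_eq_gaussianReal
  simp only [projCLM_apply] at h
  rw [h, integral_proj, ← covariance_self (measurable_proj z).aemeasurable, covariance_proj,
    real_inner_self_eq_norm_sq]
  congr 1
  ext
  rw [Real.coe_toNNReal _ (by positivity)]
  simp

/-- Jointly Gaussian variables are independent once uncorrelated, and the covariances are multiples
of the inner products. -/
theorem indepFun_proj {ι : Type*} [Finite ι] (s : ℝ≥0) (a : EuclideanSpace ℝ (Fin d))
    (b : ι → EuclideanSpace ℝ (Fin d)) (h : ∀ i, inner ℝ a (b i) = 0) :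
    IndepFun (fun w => proj w a) (fun w i => proj w (b i)) (neuronLaw d s) := by
  have := Fintype.ofFinite ι
  have hG := (hasGaussianLaw_id_neuronLaw (d := d) s).map_fun
    ((ContinuousLinearMap.pi fun _ : Unit => projCLM a).prod
      (ContinuousLinearMap.pi fun i => projCLM (b i)))
  have hI := HasGaussianLaw.indepFun_of_covariance_eval (X := fun (_ : Unit) w => proj w a)
    (Y := fun i w => proj w (b i)) (P := neuronLaw d s)
    (by simpa [projCLM_apply, ContinuousLinearMap.prod_apply] using hG)
    (fun _ i => by rw [covariance_proj, h, mul_zero])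
  exact hI.comp (measurable_pi_apply ()) measurable_id

end Projection

end LocalSGD
end

/-! ### Positive definiteness of the expected Gram matrix. -/

noncomputable section

namespace LocalSGD

open Finset

section Gram

variable {d : ℕ} {ι : Type*} [Fintype ι] [DecidableEq ι]

theorem half_sq_le_norm_add_sq_add_norm_sq {E : Type*} [NormedAddCommGroup E] (a b : E) :
    ‖a‖ ^ 2 / 2 ≤ ‖a + b‖ ^ 2 + ‖b‖ ^ 2 := by
  have h : ‖a‖ ≤ ‖a + b‖ + ‖b‖ := by
    simpa using norm_sub_le (a + b) b
  have h2 := pow_le_pow_left₀ (norm_nonneg a) h 2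
  nlinarith [sq_nonneg (‖a + b‖ - ‖b‖)]

/-- Both half intervals next to 0 have Gaussian mass at least h/(5√s), so bounds valid on either
side of the activation boundary add up. -/
theorem sum_insert_norm_sq_lintegral_le {s : ℝ≥0} (hs : s ≠ 0) {h : ℝ} (h0 : 0 ≤ h)
    (hh : h ≤ √s) {G : ℝ → ENNReal} {a b c : ℝ} (hb : 0 ≤ b) (ha : 0 ≤ a)
    (hcab : c ≤ a + b) (hpos : ∀ ξ ∈ Set.Ioc 0 h, ENNReal.ofReal a ≤ G ξ)
    (hneg : ∀ ξ ∈ Set.Icc (-h) 0, ENNReal.ofReal b ≤ G ξ) :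
    ENNReal.ofReal (h / (5 * √s) * c) ≤ ∫⁻ ξ, G ξ ∂gaussianReal 0 s := by
  have hs' : 0 < √(s : ℝ) := Real.sqrt_pos.mpr (by positivity)
  have hdisj : Disjoint (Set.Icc (-h) 0) (Set.Ioc 0 h) := by
    rw [Set.disjoint_left]
    rintro ξ ⟨-, h1⟩ ⟨h2, -⟩
    linarith
  have h1 := le_gaussianReal_of_subset hs (S := Set.Icc (-h) 0) fun x hx => by
    rw [abs_le]; exact ⟨by linarith [hx.1], by linarith [hx.2]⟩
  have h2 := le_gaussianReal_of_subset hs (S := Set.Ioc 0 h) fun x hx => by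
    rw [abs_le]; exact ⟨by linarith [hx.1], by linarith [hx.2]⟩
  rw [Real.volume_Icc, ← ENNReal.ofReal_mul (by positivity)] at h1
  rw [Real.volume_Ioc, ← ENNReal.ofReal_mul (by positivity)] at h2
  calc ENNReal.ofReal (h / (5 * √s) * c)
      ≤ ENNReal.ofReal (b * (1 / (5 * √s) * (0 - -h)) + a * (1 / (5 * √s) * (h - 0))) := by
        refine ENNReal.ofReal_le_ofReal ?_
        calc h / (5 * √s) * c ≤ h / (5 * √s) * (a + b) := by gcongr
          _ = _ := by ring
    _ = ENNReal.ofReal b * ENNReal.ofReal (1 / (5 * √s) * (0 - -h))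
        + ENNReal.ofReal a * ENNReal.ofReal (1 / (5 * √s) * (h - 0)) := by
        rw [ENNReal.ofReal_add, ENNReal.ofReal_mul hb, ENNReal.ofReal_mul ha]
        · rw [zero_sub, neg_neg]; positivity
        · rw [sub_zero]; positivity
    _ ≤ ENNReal.ofReal b * gaussianReal 0 s (Set.Icc (-h) 0)
        + ENNReal.ofReal a * gaussianReal 0 s (Set.Ioc 0 h) := by gcongr
    _ ≤ ∫⁻ ξ in Set.Icc (-h) 0, G ξ ∂gaussianReal 0 s
        + ∫⁻ ξ in Set.Ioc 0 h, G ξ ∂gaussianReal 0 s := by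
        rw [← setLIntegral_const, ← setLIntegral_const]
        exact add_le_add (setLIntegral_mono' measurableSet_Icc hneg)
          (setLIntegral_mono' measurableSet_Ioc hpos)
    _ = ∫⁻ ξ in Set.Icc (-h) 0 ∪ Set.Ioc 0 h, G ξ ∂gaussianReal 0 s :=
        (lintegral_union measurableSet_Ioc hdisj).symm
    _ ≤ _ := setLIntegral_le_lintegral _ _

/-- Each projection is Gaussian with standard deviation at least √s · β, hence rarely in [-h, h];
then a union bound. -/
theorem map_proj_compl_le {s : ℝ≥0} (hs : s ≠ 0) {β h : ℝ} (hβ : 0 < β) (p : ι)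
    {b : ι → EuclideanSpace ℝ (Fin d)} (hb : ∀ q, q ≠ p → β ≤ ‖b q‖)
    (hh : Fintype.card ι * (h / (√s * β)) ≤ 1 / 2) (h0 : 0 ≤ h) :
    1 / 2 ≤ (neuronLaw d s).map (fun w q => proj w (b q)) {y | ∀ q, q ≠ p → h < |y q|} := by
  have hs' : 0 < √(s : ℝ) := Real.sqrt_pos.mpr (by positivity)
  have hY : Measurable fun (w : Fin d → ℝ) q => proj w (b q) :=
    measurable_pi_lambda _ fun q => measurable_proj (b q)
  have hBm : MeasurableSet {y : ι → ℝ | ∀ q, q ≠ p → h < |y q|} := by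
    have : {y : ι → ℝ | ∀ q, q ≠ p → h < |y q|} = ⋂ q, {y | q ≠ p → h < |y q|} := by
      ext y; simp
    rw [this]
    refine MeasurableSet.iInter fun q => ?_
    by_cases hq : q = p
    · simp [hq]
    · simpa [hq] using measurableSet_lt measurable_const (measurable_pi_apply q).abs
  have hcompl : neuronLaw d s ((fun (w : Fin d → ℝ) q => proj w (b q)) ⁻¹'
      {y : ι → ℝ | ∀ q, q ≠ p → h < |y q|}ᶜ) ≤ 1 / 2 := by
    calc _ ≤ neuronLaw d s (⋃ q ∈ univ.erase p, {w | proj w (b q) ∈ Set.Icc (-h) h}) := by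
          refine measure_mono fun w hw => ?_
          simp only [Set.mem_preimage, Set.mem_compl_iff, Set.mem_ofPred_eq, not_forall,
            not_lt] at hw
          obtain ⟨q, hq, hw⟩ := hw
          simp only [Set.mem_iUnion]
          exact ⟨q, by simp [hq], abs_le.mp hw⟩
      _ ≤ ∑ q ∈ univ.erase p, neuronLaw d s {w | proj w (b q) ∈ Set.Icc (-h) h} :=
          measure_biUnion_finset_le _ _
      _ ≤ ∑ q ∈ univ.erase p, ENNReal.ofReal (h / (√s * β)) := by
          refine sum_le_sum fun q hq => ?_
          have hq' := hb q (mem_erase.mp hq).1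
          have hbpos : 0 < ‖b q‖ := hβ.trans_le hq'
          have h1 : neuronLaw d s {w | proj w (b q) ∈ Set.Icc (-h) h}
              = gaussianReal 0 (s * ‖b q‖₊ ^ 2) (Set.Icc (-h) h) := by
            rw [← map_proj, Measure.map_apply (measurable_proj _) measurableSet_Icc]
            rfl
          rw [h1]
          have hbne : ‖b q‖₊ ≠ 0 := by
            rw [← NNReal.coe_ne_zero]; exact hbpos.ne'
          refine (gaussianReal_Icc_le (mul_ne_zero hs (pow_ne_zero 2 hbne)) h).trans
            (ENNReal.ofReal_le_ofReal ?_)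
          push_cast
          rw [Real.sqrt_mul (by positivity), Real.sqrt_sq (norm_nonneg _)]
          gcongr
      _ ≤ Fintype.card ι * ENNReal.ofReal (h / (√s * β)) := by
          rw [sum_const, nsmul_eq_mul]
          gcongr
          exact_mod_cast (card_erase_le).trans_eq card_univ
      _ = ENNReal.ofReal (Fintype.card ι * (h / (√s * β))) := by
          rw [ENNReal.ofReal_mul (by positivity), ENNReal.ofReal_natCast]
      _ ≤ ENNReal.ofReal (1 / 2) := ENNReal.ofReal_le_ofReal hh
      _ = 1 / 2 := by
          rw [ENNReal.ofReal_div_of_pos (by norm_num)]; simp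
  rw [Measure.map_apply hY hBm]
  rw [Set.preimage_compl, prob_compl_eq_one_sub (hY hBm)] at hcompl
  have h2 := add_le_add_left hcompl (neuronLaw d s ((fun (w : Fin d → ℝ) q => proj w (b q)) ⁻¹'
      {y : ι → ℝ | ∀ q, q ≠ p → h < |y q|}))
  rw [tsub_add_cancel_of_le prob_le_one] at h2
  by_contra hcon
  rw [not_le] at hcon
  have h3 := h2.trans_lt (ENNReal.add_lt_add_left (by norm_num) hcon)
  rw [ENNReal.add_halves] at h3
  exact lt_irrefl _ h3

/-- A neuron whose activation boundary passes close to `x p` and away from the other points makes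
the features of `x p` stand out. -/
theorem ofReal_le_lintegral_norm_sq {s : ℝ≥0} (hs : s ≠ 0) {x : ι → EuclideanSpace ℝ (Fin d)}
    (hx : ∀ q, ‖x q‖ = 1) {β : ℝ} (hβ : 0 < β) (hβ1 : β ≤ 1) (p : ι)
    (hsep : ∀ q, q ≠ p → β ≤ ‖x q - (inner ℝ (x p) (x q) : ℝ) • x p‖) (u : ι → ℝ) :
    ENNReal.ofReal (β * u p ^ 2 / (40 * Fintype.card ι)) ≤
      ∫⁻ w, ENNReal.ofReal (‖∑ q, (u q * reluDeriv (proj w (x q))) • x q‖ ^ 2)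
        ∂neuronLaw d s := by
  have hs' : 0 < √(s : ℝ) := Real.sqrt_pos.mpr (by positivity)
  have hN : (1 : ℝ) ≤ Fintype.card ι := by
    exact_mod_cast Fintype.card_pos_iff.mpr ⟨p⟩
  set N : ℝ := (Fintype.card ι : ℝ) with hNdef
  -- The largest h for which the union bound over the N points leaves probability 1/2.
  set h : ℝ := √s * β / (2 * N) with hh
  have h0 : 0 < h := by positivity
  have hle : h ≤ √s := by
    rw [hh, div_le_iff₀ (by positivity)]
    nlinarith
  set c : ι → ℝ := fun q => inner ℝ (x p) (x q) with hc
  have hc1 : ∀ q, |c q| ≤ 1 := fun q => by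
    have := abs_real_inner_le_norm (x p) (x q)
    rwa [hx, hx, one_mul] at this
  -- Split each input into its parts along and orthogonal to x p. The coordinate ξ = ⟨w, x p⟩ is
  -- then independent of all projections onto the orthogonal parts.
  set b : ι → EuclideanSpace ℝ (Fin d) := fun q => x q - c q • x p with hb
  have horth : ∀ q, inner ℝ (x p) (b q) = 0 := fun q => by
    simp only [hb, inner_sub_right, inner_smul_right, real_inner_self_eq_norm_sq, hx, hc]
    ring
  set Y : (Fin d → ℝ) → ι → ℝ := fun w q => proj w (b q) with hY
  have hYm : Measurable Y := measurable_pi_lambda _ fun q => measurable_proj (b q)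
  have hξm := measurable_proj (x p)
  set t : ℝ × (ι → ℝ) → ι → ℝ := fun z q => if q = p then z.1 else c q * z.1 + z.2 q with ht
  have htm : ∀ q, Measurable fun z => t z q := by
    intro q
    simp only [ht]
    split_ifs
    · exact measurable_fst
    · exact (measurable_fst.const_mul _).add ((measurable_pi_apply q).comp measurable_snd)
  set G : ℝ × (ι → ℝ) → ENNReal :=
    fun z => ENNReal.ofReal (‖∑ q, (u q * reluDeriv (t z q)) • x q‖ ^ 2) with hG
  have hGm : Measurable G := by
    refine ENNReal.measurable_ofReal.comp (Measurable.pow_const (Measurable.norm ?_) 2)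
    exact Finset.measurable_sum _ fun q _ =>
      ((measurable_reluDeriv.comp (htm q)).const_mul _).smul_const _
  have hproj : ∀ w q, proj w (x q) = t (proj w (x p), Y w) q := by
    intro w q
    simp only [ht]
    split_ifs with hq
    · rw [hq]
    · simp only [hY, hb, proj, PiLp.sub_apply, PiLp.smul_apply, smul_eq_mul, mul_sub, mul_sum,
        sum_sub_distrib]
      rw [show ∑ k, c q * (w k * x p k) = ∑ k, w k * (c q * x p k) from
        sum_congr rfl fun k _ => by ring]
      ring
  have hmap : (neuronLaw d s).map (fun w => (proj w (x p), Y w))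
      = (gaussianReal 0 s).prod ((neuronLaw d s).map Y) := by
    rw [(indepFun_iff_map_prod_eq_prod_map_map hξm.aemeasurable hYm.aemeasurable).mp
      (indepFun_proj s (x p) b horth), map_proj]
    have : ‖x p‖₊ = 1 := by ext; simpa using hx p
    rw [this, one_pow, mul_one]
  have hprob : IsProbabilityMeasure ((neuronLaw d s).map Y) :=
    Measure.isProbabilityMeasure_map hYm.aemeasurable
  set B : Set (ι → ℝ) := {y | ∀ q, q ≠ p → h < |y q|} with hB
  have hBm : 1 / 2 ≤ (neuronLaw d s).map Y B := by
    refine map_proj_compl_le hs hβ p hsep ?_ h0.le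
    rw [hh]
    refine le_of_eq ?_
    field_simp
    exact hNdef.symm
  have hsec : ∀ y ∈ B, ENNReal.ofReal (h / (5 * √s) * (u p ^ 2 / 2))
      ≤ ∫⁻ ξ, G (ξ, y) ∂gaussianReal 0 s := by
    intro y hy
    set A := ∑ q ∈ univ.erase p, (u q * reluDeriv (y q)) • x q with hA
    -- For |ξ| ≤ h only the pattern at p depends on ξ: the sum is A for ξ ≤ 0 and u_p x_p + A for ξ
    -- > 0, and these cannot both be small.
    have hsplit : ∀ ξ ∈ Set.Icc (-h) h, ∑ q, (u q * reluDeriv (t (ξ, y) q)) • x q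
        = (u p * reluDeriv ξ) • x p + A := by
      intro ξ hξ
      rw [← Finset.add_sum_erase _ _ (mem_univ p), hA]
      congr 1
      · simp [ht]
      · refine sum_congr rfl fun q hq => ?_
        have hqp := (mem_erase.mp hq).1
        simp only [ht, if_neg hqp]
        rw [reluDeriv_eq_of_abs_lt]
        rw [add_sub_cancel_right, abs_mul]
        calc |c q| * |ξ| ≤ 1 * h :=
              mul_le_mul (hc1 q) (abs_le.mpr hξ) (abs_nonneg _) zero_le_one
          _ < |y q| := by rw [one_mul]; exact hy q hqp
    refine sum_insert_norm_sq_lintegral_le (a := ‖u p • x p + A‖ ^ 2) (b := ‖A‖ ^ 2) hs h0.le hle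
      (by positivity) (by positivity) ?_ ?_ ?_
    · have := half_sq_le_norm_add_sq_add_norm_sq (u p • x p) A
      rwa [norm_smul, hx, mul_one, Real.norm_eq_abs, sq_abs] at this
    · intro ξ hξ
      simp only [hG]
      rw [hsplit ξ ⟨by linarith [hξ.1], hξ.2⟩, reluDeriv, if_pos hξ.1, mul_one]
    · intro ξ hξ
      simp only [hG]
      rw [hsplit ξ ⟨hξ.1, by linarith [hξ.2]⟩, reluDeriv, if_neg (not_lt.mpr hξ.2), mul_zero,
        zero_smul, zero_add]
  calc ENNReal.ofReal (β * u p ^ 2 / (40 * N))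
      = ENNReal.ofReal (h / (5 * √s) * (u p ^ 2 / 2)) * (1 / 2) := by
        have : (1 / 2 : ENNReal) = ENNReal.ofReal (1 / 2) := by
          rw [ENNReal.ofReal_div_of_pos (by norm_num)]; simp
        rw [this, ← ENNReal.ofReal_mul (by positivity)]
        congr 1
        rw [hh]
        field_simp
        ring
    _ ≤ ENNReal.ofReal (h / (5 * √s) * (u p ^ 2 / 2)) * (neuronLaw d s).map Y B := by gcongr
    _ = ∫⁻ _y in B, ENNReal.ofReal (h / (5 * √s) * (u p ^ 2 / 2)) ∂(neuronLaw d s).map Y := by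
        rw [setLIntegral_const]
    _ ≤ ∫⁻ y in B, ∫⁻ ξ, G (ξ, y) ∂gaussianReal 0 s ∂(neuronLaw d s).map Y :=
        setLIntegral_mono hGm.lintegral_prod_left' hsec
    _ ≤ ∫⁻ y, ∫⁻ ξ, G (ξ, y) ∂gaussianReal 0 s ∂(neuronLaw d s).map Y :=
        setLIntegral_le_lintegral _ _
    _ = ∫⁻ z, G z ∂((gaussianReal 0 s).prod ((neuronLaw d s).map Y)) :=
        (lintegral_prod_symm _ hGm.aemeasurable).symm
    _ = ∫⁻ w, G (proj w (x p), Y w) ∂neuronLaw d s := by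
        rw [← hmap, lintegral_map hGm (hξm.prodMk hYm)]
    _ = _ := by
        refine lintegral_congr fun w => ?_
        have hpr : ∀ q, t (proj w (x p), Y w) q = proj w (x q) := fun q => (hproj w q).symm
        simp only [hG, hpr]

/-- The expected Gram matrix of the activation patterns is positive definite. -/
theorem le_sum_mul_integral_reluDeriv {s : ℝ≥0} (hs : s ≠ 0) {x : ι → EuclideanSpace ℝ (Fin d)}
    (hx : ∀ q, ‖x q‖ = 1) {β : ℝ} (hβ : 0 < β) (hβ1 : β ≤ 1)
    (hsep : ∀ p q, q ≠ p → β ≤ ‖x q - (inner ℝ (x p) (x q) : ℝ) • x p‖)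
    (u : EuclideanSpace ℝ ι) :
    β / (40 * (Fintype.card ι : ℝ) ^ 2) * ‖u‖ ^ 2 ≤
      ∑ p, ∑ q, u p * u q * (inner ℝ (x p) (x q) *
        ∫ w, reluDeriv (proj w (x p)) * reluDeriv (proj w (x q)) ∂neuronLaw d s) := by
  rcases isEmpty_or_nonempty ι with hι | hι
  · simp
  have hm : ∀ q, Measurable fun w => reluDeriv (proj w (x q)) := fun q =>
    measurable_reluDeriv.comp (measurable_proj (x q))
  have hint : ∀ p q, Integrable (fun w => reluDeriv (proj w (x p)) * reluDeriv (proj w (x q)))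
      (neuronLaw d s) := by
    intro p q
    refine Integrable.of_bound ((hm p).mul (hm q)).aestronglyMeasurable 1
      (Filter.Eventually.of_forall fun w => ?_)
    rw [Real.norm_eq_abs, abs_of_nonneg (mul_nonneg (reluDeriv_nonneg _) (reluDeriv_nonneg _))]
    exact mul_le_one₀ (reluDeriv_le_one _) (reluDeriv_nonneg _) (reluDeriv_le_one _)
  have hexp : ∀ w, ‖∑ q, (u q * reluDeriv (proj w (x q))) • x q‖ ^ 2
      = ∑ p, ∑ q, u p * u q * inner ℝ (x p) (x q)
        * (reluDeriv (proj w (x p)) * reluDeriv (proj w (x q))) := by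
    intro w
    rw [← real_inner_self_eq_norm_sq, sum_inner]
    refine sum_congr rfl fun p _ => ?_
    rw [inner_sum]
    refine sum_congr rfl fun q _ => ?_
    rw [real_inner_smul_left, real_inner_smul_right]
    ring
  have hint2 : ∀ p q, Integrable (fun w => u p * u q * inner ℝ (x p) (x q)
        * (reluDeriv (proj w (x p)) * reluDeriv (proj w (x q)))) (neuronLaw d s) :=
    fun p q => (hint p q).const_mul _
  have hI : ∫ w, ‖∑ q, (u q * reluDeriv (proj w (x q))) • x q‖ ^ 2 ∂neuronLaw d s
      = ∑ p, ∑ q, u p * u q * (inner ℝ (x p) (x q) *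
        ∫ w, reluDeriv (proj w (x p)) * reluDeriv (proj w (x q)) ∂neuronLaw d s) := by
    simp only [hexp]
    rw [integral_finsetSum _ fun p _ => integrable_finsetSum _ fun q _ => hint2 p q]
    refine sum_congr rfl fun p _ => ?_
    rw [integral_finsetSum _ fun q _ => hint2 p q]
    refine sum_congr rfl fun q _ => ?_
    rw [integral_const_mul]
    ring
  rw [← hI]
  -- The largest coordinate carries at least a fraction 1/N of ‖u‖².
  obtain ⟨p, -, hp⟩ := exists_max_image univ (fun q => u q ^ 2) univ_nonempty
  have hN : (0 : ℝ) < Fintype.card ι := by exact_mod_cast Fintype.card_pos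
  have h1 : ‖u‖ ^ 2 ≤ Fintype.card ι * u p ^ 2 := by
    rw [EuclideanSpace.norm_sq_eq]
    calc ∑ q, ‖u q‖ ^ 2 ≤ ∑ _q : ι, u p ^ 2 :=
          sum_le_sum fun q _ => by simpa using hp q (mem_univ q)
      _ = _ := by simp
  have hFint : Integrable (fun w => ‖∑ q, (u q * reluDeriv (proj w (x q))) • x q‖ ^ 2)
      (neuronLaw d s) := by
    simp only [hexp]
    exact integrable_finsetSum _ fun p _ => integrable_finsetSum _ fun q _ => hint2 p q
  have h2 := ofReal_le_lintegral_norm_sq hs hx hβ hβ1 p (hsep p) u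
  rw [← ofReal_integral_eq_lintegral_ofReal hFint
    (Filter.Eventually.of_forall fun w => by positivity),
    ENNReal.ofReal_le_ofReal_iff (integral_nonneg fun w => by positivity)] at h2
  refine le_trans ?_ h2
  calc β / (40 * (Fintype.card ι : ℝ) ^ 2) * ‖u‖ ^ 2
      ≤ β / (40 * (Fintype.card ι : ℝ) ^ 2) * (Fintype.card ι * u p ^ 2) := by gcongr
    _ = _ := by field_simp

end Gram

end LocalSGD
end

/-! ### Concentration of sums over neurons at initialization. -/

noncomputable section

namespace LocalSGD

open Finset

variable {m d : ℕ}

/-- The joint law of the two layers at initialization. -/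
abbrev initLaw (m d : ℕ) : Measure (Weights m d × (Fin m → ℝ)) :=
  (hiddenInit m d).prod (outputInit m d)

/-- The law of the weights attached to one hidden neuron. -/
abbrev unitLaw (m d : ℕ) : Measure ((Fin d → ℝ) × ℝ) :=
  (neuronLaw d (2 / (m : ℝ≥0))).prod (gaussianReal 0 (1 / (d : ℝ≥0)))

instance : IsProbabilityMeasure (hiddenInit m d) := by
  unfold hiddenInit; infer_instance

instance : IsProbabilityMeasure (outputInit m d) := by
  unfold outputInit; infer_instance

/-- Grouping both layers by neuron makes the pairs (W_r, v_r) i.i.d., so sums over neurons are sums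
of i.i.d. variables. -/
theorem initLaw_eq (S : Set (Weights m d × (Fin m → ℝ))) :
    initLaw m d S
      = Measure.pi (fun _ : Fin m => unitLaw m d) {ω | (fun r => (ω r).1, fun r => (ω r).2) ∈ S} := by
  have h := measurePreserving_arrowProdEquivProdArrow (Fin d → ℝ) ℝ (Fin m)
    (fun _ => neuronLaw d (2 / (m : ℝ≥0))) (fun _ => gaussianReal 0 (1 / (d : ℝ≥0)))
  exact (h.measure_preimage_equiv S).symm

/-- Chebyshev's inequality. -/
theorem initLaw_abs_sum_sub_ge_le {f : (Fin d → ℝ) × ℝ → ℝ} (hf : MemLp f 2 (unitLaw m d))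
    {C a : ℝ} (hC : ∫ z, f z ^ 2 ∂unitLaw m d ≤ C) (ha : 0 < a) :
    initLaw m d {ω | a ≤ |∑ r, f (ω.1 r, ω.2 r) - m * ∫ z, f z ∂unitLaw m d|}
      ≤ ENNReal.ofReal (m * C / a ^ 2) := by
  rw [initLaw_eq]
  have hmp := fun r => measurePreserving_eval (fun _ : Fin m => unitLaw m d) r
  have hL : ∀ r, MemLp (fun ω : Fin m → (Fin d → ℝ) × ℝ => f (ω r)) 2
      (Measure.pi fun _ : Fin m => unitLaw m d) := fun r => hf.comp_measurePreserving (hmp r)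
  have hX : MemLp (∑ r, fun ω : Fin m → (Fin d → ℝ) × ℝ => f (ω r)) 2
      (Measure.pi fun _ : Fin m => unitLaw m d) := memLp_finsetSum' _ fun r _ => hL r
  have hmean : ∫ ω, (∑ r, fun ω : Fin m → (Fin d → ℝ) × ℝ => f (ω r)) ω
      ∂(Measure.pi fun _ : Fin m => unitLaw m d) = m * ∫ z, f z ∂unitLaw m d := by
    simp only [Finset.sum_apply]
    rw [integral_finsetSum _ fun r _ => (hL r).integrable (by norm_num)]
    have : ∀ r : Fin m, ∫ ω : Fin m → (Fin d → ℝ) × ℝ, f (ω r)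
        ∂(Measure.pi fun _ : Fin m => unitLaw m d) = ∫ z, f z ∂unitLaw m d := fun r =>
      integral_comp_eval (μ := fun _ : Fin m => unitLaw m d) hf.aestronglyMeasurable
    simp [this]
  have h := meas_ge_le_variance_div_sq hX ha
  rw [hmean, variance_sum_pi (μ := fun _ : Fin m => unitLaw m d) (X := fun _ => f)
    fun _ => hf] at h
  simp only [Finset.sum_apply] at h
  refine h.trans (ENNReal.ofReal_le_ofReal ?_)
  refine div_le_div_of_nonneg_right ?_ (by positivity)
  rw [sum_const, card_univ, Fintype.card_fin, nsmul_eq_mul]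
  refine mul_le_mul_of_nonneg_left ?_ (Nat.cast_nonneg m)
  exact (variance_le_expectation_sq hf.aestronglyMeasurable).trans hC

theorem initLaw_sum_gt_le {f : (Fin d → ℝ) × ℝ → ℝ} (hf : Measurable f) (hf0 : ∀ z, 0 ≤ f z)
    {C θ : ℝ} (hC : ∫⁻ z, ENNReal.ofReal (f z) ∂unitLaw m d ≤ ENNReal.ofReal C) (hθ : 0 < θ) :
    initLaw m d {ω | θ < ∑ r, f (ω.1 r, ω.2 r)} ≤ ENNReal.ofReal (m * C / θ) := by
  rw [initLaw_eq]
  have hm : ∀ r, Measurable fun ω : Fin m → (Fin d → ℝ) × ℝ => ENNReal.ofReal (f (ω r)) :=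
    fun r => ENNReal.measurable_ofReal.comp (hf.comp (measurable_pi_apply r))
  have hθ' : ENNReal.ofReal θ ≠ 0 := by simpa using hθ
  calc _ ≤ Measure.pi (fun _ : Fin m => unitLaw m d)
        {ω | ENNReal.ofReal θ ≤ ∑ r, ENNReal.ofReal (f (ω r))} := by
        refine measure_mono fun ω hω => ?_
        simp only [Set.mem_ofPred_eq] at hω ⊢
        rw [← ENNReal.ofReal_sum_of_nonneg fun r _ => hf0 _]
        exact ENNReal.ofReal_le_ofReal hω.le
    _ ≤ (∫⁻ ω, ∑ r, ENNReal.ofReal (f (ω r)) ∂Measure.pi fun _ : Fin m => unitLaw m d)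
        / ENNReal.ofReal θ :=
        meas_ge_le_lintegral_div (Finset.measurable_sum _ fun r _ => hm r).aemeasurable hθ'
          ENNReal.ofReal_ne_top
    _ ≤ ENNReal.ofReal (m * C) / ENNReal.ofReal θ := by
        gcongr
        rw [lintegral_finsetSum _ fun r _ => hm r]
        have : ∀ r : Fin m, ∫⁻ ω : Fin m → (Fin d → ℝ) × ℝ, ENNReal.ofReal (f (ω r))
            ∂(Measure.pi fun _ : Fin m => unitLaw m d)
            = ∫⁻ z, ENNReal.ofReal (f z) ∂unitLaw m d := fun r =>
          (measurePreserving_eval (fun _ : Fin m => unitLaw m d) r).lintegral_comp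
            (ENNReal.measurable_ofReal.comp hf)
        simp only [this]
        rw [sum_const, card_univ, Fintype.card_fin, nsmul_eq_mul,
          ENNReal.ofReal_mul (Nat.cast_nonneg m), ENNReal.ofReal_natCast]
        gcongr
    _ = ENNReal.ofReal (m * C / θ) := (ENNReal.ofReal_div_of_pos hθ).symm

theorem integral_sq_unitLaw_snd (d : ℕ) :
    ∫ z, z ^ 2 ∂gaussianReal 0 (1 / (d : ℝ≥0)) = 1 / d := by
  rw [integral_sq_gaussianReal]; simp

theorem integral_pow_four_unitLaw_snd_le (d : ℕ) :
    ∫ z, z ^ 4 ∂gaussianReal 0 (1 / (d : ℝ≥0)) ≤ 40 / (d : ℝ) ^ 2 := by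
  refine (integral_pow_four_gaussianReal_le _).trans_eq ?_
  push_cast
  rw [div_pow, one_pow]
  ring

/-- Concentration of a sum over the neurons weighted by the squares of the output weights. -/
theorem initLaw_abs_sum_sq_mul_sub_ge_le {k : (Fin d → ℝ) → ℝ} (hk : Measurable k)
    (hk1 : ∀ w, |k w| ≤ 1) {a : ℝ} (ha : 0 < a) :
    initLaw m d {ω | a ≤ |∑ r, ω.2 r ^ 2 * k (ω.1 r)
        - m / d * ∫ w, k w ∂neuronLaw d (2 / (m : ℝ≥0))|}
      ≤ ENNReal.ofReal (m * (40 / (d : ℝ) ^ 2) / a ^ 2) := by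
  set f : (Fin d → ℝ) × ℝ → ℝ := fun z => z.2 ^ 2 * k z.1 with hf
  have hfm : Measurable f := (measurable_snd.pow_const 2).mul (hk.comp measurable_fst)
  have h4 : Integrable (fun z : (Fin d → ℝ) × ℝ => z.2 ^ 4) (unitLaw m d) :=
    (integrable_pow_gaussianReal _ 4).comp_snd _
  have hle : ∀ z, f z ^ 2 ≤ z.2 ^ 4 := by
    intro z
    simp only [hf]
    have h1 : k z.1 ^ 2 ≤ 1 := (sq_le_one_iff_abs_le_one _).mpr (hk1 z.1)
    nlinarith [mul_le_mul_of_nonneg_left h1 (by positivity : 0 ≤ z.2 ^ 4)]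
  have hsq : Integrable (fun z => f z ^ 2) (unitLaw m d) :=
    h4.mono' (hfm.pow_const 2).aestronglyMeasurable
      (Filter.Eventually.of_forall fun z => by
        rw [Real.norm_of_nonneg (sq_nonneg _)]; exact hle z)
  have hL : MemLp f 2 (unitLaw m d) := (memLp_two_iff_integrable_sq hfm.aestronglyMeasurable).mpr hsq
  have hC : ∫ z, f z ^ 2 ∂unitLaw m d ≤ 40 / (d : ℝ) ^ 2 := by
    refine (integral_mono hsq h4 hle).trans ?_
    have := integral_prod_mul (μ := neuronLaw d (2 / (m : ℝ≥0)))
      (ν := gaussianReal 0 (1 / (d : ℝ≥0))) (fun _ => (1 : ℝ)) (fun z => z ^ 4)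
    simp only [one_mul] at this
    rw [this]
    simpa using integral_pow_four_unitLaw_snd_le d
  have hmean : ∫ z, f z ∂unitLaw m d = 1 / d * ∫ w, k w ∂neuronLaw d (2 / (m : ℝ≥0)) := by
    have := integral_prod_mul (μ := neuronLaw d (2 / (m : ℝ≥0)))
      (ν := gaussianReal 0 (1 / (d : ℝ≥0))) k (fun z => z ^ 2)
    rw [integral_sq_unitLaw_snd] at this
    rw [mul_comm, ← this]
    exact integral_congr_ae (Filter.Eventually.of_forall fun z => mul_comm _ _)
  have h := initLaw_abs_sum_sub_ge_le hL hC ha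
  rw [hmean, ← mul_assoc, mul_one_div] at h
  exact h

theorem initLaw_sum_sq_gt_le (hm : 0 < m) (hd : 0 < d) :
    initLaw m d {ω | 2 * (m / d : ℝ) < ∑ r, ω.2 r ^ 2} ≤ ENNReal.ofReal (40 / m) := by
  have hm' : (0 : ℝ) < m := by positivity
  have hd' : (0 : ℝ) < d := by positivity
  have h := initLaw_abs_sum_sq_mul_sub_ge_le (m := m) (d := d) (k := fun _ => 1)
    measurable_const (by simp) (a := (m / d : ℝ)) (by positivity)
  refine (measure_mono fun ω hω => ?_).trans (h.trans_eq ?_)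
  · simp only [Set.mem_ofPred_eq, mul_one, integral_const, probReal_univ, smul_eq_mul] at hω ⊢
    refine le_trans ?_ (le_abs_self _)
    linarith
  · congr 1
    field_simp

/-- The summands are centred because v is, and each has variance at most (2/m)(1/d). -/
theorem initLaw_abs_network_ge_le (hm : 0 < m) {x : EuclideanSpace ℝ (Fin d)}
    (hx : ‖x‖ = 1) {a : ℝ} (ha : 0 < a) :
    initLaw m d {ω | a ≤ |network ω.2 ω.1 x|} ≤ ENNReal.ofReal (2 / (d * a ^ 2)) := by
  have hm' : (0 : ℝ) < m := by positivity
  set f : (Fin d → ℝ) × ℝ → ℝ := fun z => relu (proj z.1 x) * z.2 with hf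
  have hrm : Measurable fun w => relu (proj w x) := measurable_relu.comp (measurable_proj x)
  have hfm : Measurable f := (hrm.comp measurable_fst).mul measurable_snd
  have hn1 : ‖x‖₊ = 1 := by ext; simpa using hx
  have hmapx : (neuronLaw d (2 / (m : ℝ≥0))).map (fun w => proj w x)
      = gaussianReal 0 (2 / (m : ℝ≥0)) := by
    rw [map_proj, hn1, one_pow, mul_one]
  have hpsq : Integrable (fun w => proj w x ^ 2) (neuronLaw d (2 / (m : ℝ≥0))) := by
    have := integrable_pow_gaussianReal (2 / (m : ℝ≥0)) 2
    rw [← hmapx] at this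
    exact this.comp_measurable (measurable_proj x)
  have hpint : ∫ w, proj w x ^ 2 ∂neuronLaw d (2 / (m : ℝ≥0)) = 2 / m := by
    have := integral_sq_gaussianReal (2 / (m : ℝ≥0))
    rw [← hmapx, integral_map (measurable_proj x).aemeasurable (by fun_prop)] at this
    rw [this]; simp
  have hrle : ∀ w, relu (proj w x) ^ 2 ≤ proj w x ^ 2 := by
    intro w
    have := abs_relu_sub_le (proj w x) 0
    simp only [relu, max_self, sub_zero] at this
    exact sq_le_sq.mpr this
  have hrsq : Integrable (fun w => relu (proj w x) ^ 2) (neuronLaw d (2 / (m : ℝ≥0))) :=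
    hpsq.mono' (hrm.pow_const 2).aestronglyMeasurable
      (Filter.Eventually.of_forall fun w => by
        rw [Real.norm_of_nonneg (sq_nonneg _)]; exact hrle w)
  have hfsq : ∀ z, f z ^ 2 = relu (proj z.1 x) ^ 2 * z.2 ^ 2 := fun z => mul_pow _ _ _
  have hsq : Integrable (fun z => f z ^ 2) (unitLaw m d) := by
    simp only [hfsq]
    exact hrsq.mul_prod (integrable_pow_gaussianReal _ 2)
  have hL : MemLp f 2 (unitLaw m d) :=
    (memLp_two_iff_integrable_sq hfm.aestronglyMeasurable).mpr hsq
  have hC : ∫ z, f z ^ 2 ∂unitLaw m d ≤ 2 / m * (1 / d) := by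
    simp only [hfsq]
    rw [integral_prod_mul (fun w => relu (proj w x) ^ 2) (fun z : ℝ => z ^ 2),
      integral_sq_unitLaw_snd]
    refine mul_le_mul_of_nonneg_right ?_ (by positivity)
    rw [← hpint]
    exact integral_mono hrsq hpsq hrle
  have hmean : ∫ z, f z ∂unitLaw m d = 0 := by
    rw [integral_prod_mul (fun w => relu (proj w x)) (fun z : ℝ => z)]
    simp
  have h := initLaw_abs_sum_sub_ge_le hL hC ha
  rw [hmean, mul_zero] at h
  refine (measure_mono fun ω hω => ?_).trans (h.trans_eq ?_)
  · simp only [Set.mem_ofPred_eq, sub_zero] at hω ⊢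
    refine hω.trans_eq ?_
    congr 1
    exact sum_congr rfl fun r _ => mul_comm _ _
  · congr 1
    field_simp

theorem integrable_abs_pow_three_gaussianReal (v : ℝ≥0) :
    Integrable (fun z => |z| ^ 3) (gaussianReal 0 v) := by
  have := (integrable_pow_gaussianReal v 3).abs
  simpa only [abs_pow] using this

/-- AM–GM between z² and z⁴ at the scale |z| ≈ 1/√d. -/
theorem integral_abs_pow_three_le (hd : 0 < d) :
    ∫ z, |z| ^ 3 ∂gaussianReal 0 (1 / (d : ℝ≥0)) ≤ 21 / (d * √d) := by
  have hd' : (0 : ℝ) < d := by positivity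
  have hs : 0 < √(d : ℝ) := Real.sqrt_pos.mpr hd'
  have h2 := integrable_pow_gaussianReal (1 / (d : ℝ≥0)) 2
  have h4 := integrable_pow_gaussianReal (1 / (d : ℝ≥0)) 4
  have hpt : ∀ z : ℝ, |z| ^ 3 ≤ 1 / (2 * √d) * z ^ 2 + √d / 2 * z ^ 4 := by
    intro z
    have h1 : z ^ 2 = |z| ^ 2 := (sq_abs z).symm
    have h3 : z ^ 4 = |z| ^ 4 := ((by norm_num : Even 4).pow_abs z).symm
    rw [h1, h3]
    set t := |z|
    have : 1 / (2 * √d) * t ^ 2 + √d / 2 * t ^ 4 - t ^ 3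
        = t ^ 2 / (2 * √d) * (1 - √d * t) ^ 2 := by
      field_simp; ring
    have h5 : 0 ≤ t ^ 2 / (2 * √d) * (1 - √d * t) ^ 2 := by positivity
    linarith
  calc ∫ z, |z| ^ 3 ∂gaussianReal 0 (1 / (d : ℝ≥0))
      ≤ ∫ z, (1 / (2 * √d) * z ^ 2 + √d / 2 * z ^ 4) ∂gaussianReal 0 (1 / (d : ℝ≥0)) :=
        integral_mono (integrable_abs_pow_three_gaussianReal _)
          ((h2.const_mul _).add (h4.const_mul _)) hpt
    _ = 1 / (2 * √d) * (1 / d) + √d / 2 * ∫ z, z ^ 4 ∂gaussianReal 0 (1 / (d : ℝ≥0)) := by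
        rw [integral_add (h2.const_mul _) (h4.const_mul _), integral_const_mul,
          integral_const_mul, integral_sq_unitLaw_snd]
    _ ≤ 1 / (2 * √d) * (1 / d) + √d / 2 * (40 / (d : ℝ) ^ 2) := by
        gcongr
        exact integral_pow_four_unitLaw_snd_le d
    _ = (41 / 2) / (d * √d) := by
        have hsq := Real.sq_sqrt hd'.le
        field_simp
        rw [hsq]
        ring
    _ ≤ 21 / (d * √d) := by gcongr; norm_num

/-- Few neurons are close to an activation boundary. -/
theorem initLaw_sum_flip_gt_le (hm : 0 < m) (hd : 0 < d) {x : EuclideanSpace ℝ (Fin d)}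
    (hx : ‖x‖ = 1) {ρ θ : ℝ} (hρ : 0 ≤ ρ) (hθ : 0 < θ) :
    initLaw m d {ω | θ < ∑ r, (if |preact ω.1 x r| ≤ |ω.2 r| * ρ then ω.2 r ^ 2 else 0)}
      ≤ ENNReal.ofReal (m * (21 / (d * √d) * (ρ * √m)) / θ) := by
  have hm' : (0 : ℝ) < m := by positivity
  set f : (Fin d → ℝ) × ℝ → ℝ := fun z => if |proj z.1 x| ≤ |z.2| * ρ then z.2 ^ 2 else 0 with hf
  have hpm : Measurable fun z : (Fin d → ℝ) × ℝ => |proj z.1 x| :=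
    ((measurable_proj x).comp measurable_fst).abs
  have hfm : Measurable f :=
    Measurable.ite (measurableSet_le hpm (measurable_snd.abs.mul_const ρ))
      (measurable_snd.pow_const 2) measurable_const
  have hn1 : ‖x‖₊ = 1 := by ext; simpa using hx
  have hv : (2 / (m : ℝ≥0)) ≠ 0 := by positivity
  -- For a fixed output weight the neuron is near its boundary with probability at most |v|ρ√m; the
  -- weight v² makes this a third moment. Markov's inequality finishes.
  have hsec : ∀ v : ℝ, ∫⁻ w, ENNReal.ofReal (f (w, v)) ∂neuronLaw d (2 / (m : ℝ≥0))
      ≤ ENNReal.ofReal (ρ * √m * |v| ^ 3) := by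
    intro v
    have h1 : ∀ w, ENNReal.ofReal (f (w, v))
        = Set.indicator {w | proj w x ∈ Set.Icc (-(|v| * ρ)) (|v| * ρ)}
          (fun _ => ENNReal.ofReal (v ^ 2)) w := by
      intro w
      simp only [hf, Set.indicator, Set.mem_ofPred_eq, Set.mem_Icc, ← abs_le]
      split_ifs <;> simp
    simp only [h1]
    have hS : MeasurableSet {w : Fin d → ℝ | proj w x ∈ Set.Icc (-(|v| * ρ)) (|v| * ρ)} :=
      (measurable_proj x) measurableSet_Icc
    rw [lintegral_indicator_const hS]
    have h2 : neuronLaw d (2 / (m : ℝ≥0)) {w | proj w x ∈ Set.Icc (-(|v| * ρ)) (|v| * ρ)}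
        = gaussianReal 0 (2 / (m : ℝ≥0)) (Set.Icc (-(|v| * ρ)) (|v| * ρ)) := by
      have h3 := map_proj (d := d) (2 / (m : ℝ≥0)) x
      rw [hn1, one_pow, mul_one] at h3
      rw [← h3, Measure.map_apply (measurable_proj _) measurableSet_Icc]
      rfl
    rw [h2]
    calc ENNReal.ofReal (v ^ 2) * gaussianReal 0 (2 / (m : ℝ≥0)) (Set.Icc (-(|v| * ρ)) (|v| * ρ))
        ≤ ENNReal.ofReal (v ^ 2) * ENNReal.ofReal (|v| * ρ / √((2 / (m : ℝ≥0) : ℝ≥0) : ℝ)) := by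
          gcongr
          exact gaussianReal_Icc_le hv _
      _ ≤ ENNReal.ofReal (v ^ 2) * ENNReal.ofReal (|v| * ρ * √m) := by
          gcongr
          push_cast
          rw [div_eq_mul_inv, ← Real.sqrt_inv]
          refine mul_le_mul_of_nonneg_left (Real.sqrt_le_sqrt ?_) (by positivity)
          rw [inv_div]
          linarith
      _ = ENNReal.ofReal (ρ * √m * |v| ^ 3) := by
          rw [← ENNReal.ofReal_mul (sq_nonneg v), ← sq_abs v]
          congr 1
          ring
  have hC : ∫⁻ z, ENNReal.ofReal (f z) ∂unitLaw m d
      ≤ ENNReal.ofReal (21 / (d * √d) * (ρ * √m)) := by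
    have hFm : Measurable fun z => ENNReal.ofReal (f z) := ENNReal.measurable_ofReal.comp hfm
    rw [unitLaw, lintegral_prod_symm _ hFm.aemeasurable]
    refine (lintegral_mono hsec).trans ?_
    rw [← ofReal_integral_eq_lintegral_ofReal
      ((integrable_abs_pow_three_gaussianReal _).const_mul _)
      (Filter.Eventually.of_forall fun z => by positivity), integral_const_mul, mul_comm]
    refine ENNReal.ofReal_le_ofReal ?_
    exact mul_le_mul_of_nonneg_right (integral_abs_pow_three_le hd) (by positivity)
  refine initLaw_sum_gt_le hfm (fun z => ?_) hC hθ
  simp only [hf]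
  split_ifs <;> positivity

end LocalSGD
end

/-! ### The empirical Gram matrix. -/

noncomputable section

namespace LocalSGD

open Finset

variable {K n m d : ℕ}

/-- Separated unit vectors are quantitatively not collinear. -/
theorem le_norm_sub_inner_smul {x z : EuclideanSpace ℝ (Fin d)} (hx : ‖x‖ = 1) (hz : ‖z‖ = 1)
    {φ κ : ℝ} (hφ : 0 < φ) (hκ : 0 < κ) (hκ1 : κ ≤ 1) (h1 : φ ≤ ‖x - z‖) (h2 : κ * φ ≤ ‖x + z‖) :
    κ * φ / 2 ≤ ‖z - (inner ℝ x z : ℝ) • x‖ := by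
  set c : ℝ := inner ℝ x z with hc
  have hsub : ‖x - z‖ ^ 2 = 2 - 2 * c := by
    rw [norm_sub_sq_real, hx, hz]; ring
  have hadd : ‖x + z‖ ^ 2 = 2 + 2 * c := by
    rw [norm_add_sq_real, hx, hz]; ring
  have hperp : ‖z - c • x‖ ^ 2 = 1 - c ^ 2 := by
    rw [norm_sub_sq_real, norm_smul, inner_smul_right, real_inner_comm, ← hc, hx, hz,
      Real.norm_eq_abs, mul_one, sq_abs]
    ring
  have hκφ : κ * φ ≤ φ := mul_le_of_le_one_left hφ.le hκ1
  have h3 : (κ * φ) ^ 2 ≤ 2 - 2 * c := by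
    rw [← hsub]; exact pow_le_pow_left₀ (by positivity) (hκφ.trans h1) 2
  have h4 : (κ * φ) ^ 2 ≤ 2 + 2 * c := by
    rw [← hadd]; exact pow_le_pow_left₀ (by positivity) h2 2
  refine le_of_sq_le_sq ?_ (norm_nonneg _)
  rw [hperp]
  rcases le_total 0 c with h | h <;> nlinarith [sq_nonneg (κ * φ)]

theorem norm_featureMap_sq (x : Fin K → Fin n → EuclideanSpace ℝ (Fin d)) (v : Fin m → ℝ)
    (W : Weights m d) (c : EuclideanSpace ℝ (Fin K × Fin n)) :
    ‖featureMap x v W c‖ ^ 2 = ∑ p, ∑ q, c p * c q * ∑ r, v r ^ 2 *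
      (inner ℝ (x p.1 p.2) (x q.1 q.2)
        * (reluDeriv (proj (W r) (x p.1 p.2)) * reluDeriv (proj (W r) (x q.1 q.2)))) := by
  rw [← real_inner_self_eq_norm_sq, featureMap_apply, sum_inner]
  refine sum_congr rfl fun p _ => ?_
  rw [inner_sum]
  refine sum_congr rfl fun q _ => ?_
  rw [real_inner_smul_left, inner_smul_right, inner_flat_feature, ← mul_assoc]
  congr 1
  refine sum_congr rfl fun r _ => ?_
  rw [preact_feature, preact_eq_proj, preact_eq_proj, real_inner_comm]
  ring

theorem abs_sum_sum_mul_le {ι : Type*} [Fintype ι] (c : EuclideanSpace ℝ ι) {g : ι → ι → ℝ} {a : ℝ}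
    (hg : ∀ p q, |g p q| ≤ a) :
    |∑ p, ∑ q, c p * c q * g p q| ≤ a * (Fintype.card ι * ‖c‖ ^ 2) := by
  have hsum : (∑ p, |c p|) ^ 2 ≤ Fintype.card ι * ‖c‖ ^ 2 := by
    rw [EuclideanSpace.norm_sq_eq]
    simpa using sq_sum_le_card_mul_sum_sq (s := univ) (f := fun p => |c p|)
  by_cases hι : Nonempty ι
  · have ha : 0 ≤ a := (abs_nonneg _).trans (hg hι.some hι.some)
    calc |∑ p, ∑ q, c p * c q * g p q| ≤ ∑ p, ∑ q, |c p| * |c q| * a := by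
          refine (abs_sum_le_sum_abs _ _).trans (sum_le_sum fun p _ => ?_)
          refine (abs_sum_le_sum_abs _ _).trans (sum_le_sum fun q _ => ?_)
          rw [abs_mul, abs_mul]
          exact mul_le_mul_of_nonneg_left (hg p q) (by positivity)
      _ = a * (∑ p, |c p|) ^ 2 := by
          rw [sq, sum_mul_sum, mul_sum]
          refine sum_congr rfl fun p _ => ?_
          rw [mul_sum]
          exact sum_congr rfl fun q _ => by ring
      _ ≤ _ := by gcongr
  · rw [not_nonempty_iff] at hι
    simp

/-- The Gram matrix of the features at initialization is positive definite with high
probability. -/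
theorem initLaw_norm_featureMap_sq_lt_le (hm : 0 < m) (hd : 0 < d) (hK : 0 < K) (hn : 0 < n)
    {x : Fin K → Fin n → EuclideanSpace ℝ (Fin d)} (hx : ∀ i j, ‖x i j‖ = 1) {β : ℝ} (hβ : 0 < β)
    (hβ1 : β ≤ 1)
    (hsep : ∀ p q : Fin K × Fin n, q ≠ p → β ≤
      ‖x q.1 q.2 - (inner ℝ (x p.1 p.2) (x q.1 q.2) : ℝ) • x p.1 p.2‖) :
    initLaw m d {ω | ∃ c, ‖featureMap x ω.2 ω.1 c‖ ^ 2
        < (m / d : ℝ) * β / (80 * (K * n : ℝ) ^ 2) * ‖c‖ ^ 2}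
      ≤ ENNReal.ofReal (256000 * (K * n : ℝ) ^ 8 / (m * β ^ 2)) := by
  have hm' : (0 : ℝ) < m := by positivity
  have hd' : (0 : ℝ) < d := by positivity
  have hK' : (0 : ℝ) < K := by positivity
  have hn' : (0 : ℝ) < n := by positivity
  set N : ℝ := K * n with hN
  have hN0 : 0 < N := by positivity
  -- With this entrywise accuracy the quadratic form errs by at most aN‖c‖², half of its expected
  -- lower bound.
  set a : ℝ := (m / d : ℝ) * β / (80 * N ^ 3) with ha
  have ha0 : 0 < a := by positivity
  have hcard : ((Fintype.card (Fin K × Fin n) : ℕ) : ℝ) = N := by simp [hN]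
  let k : (Fin K × Fin n) × (Fin K × Fin n) → (Fin d → ℝ) → ℝ := fun z w =>
    inner ℝ (x z.1.1 z.1.2) (x z.2.1 z.2.2)
      * (reluDeriv (proj w (x z.1.1 z.1.2)) * reluDeriv (proj w (x z.2.1 z.2.2)))
  have hkm : ∀ z, Measurable (k z) := fun z =>
    ((measurable_reluDeriv.comp (measurable_proj _)).mul
      (measurable_reluDeriv.comp (measurable_proj _))).const_mul _
  have hk1 : ∀ z w, |k z w| ≤ 1 := by
    intro z w
    have h1 := abs_real_inner_le_norm (x z.1.1 z.1.2) (x z.2.1 z.2.2)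
    rw [hx, hx, mul_one] at h1
    simp only [k, abs_mul, abs_of_nonneg (reluDeriv_nonneg _)]
    exact mul_le_one₀ h1 (mul_nonneg (reluDeriv_nonneg _) (reluDeriv_nonneg _))
      (mul_le_one₀ (reluDeriv_le_one _) (reluDeriv_nonneg _) (reluDeriv_le_one _))
  let E : (Fin K × Fin n) × (Fin K × Fin n) → Set (Weights m d × (Fin m → ℝ)) := fun z =>
    {ω | a ≤ |∑ r, ω.2 r ^ 2 * k z (ω.1 r)
        - m / d * ∫ w, k z w ∂neuronLaw d (2 / (m : ℝ≥0))|}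
  have hsub : {ω : Weights m d × (Fin m → ℝ) | ∃ c, ‖featureMap x ω.2 ω.1 c‖ ^ 2
        < (m / d : ℝ) * β / (80 * N ^ 2) * ‖c‖ ^ 2} ⊆ ⋃ z, E z := by
    rintro ω ⟨c, hc⟩
    by_contra hω
    simp only [Set.mem_iUnion, not_exists, E, Set.mem_ofPred_eq, not_le] at hω
    have hG := abs_sum_sum_mul_le c (g := fun p q => ∑ r, ω.2 r ^ 2 * k (p, q) (ω.1 r)
        - m / d * ∫ w, k (p, q) w ∂neuronLaw d (2 / (m : ℝ≥0))) (a := a)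
      fun p q => (hω (p, q)).le
    have hE := le_sum_mul_integral_reluDeriv (s := 2 / (m : ℝ≥0)) (by positivity)
      (x := fun p : Fin K × Fin n => x p.1 p.2) (fun q => hx _ _) hβ hβ1 hsep c
    rw [hcard] at hE hG
    have hsplit : ∑ p, ∑ q, c p * c q * (∑ r, ω.2 r ^ 2 * k (p, q) (ω.1 r)
        - m / d * ∫ w, k (p, q) w ∂neuronLaw d (2 / (m : ℝ≥0)))
        = ‖featureMap x ω.2 ω.1 c‖ ^ 2 - m / d * ∑ p, ∑ q, c p * c q *
          (inner ℝ (x p.1 p.2) (x q.1 q.2) * ∫ w, reluDeriv (proj w (x p.1 p.2))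
            * reluDeriv (proj w (x q.1 q.2)) ∂neuronLaw d (2 / (m : ℝ≥0))) := by
      rw [norm_featureMap_sq, mul_sum, ← sum_sub_distrib]
      refine sum_congr rfl fun p _ => ?_
      rw [mul_sum, ← sum_sub_distrib]
      refine sum_congr rfl fun q _ => ?_
      simp only [k, integral_const_mul]
      ring
    rw [hsplit] at hG
    have h1 := (abs_le.mp hG).1
    have h2 := mul_le_mul_of_nonneg_left hE (by positivity : (0 : ℝ) ≤ m / d)
    have h3 : a * (N * ‖c‖ ^ 2) = (m / d : ℝ) * β / (80 * N ^ 2) * ‖c‖ ^ 2 := by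
      rw [ha]; field_simp
    have h4 : (m / d : ℝ) * (β / (40 * N ^ 2) * ‖c‖ ^ 2)
        = 2 * ((m / d : ℝ) * β / (80 * N ^ 2) * ‖c‖ ^ 2) := by
      field_simp; ring
    linarith
  calc _ ≤ initLaw m d (⋃ z, E z) := measure_mono hsub
    _ ≤ ∑ z, initLaw m d (E z) := measure_iUnion_fintype_le _ _
    _ ≤ ∑ _z : (Fin K × Fin n) × (Fin K × Fin n),
          ENNReal.ofReal (m * (40 / (d : ℝ) ^ 2) / a ^ 2) :=
        sum_le_sum fun z _ => initLaw_abs_sum_sq_mul_sub_ge_le (hkm z) (hk1 z) ha0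
    _ = ENNReal.ofReal (256000 * N ^ 8 / (m * β ^ 2)) := by
        rw [← ENNReal.ofReal_sum_of_nonneg fun _ _ => by positivity]
        congr 1
        rw [sum_const, card_univ, Fintype.card_prod, nsmul_eq_mul, Nat.cast_mul, hcard, ha]
        field_simp
        ring

end LocalSGD
end

/-! ### Good initializations and the joint law with the samples. -/

noncomputable section

namespace LocalSGD

open Finset

variable {K n m d : ℕ}

/-- The properties of the initialization that the convergence of Local SGD depends on. -/
structure IsGoodInit (x : Fin K → Fin n → EuclideanSpace ℝ (Fin d)) (V R ρ θ lam : ℝ)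
    (v : Fin m → ℝ) (W : Weights m d) : Prop where
  sum_sq_le : ∑ r, v r ^ 2 ≤ V
  abs_network_le : ∀ i j, |network v W (x i j)| ≤ R
  flip_le : ∀ i j, ∑ r, (if |preact W (x i j) r| ≤ |v r| * ρ then v r ^ 2 else 0) ≤ θ
  le_norm_featureMap_sq : ∀ c, lam * ‖c‖ ^ 2 ≤ ‖featureMap x v W c‖ ^ 2

theorem initLaw_not_isGoodInit_le (hm : 0 < m) (hd : 0 < d) (hK : 0 < K) (hn : 0 < n)
    {x : Fin K → Fin n → EuclideanSpace ℝ (Fin d)} (hx : ∀ i j, ‖x i j‖ = 1) {β : ℝ} (hβ : 0 < β)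
    (hβ1 : β ≤ 1)
    (hsep : ∀ p q : Fin K × Fin n, q ≠ p → β ≤
      ‖x q.1 q.2 - (inner ℝ (x p.1 p.2) (x q.1 q.2) : ℝ) • x p.1 p.2‖)
    {R ρ θ : ℝ} (hR : 0 < R) (hρ : 0 ≤ ρ) (hθ : 0 < θ) :
    initLaw m d {ω | ¬ IsGoodInit x (2 * (m / d)) R ρ θ
        ((m / d : ℝ) * β / (80 * (K * n : ℝ) ^ 2)) ω.2 ω.1}
      ≤ ENNReal.ofReal (40 / m + K * n * (2 / (d * R ^ 2))
        + K * n * (m * (21 / (d * √d) * (ρ * √m)) / θ)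
        + 256000 * (K * n : ℝ) ^ 8 / (m * β ^ 2)) := by
  have hunion : ∀ (E : Fin K × Fin n → Set (Weights m d × (Fin m → ℝ))) (b : ℝ), 0 ≤ b →
      (∀ p, initLaw m d (E p) ≤ ENNReal.ofReal b) →
      initLaw m d (⋃ p, E p) ≤ ENNReal.ofReal (K * n * b) := by
    intro E b hb hE
    calc _ ≤ ∑ p, initLaw m d (E p) := measure_iUnion_fintype_le _ _
      _ ≤ ∑ _p : Fin K × Fin n, ENNReal.ofReal b := sum_le_sum fun p _ => hE p
      _ = _ := by
        rw [← ENNReal.ofReal_sum_of_nonneg fun _ _ => hb]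
        simp
  have h1 := initLaw_sum_sq_gt_le hm hd
  have h2 := hunion _ _ (by positivity) fun p =>
    initLaw_abs_network_ge_le hm (hx p.1 p.2) hR
  have h3 := hunion _ _ (by positivity) fun p =>
    initLaw_sum_flip_gt_le hm hd (hx p.1 p.2) hρ hθ
  have h4 := initLaw_norm_featureMap_sq_lt_le hm hd hK hn hx hβ hβ1 hsep
  rw [ENNReal.ofReal_add (by positivity) (by positivity),
    ENNReal.ofReal_add (by positivity) (by positivity),
    ENNReal.ofReal_add (by positivity) (by positivity)]
  refine le_trans (measure_mono ?_) ((measure_union_le _ _).trans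
    (add_le_add ((measure_union_le _ _).trans
      (add_le_add ((measure_union_le _ _).trans (add_le_add h1 h2)) h3)) h4))
  intro ω hω
  by_contra hcon
  simp only [Set.mem_union, Set.mem_iUnion, Set.mem_ofPred_eq, not_or, not_exists, not_lt,
    not_le, Prod.forall] at hcon
  exact hω ⟨hcon.1.1.1, fun i j => (hcon.1.1.2 i j).le, fun i j => hcon.1.2 i j, hcon.2⟩

instance [NeZero n] : IsProbabilityMeasure (samplingLaw K n) := by
  have : IsProbabilityMeasure (uniformOn (Set.univ : Set (Fin n))) :=
    isProbabilityMeasure_uniformOn Set.finite_univ Set.univ_nonempty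
  unfold samplingLaw
  infer_instance

instance [NeZero n] : IsProbabilityMeasure (trainingLaw K n m d) := by
  unfold trainingLaw
  infer_instance

theorem trainingLaw_eq [NeZero n] (S : Set (Weights m d × (Fin m → ℝ) × (ℕ → Fin K → Fin n))) :
    trainingLaw K n m d S
      = ((initLaw m d).prod (samplingLaw K n)) {ω | (ω.1.1, ω.1.2, ω.2) ∈ S} :=
  ((measurePreserving_prodAssoc (hiddenInit m d) (outputInit m d)
    (samplingLaw K n)).measure_preimage_equiv S).symm

theorem trainingLaw_init [NeZero n] (S : Set (Weights m d × (Fin m → ℝ))) :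
    trainingLaw K n m d {ω | (ω.1, ω.2.1) ∈ S} = initLaw m d S := by
  rw [trainingLaw_eq]
  have : {ω : (Weights m d × (Fin m → ℝ)) × (ℕ → Fin K → Fin n) |
      (ω.1.1, ω.1.2, ω.2) ∈ {ω : Weights m d × (Fin m → ℝ) × (ℕ → Fin K → Fin n) |
        (ω.1, ω.2.1) ∈ S}} = S ×ˢ Set.univ := by
    ext ω
    simp
  rw [this, Measure.prod_prod, measure_univ, mul_one]

/-- Fubini: the maximal inequality holds for each fixed initialization with ∑ v_r² ≤ V. This
restriction is part of the event, so all other sections are empty. -/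
theorem trainingLaw_exists_noise_le [NeZero n] (hK : 0 < K)
    {x : Fin K → Fin n → EuclideanSpace ℝ (Fin d)} (hx : ∀ i j, ‖x i j‖ = 1)
    (y : Fin K → Fin n → ℝ) {η : ℝ} (hη : 0 < η) (τ : ℕ) (V : ℝ) (T : ℕ) :
    trainingLaw K n m d {ω | ∑ r, ω.2.1 r ^ 2 ≤ V ∧
        ∃ t ≤ T, 1 < η * ∑ s ∈ range t, noise x y η τ ω.2.1 ω.1 s ω.2.2}
      ≤ ENNReal.ofReal (T * (4 * η * ((K * n) ^ 2 * V * n)) ^ 2) := by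
  rw [trainingLaw_eq]
  set S : Set ((Weights m d × (Fin m → ℝ)) × (ℕ → Fin K → Fin n)) :=
    {ω | ∑ r, ω.1.2 r ^ 2 ≤ V ∧
      ∃ t ≤ T, 1 < η * ∑ s ∈ range t, noise x y η τ ω.1.2 ω.1.1 s ω.2} with hS
  have hSm : MeasurableSet S := by
    have h1 : MeasurableSet {ω : (Weights m d × (Fin m → ℝ)) × (ℕ → Fin K → Fin n) |
        ∑ r, ω.1.2 r ^ 2 ≤ V} := measurableSet_le (by fun_prop) measurable_const
    have h2 : MeasurableSet (⋃ t, ⋃ (_ : t ≤ T),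
        {ω : (Weights m d × (Fin m → ℝ)) × (ℕ → Fin K → Fin n) |
          1 < η * ∑ s ∈ range t, noise x y η τ ω.1.2 ω.1.1 s ω.2}) := by
      refine MeasurableSet.iUnion fun t => MeasurableSet.iUnion fun _ =>
        measurableSet_lt measurable_const (Measurable.const_mul ?_ η)
      exact Finset.measurable_sum _ fun s _ => measurable_noise x y η τ
        (f := fun ω : (Weights m d × (Fin m → ℝ)) × (ℕ → Fin K → Fin n) => ω.1.1)
        (v := fun ω => ω.1.2) (J := fun ω => ω.2) (measurable_fst.comp measurable_fst)
        (measurable_snd.comp measurable_fst) measurable_snd s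
    convert h1.inter h2 using 1
    ext ω
    simp [hS]
  change ((initLaw m d).prod (samplingLaw K n)) S ≤ _
  rw [Measure.prod_apply hSm]
  calc _ ≤ ∫⁻ _ω, ENNReal.ofReal (T * (4 * η * ((K * n) ^ 2 * V * n)) ^ 2) ∂initLaw m d := by
        refine lintegral_mono fun ω => ?_
        by_cases hV : ∑ r, ω.2 r ^ 2 ≤ V
        · refine (measure_mono ?_).trans
            (infinitePi_exists_noise_le x y η τ ω.2 ω.1 hK hη hx hV T)
          exact fun J hJ => hJ.2
        · have : Prod.mk ω ⁻¹' S = ∅ := by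
            ext J
            simp [hS, hV]
          simp [this]
    _ = _ := by simp

/-- A union bound on the complement and subadditivity, both valid for outer measure; S need not be
measurable. -/
theorem one_sub_le_trainingLaw_real [NeZero n]
    {S : Set (Weights m d × (Fin m → ℝ) × (ℕ → Fin K → Fin n))}
    {A : Set (Weights m d × (Fin m → ℝ))}
    {E : Set (Weights m d × (Fin m → ℝ) × (ℕ → Fin K → Fin n))} {a b : ℝ} (ha : 0 ≤ a) (hb : 0 ≤ b)
    (hA : initLaw m d A ≤ ENNReal.ofReal a) (hE : trainingLaw K n m d E ≤ ENNReal.ofReal b)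
    (hS : ∀ ω, (ω.1, ω.2.1) ∉ A → ω ∉ E → ω ∈ S) : 1 - (a + b) ≤ (trainingLaw K n m d).real S := by
  have h1 : trainingLaw K n m d Sᶜ ≤ ENNReal.ofReal (a + b) := by
    rw [ENNReal.ofReal_add ha hb]
    refine le_trans (measure_mono ?_) ((measure_union_le {ω | (ω.1, ω.2.1) ∈ A} E).trans
      (add_le_add ((trainingLaw_init A).trans_le hA) hE))
    intro ω hω
    by_contra h
    rw [Set.mem_union, not_or] at h
    exact hω (hS ω h.1 h.2)
  have h2 : (trainingLaw K n m d).real Sᶜ ≤ a + b := by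
    rw [measureReal_def]
    exact ENNReal.toReal_le_of_le_ofReal (by positivity) h1
  have h3 : (1 : ℝ) ≤ (trainingLaw K n m d).real S + (trainingLaw K n m d).real Sᶜ := by
    have := measureReal_union_le (μ := trainingLaw K n m d) S Sᶜ
    rwa [Set.union_compl_self, probReal_univ] at this
  linarith

end LocalSGD
end

/-! ### Scalar consequences of the assumptions on width, horizon and step size. -/

noncomputable section

namespace LocalSGD

section Scalars

theorem rpow_natCast_div_two {a : ℝ} (ha : 0 ≤ a) (k : ℕ) : a ^ ((k : ℝ) / 2) = √a ^ k := by
  rw [Real.sqrt_eq_rpow, ← Real.rpow_natCast, ← Real.rpow_mul ha]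
  congr 1
  ring

variable {n d m φ η τ T ℓ l : ℝ}

theorem le_sq_mul_sqrt_of_width (hd : 0 < d) (hn : 0 ≤ n) (hφ : 0 < φ) (hm : 0 ≤ m) (hℓ : 0 ≤ ℓ)
    (h : d * n ^ 25 * ℓ ^ 3 / φ ^ 4 ≤ m) : √n ^ 25 * √ℓ ^ 3 ≤ φ ^ 2 * √(m / d) := by
  rw [div_le_iff₀ (by positivity)] at h
  refine le_of_sq_le_sq ?_ (by positivity)
  rw [mul_pow, mul_pow, Real.sq_sqrt (by positivity), ← pow_mul, ← pow_mul, mul_comm 25 2,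
    mul_comm 3 2, pow_mul, pow_mul, Real.sq_sqrt hn, Real.sq_sqrt hℓ, ← mul_div_assoc,
    le_div_iff₀ hd]
  linarith

/-- Substitute the lower bound on T into ηmφT ≤ dn² log T. Square roots as base variables turn the
half-integer exponents into natural powers. -/
theorem stepSize_mul_le (hd : 1 ≤ d) (hn : 1 ≤ n) (hφ : 0 < φ) (hm : 0 < m) (hT : 0 < T)
    (hl : 1 / 2 ≤ l) (hτ : 0 ≤ τ) (hη : 0 < η)
    (hT' : d * √n ^ 45 * l ^ 3 * τ * √ℓ ^ 3 / √φ ^ 11 ≤ T)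
    (hη' : η ≤ d * n ^ 2 * l / (m * φ * T)) :
    (τ * (η * (m / d))) * √n ^ 41 * l ^ 2 * √ℓ ^ 3 ≤ √φ ^ 9 := by
  have hp : 0 < √φ := Real.sqrt_pos.mpr hφ
  have hr : 0 < √n := Real.sqrt_pos.mpr (by linarith)
  have hl0 : 0 < l := by linarith
  have hn2 : √n ^ 2 = n := Real.sq_sqrt (by linarith)
  have hp2 : √φ ^ 2 = φ := Real.sq_sqrt hφ.le
  set r := √n
  set p := √φ
  rw [← hn2, ← hp2] at hη'
  rw [div_le_iff₀ (by positivity)] at hT'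
  rw [le_div_iff₀ (by positivity)] at hη'
  have hM : 0 < η * m := by positivity
  have h1 : (η * m * p ^ 2) * (d * r ^ 45 * l ^ 3 * τ * √ℓ ^ 3) ≤ d * r ^ 4 * l * p ^ 11 := by
    calc _ ≤ (η * m * p ^ 2) * (T * p ^ 11) := by gcongr
      _ = η * (m * p ^ 2 * T) * p ^ 11 := by ring
      _ ≤ d * (r ^ 2) ^ 2 * l * p ^ 11 := by gcongr
      _ = _ := by ring
  have h2 : (d * r ^ 4 * l * p ^ 2) * (τ * (η * m) * r ^ 41 * l ^ 2 * √ℓ ^ 3)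
      ≤ (d * r ^ 4 * l * p ^ 2) * p ^ 9 := by linarith
  have h3 := le_of_mul_le_mul_left h2 (by positivity)
  refine le_trans (le_of_eq_of_le ?_ (div_le_self (a := τ * (η * m) * r ^ 41 * l ^ 2 * √ℓ ^ 3)
    (by positivity) hd)) h3
  ring

theorem sqrt_pow_seven_le (hφ : 0 < φ) (hφ2 : φ ≤ 2) : √φ ^ 7 ≤ 12 := by
  have h1 : √φ ≤ 3 / 2 := Real.sqrt_le_iff.mpr ⟨by norm_num, by norm_num; linarith⟩
  have h2 : √φ ^ 2 ≤ 2 := by rw [Real.sq_sqrt hφ.le]; exact hφ2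
  calc √φ ^ 7 = (√φ ^ 2) ^ 3 * √φ := by ring
    _ ≤ 2 ^ 3 * (3 / 2) := by gcongr
    _ = 12 := by norm_num

/-- The logarithmic factors cost at most 32, and φ^{9/2} ≤ 12φ. Used with a = τηm/d, this makes
drift and second-order terms negligible. -/
theorem period_mul_stepSize_le (hn : 1 ≤ n) (hφ : 0 < φ) (hφ2 : φ ≤ 2) (hℓ : 1 / 2 ≤ √ℓ)
    (hl : 1 / 2 ≤ l) {a : ℝ} (ha : 0 ≤ a) (h : a * √n ^ 41 * l ^ 2 * √ℓ ^ 3 ≤ √φ ^ 9) :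
    a * n ^ 20 ≤ 400 * φ := by
  have hr : 1 ≤ √n := Real.one_le_sqrt.mpr hn
  have h7 := sqrt_pow_seven_le hφ hφ2
  have h1 : a * √n ^ 40 * (1 / 2) ^ 2 * (1 / 2) ^ 3 ≤ a * √n ^ 41 * l ^ 2 * √ℓ ^ 3 := by
    gcongr
    norm_num
  have h2 : √n ^ 40 = n ^ 20 := by
    rw [show 40 = 2 * 20 by norm_num, pow_mul, Real.sq_sqrt (by linarith)]
  have h3 : √φ ^ 9 = φ * √φ ^ 7 := by
    nth_rw 2 [← Real.sq_sqrt hφ.le]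
    ring
  rw [h2] at h1
  nlinarith

/-- Used with a = ηm/d and b = aT, so that ab is, up to powers of n, the variance in the maximal
inequality; one of the two factors log T cancels the log T in the bound on b. -/
theorem stepSize_sq_mul_horizon_le (hn : 1 ≤ n) (hφ : 0 < φ) (hφ2 : φ ≤ 2) (hℓ : 1 / 2 ≤ √ℓ)
    (hl : 1 / 2 ≤ l) {a b : ℝ} (ha : 0 ≤ a) (hb : 0 ≤ b)
    (h : a * √n ^ 41 * l ^ 2 * √ℓ ^ 3 ≤ √φ ^ 9) (h' : b * φ ≤ n ^ 2 * l) :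
    a * b * n ^ 18 ≤ 192 := by
  have hr : 1 ≤ √n := Real.one_le_sqrt.mpr hn
  have hl0 : 0 < l := by linarith
  have hp : 0 < √φ := Real.sqrt_pos.mpr hφ
  have h7 := sqrt_pow_seven_le hφ hφ2
  have hn2 : √n ^ 2 = n := Real.sq_sqrt (by linarith)
  have hp2 : √φ ^ 2 = φ := Real.sq_sqrt hφ.le
  have h1 : (a * √n ^ 41 * l ^ 2 * √ℓ ^ 3) * (b * √φ ^ 2) ≤ √φ ^ 9 * ((√n ^ 2) ^ 2 * l) := by
    rw [hp2, hn2]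
    gcongr
  have h2 : (√n ^ 4 * l * √φ ^ 2) * (a * b * √n ^ 37 * l * √ℓ ^ 3)
      ≤ (√n ^ 4 * l * √φ ^ 2) * √φ ^ 7 := by
    linarith
  have h3 := le_of_mul_le_mul_left h2 (by positivity)
  have h4 : a * b * √n ^ 36 * (1 / 2) * (1 / 2) ^ 3 ≤ a * b * √n ^ 37 * l * √ℓ ^ 3 := by
    gcongr
    norm_num
  have h5 : √n ^ 36 = n ^ 18 := by
    rw [show 36 = 2 * 18 by norm_num, pow_mul, hn2]
  rw [h5] at h4
  linarith

end Scalars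

end LocalSGD
end

/-! ### The conditions of the trajectory theorem for the chosen parameters. -/

noncomputable section

namespace LocalSGD

open Finset

section Conditions

variable {k n φ M c₀ η τ B r p q : ℝ}

theorem sqrt_le_self_of_one_le {a : ℝ} (ha : 1 ≤ a) : √a ≤ a :=
  Real.sqrt_le_iff.mpr ⟨by linarith, by nlinarith⟩

theorem drift_condition (hk : 1 ≤ k) (hn : 12800 * k ≤ n) (hφ : 0 < φ) (hτη : 0 ≤ τ * (η * M))
    (hstep : τ * (η * M) * n ^ 20 ≤ 400 * φ) :
    8 * √(k * n) * n * τ * η * (2 * M) ≤ φ / (2 * n ^ 5) := by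
  have hn1 : 1 ≤ n := by linarith
  have hn0 : 0 < n := by linarith
  have hs : √(k * n) ≤ k * n := sqrt_le_self_of_one_le (by nlinarith)
  have h1 : τ * (η * M) ≤ 400 * φ / n ^ 20 := (le_div_iff₀ (by positivity)).mpr hstep
  calc 8 * √(k * n) * n * τ * η * (2 * M) = 16 * √(k * n) * n * (τ * (η * M)) := by ring
    _ ≤ 16 * (k * n) * n * (400 * φ / n ^ 20) := by gcongr
    _ = 12800 * k * φ / (2 * n ^ 18) := by field_simp; ring
    _ ≤ n * φ / (2 * n ^ 18) := by gcongr
    _ = φ / (2 * n ^ 17) := by field_simp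
    _ ≤ φ / (2 * n ^ 5) := by
        gcongr
        norm_num

theorem linearization_condition (hk : 1 ≤ k) (hn : 1 ≤ n) (hφ : 0 < φ) (hM : 0 < M) :
    √(k * n) * (n * (φ / (2 * n ^ 5) * (2 * M) + 3 * (φ / n ^ 5 * M)))
      ≤ 4 * k * M * φ / n ^ 3 := by
  have hs : √(k * n) ≤ k * n := sqrt_le_self_of_one_le (by nlinarith)
  calc _ ≤ (k * n) * (n * (φ / (2 * n ^ 5) * (2 * M) + 3 * (φ / n ^ 5 * M))) := by gcongr
    _ = _ := by field_simp; ring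

/-- Each perturbation is the rate Mφ/n² times a constant multiple of k⁴/n; the spare 1/n beats c₀/k
for large n. -/
theorem perturbation_condition (hk : 1 ≤ k) (hn : 1 ≤ n) (hc : 204800 * k ^ 5 ≤ c₀ * n)
    (hφ : 0 < φ) (hφ2 : φ ≤ 2) (hM : 0 < M) (hη : 0 < η) (hstep : η * M * n ^ 20 ≤ 400 * φ) :
    2 * (4 * k * M * φ / n ^ 3) + 2 * η * ((k * n) ^ 2 * (2 * M) * n) ^ 2
      + 2 * η * (4 * k * M * φ / n ^ 3) ^ 2 ≤ c₀ * (M * φ) / n ^ 2 / k := by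
  have h1 : η * M ≤ 400 * φ / n ^ 20 := (le_div_iff₀ (by positivity)).mpr hstep
  have h2 : 2 * η * ((k * n) ^ 2 * (2 * M) * n) ^ 2 ≤ M * φ / n ^ 2 * (3200 * k ^ 4 / n) := by
    calc _ = 8 * k ^ 4 * n ^ 6 * M * (η * M) := by ring
      _ ≤ 8 * k ^ 4 * n ^ 6 * M * (400 * φ / n ^ 20) := by gcongr
      _ = M * φ / n ^ 2 * (3200 * k ^ 4 / n ^ 12) := by field_simp; ring
      _ ≤ M * φ / n ^ 2 * (3200 * k ^ 4 / n) := by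
        gcongr
        exact le_self_pow₀ hn (by norm_num)
  have h3 : 2 * η * (4 * k * M * φ / n ^ 3) ^ 2 ≤ M * φ / n ^ 2 * (51200 * k ^ 2 / n) := by
    calc _ = 32 * k ^ 2 * M * φ * (φ * (η * M)) / n ^ 6 := by field_simp; ring
      _ ≤ 32 * k ^ 2 * M * φ * (2 * (400 * 2 / n ^ 20)) / n ^ 6 := by
        gcongr
        exact h1.trans (by gcongr)
      _ ≤ 32 * k ^ 2 * M * φ * (2 * (400 * 2 / 1)) / n ^ 3 := by
        gcongr
        · exact one_le_pow₀ hn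
        · norm_num
      _ = _ := by field_simp; ring
  have hk4 : k ≤ k ^ 4 := le_self_pow₀ hk (by norm_num)
  have hk2 : k ^ 2 ≤ k ^ 4 := pow_le_pow_right₀ hk (by norm_num)
  have h4 : (8 * k + 3200 * k ^ 4 + 51200 * k ^ 2) / n ≤ c₀ / k := by
    rw [div_le_div_iff₀ (by positivity) (by positivity)]
    refine le_trans ?_ hc
    have : (8 * k + 3200 * k ^ 4 + 51200 * k ^ 2) * k ≤ (204800 * k ^ 4) * k := by
      gcongr
      linarith
    linarith
  have h5 : 2 * (4 * k * M * φ / n ^ 3) = M * φ / n ^ 2 * (8 * k / n) := by field_simp; ring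
  calc _ ≤ M * φ / n ^ 2 * (8 * k / n) + M * φ / n ^ 2 * (3200 * k ^ 4 / n)
        + M * φ / n ^ 2 * (51200 * k ^ 2 / n) := by linarith
    _ = M * φ / n ^ 2 * ((8 * k + 3200 * k ^ 4 + 51200 * k ^ 2) / n) := by ring
    _ ≤ M * φ / n ^ 2 * (c₀ / k) := by gcongr
    _ = _ := by ring

theorem rate_condition (hk : 1 ≤ k) (hn : 1600 ≤ n) (hc1 : c₀ ≤ 1)
    (hφ : 0 < φ) (hφ2 : φ ≤ 2) (hM : 0 < M) (hη : 0 < η) (hstep : η * M * n ^ 20 ≤ 400 * φ) :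
    η * (c₀ * (M * φ) / n ^ 2 / k) ≤ 1 := by
  have hn1 : 1 ≤ n := by linarith
  have h1 : η * M ≤ 400 * φ / n ^ 20 := (le_div_iff₀ (by positivity)).mpr hstep
  calc η * (c₀ * (M * φ) / n ^ 2 / k) = c₀ * (η * M) * φ / n ^ 2 / k := by ring
    _ ≤ 1 * (400 * 2 / n) * 2 / 1 / 1 := by
        gcongr
        · refine h1.trans ?_
          gcongr
          exact le_self_pow₀ hn1 (by norm_num)
        · exact one_le_pow₀ hn1
    _ = 1600 / n := by ring
    _ ≤ 1 := (div_le_one (by linarith)).mpr hn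

theorem residual_bound_le (hk : 1 ≤ k) (hn : 1 ≤ n) (hB0 : 0 ≤ B) (hB : B ≤ n) :
    √(k * n) * (n + B) ≤ 2 * k * √n ^ 3 := by
  have hs : √k ≤ k := sqrt_le_self_of_one_le hk
  have hn2 : √n ^ 2 = n := Real.sq_sqrt (by linarith)
  rw [Real.sqrt_mul (by linarith)]
  calc √k * √n * (n + B) ≤ k * √n * (n + n) := by gcongr
    _ = 2 * k * (√n * √n ^ 2) := by rw [hn2]; ring
    _ = _ := by ring

/-- This is where the width enters: n^{23/2} would suffice up to constants, and the width gives
n^{25/2}, so one factor n absorbs them. -/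
theorem radius_condition (hk : 1 ≤ k) (hn : 1 ≤ n) (hc0 : 0 < c₀) (hc : 192 * k ^ 2 ≤ c₀ * n)
    (hφ : 0 < φ) (hM : 0 < M) (hq : 1 / 2 ≤ q) (hw : √n ^ 25 * q ^ 3 ≤ φ ^ 2 * √M) {u : ℝ}
    (hu : u ≤ 2 * k * √n ^ 3) :
    2 * n * (6 * u / (c₀ * (M * φ) / n ^ 2 / k)) ≤ φ / (n ^ 7 * √M) := by
  have hr : 0 < √n := Real.sqrt_pos.mpr (by linarith)
  have hS : 0 < √M := Real.sqrt_pos.mpr hM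
  have hn2 : √n ^ 2 = n := Real.sq_sqrt (by linarith)
  have hM2 : √M ^ 2 = M := Real.sq_sqrt hM.le
  have h1 : √n ^ 25 * (1 / 2) ^ 3 ≤ φ ^ 2 * √M := le_trans (by gcongr) hw
  have h2 : 24 * k ^ 2 * √n ^ 23 ≤ c₀ * (φ ^ 2 * √M) := by
    calc 24 * k ^ 2 * √n ^ 23 = (192 * k ^ 2) * √n ^ 23 / 8 := by ring
      _ ≤ (c₀ * n) * √n ^ 23 / 8 := by gcongr
      _ = c₀ * (√n ^ 2 * √n ^ 23 * (1 / 2) ^ 3) := by rw [hn2]; ring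
      _ = c₀ * (√n ^ 25 * (1 / 2) ^ 3) := by ring
      _ ≤ _ := by gcongr
  calc _ = 2 * √n ^ 2 * (6 * u / (c₀ * (√M ^ 2 * φ) / (√n ^ 2) ^ 2 / k)) := by rw [hn2, hM2]
    _ ≤ 2 * √n ^ 2 * (6 * (2 * k * √n ^ 3) / (c₀ * (√M ^ 2 * φ) / (√n ^ 2) ^ 2 / k)) := by gcongr
    _ = 24 * k ^ 2 * √n ^ 23 / (c₀ * φ * √M ^ 2 * √n ^ 14) := by field_simp; ring
    _ ≤ c₀ * (φ ^ 2 * √M) / (c₀ * φ * √M ^ 2 * √n ^ 14) := by gcongr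
    _ = φ / ((√n ^ 2) ^ 7 * √M) := by field_simp
    _ = _ := by rw [hn2]

/-- √θ dominates, and n√θ is smaller than √(Mφ)/n by a factor √n. -/
theorem movement_condition (hk : 1 ≤ k) (hn : 1 ≤ n) (hc0 : 0 < c₀) (hc : 9 * k ^ 2 ≤ c₀ * n)
    (hφ : 0 < φ) (hφ2 : φ ≤ 2) (hM : 0 < M) :
    n * (φ / (2 * n ^ 5) * √(2 * M) + √(φ / n ^ 5 * M)) ≤ √(c₀ * (M * φ) / n ^ 2) / k := by
  have hn0 : 0 < n := by linarith
  have h1 : φ / (2 * n ^ 5) * √(2 * M) ≤ √(φ / n ^ 5 * M) := by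
    refine Real.le_sqrt_of_sq_le ?_
    rw [mul_pow, Real.sq_sqrt (by positivity)]
    calc (φ / (2 * n ^ 5)) ^ 2 * (2 * M) = φ / n ^ 5 * M * (φ / (2 * n ^ 5)) := by
          field_simp
      _ ≤ φ / n ^ 5 * M * 1 := by
          gcongr
          rw [div_le_one (by positivity)]
          have := one_le_pow₀ hn (n := 5)
          linarith
      _ = _ := mul_one _
  have h2 : 2 * n * √(φ / n ^ 5 * M) * k ≤ √(c₀ * (M * φ) / n ^ 2) := by
    refine Real.le_sqrt_of_sq_le ?_
    rw [mul_pow, mul_pow, Real.sq_sqrt (by positivity)]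
    calc (2 * n) ^ 2 * (φ / n ^ 5 * M) * k ^ 2 = (4 * k ^ 2) * (M * φ) / n ^ 3 := by
          field_simp; ring
      _ ≤ (c₀ * n) * (M * φ) / n ^ 3 := by
          have : 4 * k ^ 2 ≤ c₀ * n := by nlinarith
          gcongr
      _ = _ := by field_simp
  rw [le_div_iff₀ (by linarith)]
  refine le_trans ?_ h2
  calc _ ≤ n * (√(φ / n ^ 5 * M) + √(φ / n ^ 5 * M)) * k := by gcongr
    _ = _ := by ring

/-- The exponents of ω arise here: ‖u_0‖/√λ is of order n^{5/2}/√(Mφ), and the width bound replaces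
√M. -/
theorem movement_bound_le (hk : 1 ≤ k) (hn : 1 ≤ n) (hc0 : 0 < c₀) (hc1 : c₀ ≤ 1)
    (hφ : 0 < φ) (hM : 0 < M) (hq : 1 / 2 ≤ q) (hw : √n ^ 25 * q ^ 3 ≤ φ ^ 2 * √M) {u : ℝ}
    (hu : u ≤ 2 * k * √n ^ 3) :
    14 * u / √(c₀ * (M * φ) / n ^ 2) ≤ 28 * k / c₀ * (√φ ^ 3 / (n ^ 9 * q ^ 3)) := by
  have hr : 1 ≤ √n := Real.one_le_sqrt.mpr hn
  have hr0 : 0 < √n := by linarith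
  have hS : 0 < √M := Real.sqrt_pos.mpr hM
  have hp : 0 < √φ := Real.sqrt_pos.mpr hφ
  have hn2 : √n ^ 2 = n := Real.sq_sqrt (by linarith)
  have hp2 : √φ ^ 2 = φ := Real.sq_sqrt hφ.le
  have hlam : c₀ * (√M * √φ) / n ≤ √(c₀ * (M * φ) / n ^ 2) := by
    refine Real.le_sqrt_of_sq_le ?_
    rw [div_pow, mul_pow, mul_pow, Real.sq_sqrt hM.le, hp2]
    gcongr
    exact pow_le_of_le_one hc0.le hc1 (by norm_num)
  have h1 : √n ^ 23 * q ^ 3 ≤ (√φ ^ 2) ^ 2 * √M := by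
    rw [hp2]
    refine le_trans ?_ hw
    gcongr
    norm_num
  calc 14 * u / √(c₀ * (M * φ) / n ^ 2)
      ≤ 14 * (2 * k * √n ^ 3) / (c₀ * (√M * √φ) / n) := by gcongr
    _ = 28 * k / c₀ * (√n ^ 3 * n / (√M * √φ)) := by field_simp; ring
    _ ≤ 28 * k / c₀ * (√φ ^ 3 / (n ^ 9 * q ^ 3)) := by
        refine mul_le_mul_of_nonneg_left ?_ (by positivity)
        rw [div_le_div_iff₀ (by positivity) (by positivity)]
        calc √n ^ 3 * n * (n ^ 9 * q ^ 3) = √n ^ 3 * (√n ^ 2) ^ 10 * q ^ 3 := by rw [hn2]; ring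
          _ = √n ^ 23 * q ^ 3 := by ring
          _ ≤ (√φ ^ 2) ^ 2 * √M := h1
          _ = _ := by ring

end Conditions

end LocalSGD
end

/-! ### Assembly: convergence from a good initialization and its failure probability. -/

noncomputable section

namespace LocalSGD

open Finset

variable {K n m d : ℕ}

section Convergence

variable {x : Fin K → Fin n → EuclideanSpace ℝ (Fin d)} {y : Fin K → Fin n → ℝ} {η : ℝ} {τ T : ℕ}
  {v : Fin m → ℝ} {W₀ : Weights m d} {J : ℕ → Fin K → Fin n} {M φ c₀ B q : ℝ}

/-- The training trajectory from a good initialization, as long as the accumulated sampling noise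
stays small. -/
theorem trajectory_of_isGoodInit (hK : 0 < K) (hx : ∀ i j, ‖x i j‖ = 1)
    (hy : ∀ i j, |y i j| ≤ B) (hη : 0 < η) (hτ : 0 < τ) (hM : 0 < M) (hφ : 0 < φ) (hφ2 : φ ≤ 2)
    (hc0 : 0 < c₀) (hc1 : c₀ ≤ 1) (hc : 204800 * (K : ℝ) ^ 5 ≤ c₀ * n) (hB0 : 0 ≤ B) (hB : B ≤ n)
    (hstep : τ * (η * M) * (n : ℝ) ^ 20 ≤ 400 * φ) (hq : 1 / 2 ≤ q)
    (hw : √(n : ℝ) ^ 25 * q ^ 3 ≤ φ ^ 2 * √M)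
    (hinit : IsGoodInit x (2 * M) n (φ / ((n : ℝ) ^ 7 * √M)) (φ / (n : ℝ) ^ 5 * M)
      (c₀ * (M * φ) / (n : ℝ) ^ 2) v W₀)
    (hnoise : ∀ t ≤ T, η * ∑ s ∈ range t, noise x y η τ v W₀ s J ≤ 1) {t : ℕ} (ht : t ≤ T) :
    ‖residual x y v (avgIterate x y η τ v W₀ J t)‖ ^ 2 ≤ 4 * ‖residual x y v W₀‖ ^ 2
        * Real.exp (-(η * (c₀ * (M * φ) / (n : ℝ) ^ 2 / K))) ^ t ∧
      frobNorm (avgIterate x y η τ v W₀ J t - W₀)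
        ≤ 28 * K / c₀ * (√φ ^ 3 / ((n : ℝ) ^ 9 * q ^ 3)) ∧
      (∀ i, frobNorm (localIterate x y η τ v W₀ J t i - W₀)
        ≤ 28 * K / c₀ * (√φ ^ 3 / ((n : ℝ) ^ 9 * q ^ 3))) ∧
      η * (c₀ * (M * φ) / (n : ℝ) ^ 2 / K) ≤ 1 := by
  have hk : (1 : ℝ) ≤ K := by exact_mod_cast hK
  have hcn : 204800 * (K : ℝ) ^ 5 ≤ n := hc.trans (mul_le_of_le_one_left (by positivity) hc1)
  have hk1 : (1 : ℝ) ≤ (K : ℝ) ^ 5 := one_le_pow₀ hk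
  have hk2 : (K : ℝ) ^ 2 ≤ (K : ℝ) ^ 5 := pow_le_pow_right₀ hk (by norm_num)
  have hkk : (K : ℝ) ≤ (K : ℝ) ^ 5 := le_self_pow₀ hk (by norm_num)
  have hn1 : (1 : ℝ) ≤ n := by linarith
  have hn : 0 < n := by exact_mod_cast (zero_lt_one.trans_le hn1)
  have hτ1 : (1 : ℝ) ≤ τ := by exact_mod_cast hτ
  have hηM : 0 ≤ η * M := by positivity
  have hstep1 : η * M * (n : ℝ) ^ 20 ≤ 400 * φ :=
    (mul_le_mul_of_nonneg_right (le_mul_of_one_le_left hηM hτ1) (by positivity)).trans hstep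
  have hu : ‖residual x y v W₀‖ ≤ 2 * K * √(n : ℝ) ^ 3 := by
    refine le_trans (norm_le_sqrt_card_mul _ (b := n + B) (by positivity) fun p => ?_)
      (by simpa using residual_bound_le hk hn1 hB0 hB)
    rw [residual_apply]
    exact (abs_sub _ _).trans (add_le_add (hinit.abs_network_le _ _) (hy _ _))
  have h1 := drift_condition (k := (K : ℝ)) (n := n) hk (by linarith) hφ (by positivity) hstep
  have h2 : φ / (2 * (n : ℝ) ^ 5) ≤ 1 := by
    rw [div_le_one (by positivity)]
    linarith [one_le_pow₀ hn1 (n := 5)]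
  have h3 := linearization_condition (k := (K : ℝ)) hk hn1 hφ hM
  have h4 := perturbation_condition hk hn1 hc hφ hφ2 hM hη hstep1
  have h5 := rate_condition (c₀ := c₀) hk (by linarith) hc1 hφ hφ2 hM hη hstep1
  have h6 := radius_condition hk hn1 hc0 (by linarith) hφ hM hq hw hu
  have h7 := movement_condition (c₀ := c₀) hk hn1 hc0 (by linarith) hφ hφ2 hM
  have hbd := movement_bound_le hk hn1 hc0 hc1 hφ hM hq hw hu
  have hres := norm_residual_sq_le hK hx hη hτ hinit.sum_sq_le h1 h2 (by positivity)
    hinit.flip_le (by positivity) hinit.le_norm_featureMap_sq h3 h4 h5 hnoise h6 t ht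
  have hmove := norm_flat_sub_le hK hn hx hη hτ hinit.sum_sq_le h1 h2 (by positivity)
    hinit.flip_le (by positivity) hinit.le_norm_featureMap_sq h3 h4 h5 hnoise h6 h7 t ht
  refine ⟨hres, ?_, fun i => ?_, h5⟩
  · rw [frobNorm_eq_norm_flat]
    exact hmove.1.trans hbd
  · rw [frobNorm_eq_norm_flat]
    exact (hmove.2 i).trans hbd

/-- e^{-a} ≤ 1/(1 + a) ≤ 1 - a/2 on [0, 1], and the factor 4 is at most n. -/
theorem globalLoss_le_of_norm_residual_sq_le {W W' : Weights m d} {a : ℝ} (ha : a ≤ 1)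
    (hn : 4 ≤ n) (t : ℕ)
    (h : ‖residual x y v W‖ ^ 2 ≤ 4 * ‖residual x y v W'‖ ^ 2 * Real.exp (-a) ^ t) (ha0 : 0 ≤ a) :
    globalLoss x y v W ≤ (1 - a / 2) ^ t * n * globalLoss x y v W' := by
  have hexp : Real.exp (-a) ≤ 1 - a / 2 := by
    have h1 := Real.add_one_le_exp a
    rw [Real.exp_neg]
    refine inv_le_of_inv_le₀ (by linarith) ((inv_le_of_inv_le₀ (by positivity) ?_).trans h1)
    rw [inv_eq_one_div, div_le_iff₀ (by linarith)]
    nlinarith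
  have hn' : (4 : ℝ) ≤ n := by exact_mod_cast hn
  rw [globalLoss_eq, globalLoss_eq]
  calc (K : ℝ)⁻¹ * (‖residual x y v W‖ ^ 2 / 2)
      ≤ (K : ℝ)⁻¹ * (n * ‖residual x y v W'‖ ^ 2 * (1 - a / 2) ^ t / 2) := by
        gcongr
        refine h.trans ?_
        gcongr
    _ = _ := by ring

end Convergence

/-- The failure probability of the initialization. -/
theorem init_failure_le {k κ N φ M m d : ℝ} (hk : 1 ≤ k) (hκ0 : 0 < κ) (hκ1 : κ ≤ 1) (hN : 1 ≤ N)
    (hφ : 0 < φ) (hφ2 : φ ≤ 2) (hd : 1 ≤ d) (hm : 0 < m) (hM : M = m / d) {q : ℝ} (hq : 1 / 2 ≤ q)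
    (hw : √N ^ 25 * q ^ 3 ≤ φ ^ 2 * √M) :
    40 / m + k * N * (2 / (d * N ^ 2))
        + k * N * (m * (21 / (d * √d) * (φ / (N ^ 7 * √M) * √m)) / (φ / N ^ 5 * M))
        + 256000 * (k * N) ^ 8 / (m * (κ * φ / 2) ^ 2)
      ≤ 300000000 * (k ^ 8 / κ ^ 2) / N := by
  have hd0 : 0 < d := by linarith
  have hM0 : 0 < M := by rw [hM]; positivity
  have hmM : m = M * d := by rw [hM]; field_simp
  have hMm : M ≤ m := by rw [hmM]; exact le_mul_of_one_le_right hM0.le hd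
  have hwidth : N ^ 25 ≤ 64 * φ ^ 4 * M := by
    have h1 : (√N ^ 25 * (1 / 2) ^ 3) ^ 2 ≤ (φ ^ 2 * √M) ^ 2 :=
      pow_le_pow_left₀ (by positivity) (le_trans (by gcongr) hw) 2
    rw [mul_pow, mul_pow, Real.sq_sqrt hM0.le, ← pow_mul, mul_comm 25 2, pow_mul,
      Real.sq_sqrt (by linarith)] at h1
    linarith
  have hA : 1 ≤ k ^ 8 / κ ^ 2 := by
    rw [one_le_div (by positivity)]
    exact (pow_le_one₀ hκ0.le hκ1).trans (one_le_pow₀ hk)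
  have hkA : k ≤ k ^ 8 / κ ^ 2 := by
    rw [le_div_iff₀ (by positivity)]
    exact (mul_le_of_le_one_right (by linarith) (pow_le_one₀ hκ0.le hκ1)).trans
      (le_self_pow₀ hk (by norm_num))
  set A := k ^ 8 / κ ^ 2 with hAdef
  have h1 : 40 / m ≤ 40960 * A / N := by
    rw [div_le_div_iff₀ hm (by linarith)]
    have : N ≤ N ^ 25 := le_self_pow₀ hN (by norm_num)
    have h4 : φ ^ 4 ≤ 2 ^ 4 := pow_le_pow_left₀ hφ.le hφ2 4
    have h5 : N ≤ 1024 * m := by nlinarith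
    nlinarith
  have h2 : k * N * (2 / (d * N ^ 2)) ≤ 2 * A / N := by
    calc k * N * (2 / (d * N ^ 2)) = 2 * k / N / d := by field_simp
      _ ≤ 2 * k / N := div_le_self (by positivity) hd
      _ ≤ _ := by gcongr
  -- With ρ = φ/(N⁷√M) and θ = φM/N⁵, all dependence on φ, m and d cancels and 21k/N is left.
  have h3 : k * N * (m * (21 / (d * √d) * (φ / (N ^ 7 * √M) * √m)) / (φ / N ^ 5 * M))
      ≤ 21 * A / N := by
    have hsm : √m = √M * √d := by rw [hmM, Real.sqrt_mul hM0.le]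
    have hS : 0 < √M := Real.sqrt_pos.mpr hM0
    have hsd : 0 < √d := Real.sqrt_pos.mpr hd0
    rw [hsm, hmM]
    calc _ = 21 * k / N := by field_simp
      _ ≤ _ := by gcongr
  have h4 : 256000 * (k * N) ^ 8 / (m * (κ * φ / 2) ^ 2) ≤ 262144000 * A / N := by
    have h5 : N ^ 25 ≤ 256 * (m * φ ^ 2) := by
      have : φ ^ 2 ≤ 2 ^ 2 := pow_le_pow_left₀ hφ.le hφ2 2
      calc N ^ 25 ≤ 64 * φ ^ 2 * (φ ^ 2 * M) := by linarith
        _ ≤ 64 * 2 ^ 2 * (φ ^ 2 * m) := by gcongr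
        _ = _ := by ring
    have h6 : N ^ 9 ≤ N ^ 25 := pow_le_pow_right₀ hN (by norm_num)
    calc 256000 * (k * N) ^ 8 / (m * (κ * φ / 2) ^ 2)
        = 1024000 * A * (N ^ 9 / (m * φ ^ 2)) / N := by rw [hAdef]; field_simp; ring
      _ ≤ 1024000 * A * 256 / N := by
          gcongr
          rw [div_le_iff₀ (by positivity)]
          linarith
      _ = _ := by ring
  calc _ ≤ 40960 * A / N + 2 * A / N + 21 * A / N + 262144000 * A / N := by gcongr
    _ = 262184983 * A / N := by ring
    _ ≤ _ := by gcongr; norm_num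

end LocalSGD
end

/-! ### The main theorem. -/

set_option maxHeartbeats 1000000 in
theorem mainTheorem2 (K : ℕ) (hK : 0 < K) (B κ : ℝ) (hκ : 0 < κ) :
    ∃ c C : ℝ, 0 < c ∧ 0 < C ∧
      ∀ (n m d τ T : ℕ) [NeZero n] (φ η : ℝ)
        (x : Fin K → Fin n → EuclideanSpace ℝ (Fin d)) (y : Fin K → Fin n → ℝ),
        2 ≤ m → 0 < τ → 0 < φ →
        (∀ i j, ‖x i j‖ = 1) →
        (∀ i j, |y i j| ≤ B) →
        (∀ i j i' j', (i, j) ≠ (i', j') →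
          φ ≤ ‖x i j - x i' j'‖ ∧ κ * φ ≤ ‖x i j + x i' j'‖) →
        (d : ℝ) * (n : ℝ) ^ 25 * Real.log m ^ 3 / φ ^ 4 ≤ m →
        (d : ℝ) * (n : ℝ) ^ (45 / 2 : ℝ) * Real.log T ^ 3 * τ * Real.log m ^ (3 / 2 : ℝ)
          / φ ^ (11 / 2 : ℝ) ≤ T →
        0 < η → η ≤ (d : ℝ) * (n : ℝ) ^ 2 * Real.log T / (m * φ * T) →
        1 - C / n ≤ (LocalSGD.trainingLaw K n m d).real
          {ω | ∀ t ≤ T,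
            LocalSGD.frobNorm (LocalSGD.avgIterate x y η τ ω.2.1 ω.1 ω.2.2 t - ω.1)
                ≤ C * (φ ^ (3 / 2 : ℝ) / ((n : ℝ) ^ 9 * Real.log m ^ (3 / 2 : ℝ))) ∧
            (∀ i, LocalSGD.frobNorm (LocalSGD.localIterate x y η τ ω.2.1 ω.1 ω.2.2 t i - ω.1)
                ≤ C * (φ ^ (3 / 2 : ℝ) / ((n : ℝ) ^ 9 * Real.log m ^ (3 / 2 : ℝ)))) ∧
            LocalSGD.globalLoss x y ω.2.1 (LocalSGD.avgIterate x y η τ ω.2.1 ω.1 ω.2.2 t)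
                ≤ (1 - c * (η * m * φ / (d * (n : ℝ) ^ 2))) ^ t * n
                    * LocalSGD.globalLoss x y ω.2.1 ω.1
                  + Real.exp (C * ((d : ℝ) ^ (1 / 2 : ℝ) * (n : ℝ) ^ 10
                        / ((m : ℝ) ^ (1 / 2 : ℝ) * φ ^ (5 / 2 : ℝ))))
                    * (C * ((m : ℝ) ^ (7 / 2 : ℝ) * (n : ℝ) ^ 11 * (τ : ℝ) ^ 3 * η ^ 3
                          / ((d : ℝ) ^ 3 * φ ^ (3 / 2 : ℝ))
                        + (m : ℝ) ^ (3 / 2 : ℝ) * (n : ℝ) ^ 9 * τ * η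
                          / ((d : ℝ) ^ (1 / 2 : ℝ) * φ ^ (3 / 2 : ℝ))))
                    * LocalSGD.globalLoss x y ω.2.1 ω.1} := by
  -- With κ' ≤ 1 both separation conditions hold at the scale κ'φ.
  obtain ⟨κ', hκ'⟩ : ∃ κ' : ℝ, κ' = min 1 κ := ⟨_, rfl⟩
  have hκ0 : 0 < κ' := hκ' ▸ lt_min one_pos hκ
  have hκ1 : κ' ≤ 1 := hκ' ▸ min_le_left _ _
  have hk : (1 : ℝ) ≤ K := by exact_mod_cast hK
  have hk0 : (0 : ℝ) < K := by linarith
  obtain ⟨A, hA⟩ : ∃ A : ℝ, A = (K : ℝ) ^ 8 / κ' ^ 2 := ⟨_, rfl⟩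
  have hκsq : κ' ^ 2 ≤ κ' := pow_le_of_le_one hκ0.le hκ1 (by norm_num)
  have hA7 : (K : ℝ) ^ 7 / κ' ≤ A := by
    rw [hA]
    gcongr
    norm_num
  have hA4 : (K : ℝ) ^ 4 ≤ A := by
    rw [hA, le_div_iff₀ (by positivity)]
    exact (mul_le_of_le_one_right (by positivity) (pow_le_one₀ hκ0.le hκ1)).trans
      (pow_le_pow_right₀ hk (by norm_num))
  have hA1 : 1 ≤ A := (one_le_pow₀ hk).trans hA4
  -- The Gram bound (m/d)β/(80(Kn)²) with β = κ'φ/2 is c₀ · (m/d)φ/n².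
  obtain ⟨c₀, hc₀⟩ : ∃ c₀ : ℝ, c₀ = κ' / (160 * (K : ℝ) ^ 2) := ⟨_, rfl⟩
  have hc0 : 0 < c₀ := by rw [hc₀]; positivity
  have hc1 : c₀ ≤ 1 := by
    rw [hc₀, div_le_one (by positivity)]
    linarith [one_le_pow₀ hk (n := 2)]
  obtain ⟨C, hC⟩ : ∃ C : ℝ, C = 1000000000 * A + |B| := ⟨_, rfl⟩
  have hC0 : 0 < C := by rw [hC]; positivity
  refine ⟨c₀ / (2 * K), C, by positivity, hC0, ?_⟩
  intro n m d τ T _ φ η x y hm hτ hφ hx hy hsep hwidth hhorizon hη hη'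
  have hn0 : (0 : ℝ) < n := by exact_mod_cast Nat.pos_of_ne_zero (NeZero.ne n)
  -- For n < C the claimed probability is negative, so n may be assumed large compared with K, 1/κ'
  -- and B.
  rcases lt_or_ge (n : ℝ) C with hnC | hnC
  · refine le_trans ?_ measureReal_nonneg
    rw [sub_nonpos, one_le_div hn0]
    exact hnC.le
  have hAn : 1000000000 * A ≤ n := le_trans (by rw [hC]; linarith [abs_nonneg B]) hnC
  have hBn : |B| ≤ n := le_trans (by rw [hC]; linarith) hnC
  have hn1 : (1 : ℝ) ≤ n := by linarith
  have hn4 : 4 ≤ n := by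
    have : ((4 : ℕ) : ℝ) ≤ n := by push_cast; linarith
    exact_mod_cast this
  have hc : 204800 * (K : ℝ) ^ 5 ≤ c₀ * n := by
    rw [div_le_iff₀ hκ0] at hA7
    rw [hc₀, div_mul_eq_mul_div, le_div_iff₀ (by positivity)]
    nlinarith
  have i₀ : Fin K := ⟨0, hK⟩
  have hφ2 : φ ≤ 2 := by
    have h := (hsep i₀ ⟨0, by omega⟩ i₀ ⟨1, by omega⟩ (by simp)).1
    refine h.trans ((norm_sub_le _ _).trans ?_)
    rw [hx, hx]
    norm_num
  have hd : 0 < d := by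
    rcases Nat.eq_zero_or_pos d with rfl | h
    · have h := hx i₀ ⟨0, by omega⟩
      rw [Subsingleton.elim (x i₀ ⟨0, by omega⟩) 0, norm_zero] at h
      exact absurd h (by norm_num)
    · exact h
  have hd1 : (1 : ℝ) ≤ d := by exact_mod_cast hd
  have hd0 : (0 : ℝ) < d := by linarith
  have hm0 : (0 : ℝ) < m := by positivity
  -- For T ≤ 1 the logarithm vanishes and no positive step size is admissible.
  have hT : 2 ≤ T := by
    by_contra h
    have hlog : Real.log T = 0 := by
      have : T = 0 ∨ T = 1 := by omega
      rcases this with rfl | rfl <;> simp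
    rw [hlog, mul_zero, zero_div] at hη'
    linarith
  have hT0 : (0 : ℝ) < T := by positivity
  have hlog2 : ∀ k : ℕ, 2 ≤ k → 1 / 2 ≤ Real.log k := by
    intro k hk
    have h1 : Real.log 2 ≤ Real.log k := Real.log_le_log (by norm_num) (by exact_mod_cast hk)
    linarith [Real.log_two_gt_d9]
  have hℓ := hlog2 m hm
  have hl := hlog2 T hT
  obtain ⟨q, hqdef⟩ : ∃ q : ℝ, q = √(Real.log m) := ⟨_, rfl⟩
  have hq : 1 / 2 ≤ q := by
    rw [hqdef]
    refine Real.le_sqrt_of_sq_le (le_trans ?_ hℓ)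
    norm_num
  obtain ⟨M, hM⟩ : ∃ M : ℝ, M = m / d := ⟨_, rfl⟩
  have hM0 : 0 < M := by rw [hM]; positivity
  have hw : √(n : ℝ) ^ 25 * q ^ 3 ≤ φ ^ 2 * √M := by
    rw [hqdef, hM]
    exact LocalSGD.le_sq_mul_sqrt_of_width hd0 hn0.le hφ hm0.le (by linarith) hwidth
  have hrpow : ∀ a : ℝ, 0 ≤ a → a ^ (3 / 2 : ℝ) = √a ^ 3 := fun a ha => by
    simpa using LocalSGD.rpow_natCast_div_two ha 3
  have hhor : (d : ℝ) * √(n : ℝ) ^ 45 * Real.log T ^ 3 * τ * √(Real.log m) ^ 3 / √φ ^ 11 ≤ T := by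
    have h1 : (n : ℝ) ^ (45 / 2 : ℝ) = √(n : ℝ) ^ 45 := by
      simpa using LocalSGD.rpow_natCast_div_two hn0.le 45
    have h2 : φ ^ (11 / 2 : ℝ) = √φ ^ 11 := by
      simpa using LocalSGD.rpow_natCast_div_two hφ.le 11
    rwa [h1, h2, hrpow _ (by linarith)] at hhorizon
  have hτ1 : (1 : ℝ) ≤ τ := by exact_mod_cast hτ
  have hstep0 := LocalSGD.stepSize_mul_le hd1 hn1 hφ hm0 hT0 hl (by positivity) hη hhor hη'
  rw [← hM, ← hqdef] at hstep0
  have hηM : 0 ≤ η * M := by positivity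
  have hstep : τ * (η * M) * (n : ℝ) ^ 20 ≤ 400 * φ :=
    LocalSGD.period_mul_stepSize_le (ℓ := Real.log m) hn1 hφ hφ2 (hqdef ▸ hq) hl (by positivity)
      (hqdef ▸ hstep0)
  have hηT : η * M * T * φ ≤ n ^ 2 * Real.log T := by
    rw [le_div_iff₀ (by positivity)] at hη'
    rw [hM]
    calc η * (m / d) * T * φ = η * (m * φ * T) / d := by ring
      _ ≤ d * n ^ 2 * Real.log T / d := by gcongr
      _ = _ := by field_simp
  have hsq : η * M * (η * M * T) * (n : ℝ) ^ 18 ≤ 192 := by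
    refine LocalSGD.stepSize_sq_mul_horizon_le (ℓ := Real.log m) hn1 hφ hφ2 (hqdef ▸ hq) hl hηM
      (by positivity) ?_ hηT
    refine le_trans ?_ hstep0
    rw [← hqdef]
    have hle : η * M ≤ τ * (η * M) := le_mul_of_one_le_left hηM hτ1
    have hfac : 0 ≤ √(n : ℝ) ^ 41 * Real.log T ^ 2 * q ^ 3 := by positivity
    linarith [mul_le_mul_of_nonneg_right hle hfac]
  have hβ0 : 0 < κ' * φ / 2 := by positivity
  have hβ1 : κ' * φ / 2 ≤ 1 := by nlinarith
  have hβsep : ∀ p p' : Fin K × Fin n, p' ≠ p → κ' * φ / 2 ≤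
      ‖x p'.1 p'.2 - (inner ℝ (x p.1 p.2) (x p'.1 p'.2) : ℝ) • x p.1 p.2‖ := by
    intro p p' hp
    have h := hsep p.1 p.2 p'.1 p'.2 (fun h => hp h.symm)
    refine LocalSGD.le_norm_sub_inner_smul (hx _ _) (hx _ _) hφ hκ0 hκ1 h.1 (le_trans ?_ h.2)
    have : κ' ≤ κ := hκ' ▸ min_le_right _ _
    gcongr
  have hinit := LocalSGD.initLaw_not_isGoodInit_le (m := m) (by omega) hd hK (by omega) hx hβ0 hβ1
    hβsep hn0 (ρ := φ / ((n : ℝ) ^ 7 * √M)) (θ := φ / (n : ℝ) ^ 5 * M) (by positivity)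
    (by positivity)
  have hfail := LocalSGD.init_failure_le hk hκ0 hκ1 hn1 hφ hφ2 hd1 hm0 hM hq hw
  have hlam : (m / d : ℝ) * (κ' * φ / 2) / (80 * (K * n : ℝ) ^ 2)
      = c₀ * (M * φ) / (n : ℝ) ^ 2 := by
    rw [hc₀, hM]
    field_simp
    norm_num
  rw [hlam, ← hM] at hinit
  have hnoise := LocalSGD.trainingLaw_exists_noise_le (m := m) hK hx y hη τ (2 * M) T
  have hnoise_fail : T * (4 * η * ((K * n) ^ 2 * (2 * M) * n)) ^ 2 ≤ 12288 * A / n := by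
    calc T * (4 * η * ((K * n) ^ 2 * (2 * M) * n)) ^ 2
        = 64 * (K : ℝ) ^ 4 * (η * M * (η * M * T) * (n : ℝ) ^ 18) / n ^ 12 := by
          field_simp
          ring
      _ ≤ 64 * A * 192 / n := by
          gcongr
          exact le_self_pow₀ hn1 (by norm_num)
      _ = 12288 * A / n := by ring
  refine le_trans ?_ (LocalSGD.one_sub_le_trainingLaw_real (by positivity) (by positivity) hinit
    hnoise ?_)
  · have h1 : C / n = (1000000000 * A + |B|) / n := by rw [hC]
    have h2 : 300000000 * A / n + 12288 * A / n ≤ C / n := by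
      rw [h1, ← add_div, div_le_div_iff_of_pos_right hn0]
      linarith [abs_nonneg B]
    rw [← hA] at hfail
    linarith
  intro ω hgood hnot t ht
  have hgood' := not_not.mp hgood
  have hnoise' : ∀ t ≤ T, η * ∑ s ∈ Finset.range t,
      LocalSGD.noise x y η τ ω.2.1 ω.1 s ω.2.2 ≤ 1 := by
    intro t ht
    by_contra h
    exact hnot ⟨hgood'.sum_sq_le, t, ht, not_le.mp h⟩
  obtain ⟨hres, havg, hloc, hrate⟩ := LocalSGD.trajectory_of_isGoodInit hK hx
    (fun i j => (hy i j).trans (le_abs_self B)) hη hτ hM0 hφ hφ2 hc0 hc1 hc (abs_nonneg B) hBn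
    hstep hq hw hgood' hnoise' ht
  have hω : 28 * K / c₀ * (√φ ^ 3 / ((n : ℝ) ^ 9 * q ^ 3))
      ≤ C * (φ ^ (3 / 2 : ℝ) / ((n : ℝ) ^ 9 * Real.log m ^ (3 / 2 : ℝ))) := by
    rw [hrpow _ hφ.le, hrpow _ (by linarith), ← hqdef]
    refine mul_le_mul_of_nonneg_right ?_ (by positivity)
    have h1 : 28 * K / c₀ = 4480 * ((K : ℝ) ^ 3 / κ') := by
      rw [hc₀]
      field_simp
      norm_num
    have h2 : (K : ℝ) ^ 3 / κ' ≤ (K : ℝ) ^ 7 / κ' := by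
      gcongr
      norm_num
    rw [h1, hC]
    linarith [abs_nonneg B]
  refine ⟨havg.trans hω, fun i => (hloc i).trans hω, ?_⟩
  refine (LocalSGD.globalLoss_le_of_norm_residual_sq_le hrate hn4 t hres (by positivity)).trans ?_
  have hL : 0 ≤ LocalSGD.globalLoss x y ω.2.1 ω.1 := by
    rw [LocalSGD.globalLoss_eq]
    positivity
  have hcoef : η * (c₀ * (M * φ) / (n : ℝ) ^ 2 / K) / 2
      = c₀ / (2 * K) * (η * m * φ / (d * (n : ℝ) ^ 2)) := by
    rw [hM]
    field_simp
  rw [hcoef]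
  -- The geometric term alone bounds the loss; the second term is merely nonnegative.
  exact le_add_of_nonneg_right (by positivity)
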